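/- Let $n\ge 1$. For a power series $f=\sum_I a_I z^I$ converging near $0\in\mathbb{C}^n$ let $\Gamma_+(f)\subset\mathbb{R}^n$ be the convex hull of $\bigcup_{a_I\neq 0}(I+\mathbb{R}_{\ge 0}^n)$, and let the Newton diagram $\Gamma_f$ be the union of the compact faces of $\Gamma_+(f)$. The series $f$ is commode if it contains a pure power of every variable with non-zero coefficient; it is Newton-non-degenerate if for every compact face $\sigma$ of $\Gamma_+(f)$ (of every dimension) the truncation $f|_\sigma=\sum_{I\in\sigma}a_Iz^I$ has no singular point on its zero set in the torus $(\mathbb{C}^*)^n$. A hypersurface germ $\{f=0\}\subset(\mathbb{C}^n,0)$ has ND-topological type $\mathbb{D}$ if a locally analytic change of coordinates fixing $0$ brings $f$ to a Newton-non-degenerate form with Newton diagram $\mathbb{D}$. The type $\mathbb{D}$ is $r$-determined if, for convergent germs, having type $\mathbb{D}$ depends only on the $r$-jet; the degree of determinacy of $\mathbb{D}$ is the least such $r$. Let $\mathbb{D}$ be the Newton diagram of a commode singular hypersurface germ in $(\mathbb{C}^n,0)$. Let $\Sigma_{\mathbb{D}}=\Sigma_{\mathbb{D}}^{d,n}$ be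 the set of hypersurfaces of degree $d$ in $\mathbb{P}^n$, regarded as points of $\mathbb{P}^{N_d}$, $N_d=\binom{d+n}{n}-1$, that have exactly one singular point, at which the germ has ND-topological type $\mathbb{D}$. Then the degree of determinacy of $\mathbb{D}$ is finite, and for every $d$ greater than it the stratum $\Sigma_{\mathbb{D}}$ is non-empty, constructible and irreducible in the Zariski topology of $\mathbb{P}^{N_d}$, and its closure $\overline{\Sigma}_{\mathbb{D}}$ in the classical topology is a (Zariski closed) irreducible algebraic subvariety of $\mathbb{P}^{N_d}$. -/

import Mathlib

open scoped LinearAlgebra.Projectivization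

noncomputable section

namespace NDStratum

/-! ### Germs, Newton polyhedra, Newton diagrams -/

/-- The power series `f` converges (absolutely) in some polydisc around the origin,
i.e. it is the Taylor series of a germ of an analytic function on `(ℂⁿ, 0)`. -/
def IsConvergent {n : ℕ} (f : MvPowerSeries (Fin n) ℂ) : Prop :=
  ∃ ρ : ℝ, 0 < ρ ∧ Summable fun I : Fin n →₀ ℕ => ‖MvPowerSeries.coeff I f‖ * ρ ^ I.degree

/-- The germ `{f = 0}` is a singular hypersurface germ at the origin:
`f` and all its first order partial derivatives vanish there. -/
def IsSingularGerm {n : ℕ} (f : MvPowerSeries (Fin n) ℂ) : Prop :=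
  MvPowerSeries.constantCoeff f = 0 ∧
    ∀ i : Fin n, MvPowerSeries.coeff (Finsupp.single i 1) f = 0

/-- `f` is commode (convenient): it contains a pure power of each of the variables. -/
def IsCommode {n : ℕ} (f : MvPowerSeries (Fin n) ℂ) : Prop :=
  ∀ i : Fin n, ∃ m : ℕ, MvPowerSeries.coeff (Finsupp.single i m) f ≠ 0

/-- The Newton polyhedron `Γ₊(f)`, the convex hull of the union of the orthants `I + ℝ₊ⁿ`
over all exponents `I` of monomials of `f`. -/
def newtonPolyhedron {n : ℕ} (f : MvPowerSeries (Fin n) ℂ) : Set (Fin n → ℝ) :=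
  convexHull ℝ {x | ∃ I : Fin n →₀ ℕ, MvPowerSeries.coeff I f ≠ 0 ∧ ∀ i, (I i : ℝ) ≤ x i}

/-- The Newton diagram of `f`, the union of the compact faces of `Γ₊(f)`. The compact faces are
those cut out by minimizing a linear form all of whose coefficients are positive. -/
def newtonDiagram {n : ℕ} (f : MvPowerSeries (Fin n) ℂ) : Set (Fin n → ℝ) :=
  {x | x ∈ newtonPolyhedron f ∧ ∃ w : Fin n → ℝ, (∀ i, 0 < w i) ∧
    ∀ y ∈ newtonPolyhedron f, ∑ i, w i * x i ≤ ∑ i, w i * y i}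

/-- The exponents of the monomials of `f` that lie on the compact face of `Γ₊(f)` cut out by the
linear form `w` (with positive coefficients), i.e. those on which `w` is minimal. -/
def faceSupport {n : ℕ} (w : Fin n → ℝ) (f : MvPowerSeries (Fin n) ℂ) : Set (Fin n →₀ ℕ) :=
  {I | MvPowerSeries.coeff I f ≠ 0 ∧
    ∀ J : Fin n →₀ ℕ, MvPowerSeries.coeff J f ≠ 0 → ∑ i, w i * (I i : ℝ) ≤ ∑ i, w i * (J i : ℝ)}

/-- A compact face carries finitely many monomials, so the sum in `facePart` is a finite one. -/
theorem faceSupport_finite {n : ℕ} (w : Fin n → ℝ) (hw : ∀ i, 0 < w i)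
    (f : MvPowerSeries (Fin n) ℂ) : (faceSupport w f).Finite := by
  rcases (faceSupport w f).eq_empty_or_nonempty with h | ⟨I₀, h₀⟩
  · rw [h]; exact Set.finite_empty
  · have key : ∀ I ∈ faceSupport w f, ∀ i, I i ≤ ⌈(∑ j, w j * (I₀ j : ℝ)) / w i⌉₊ := by
      intro I hI i
      have h1 := hI.2 I₀ h₀.1
      have h2 : w i * (I i : ℝ) ≤ ∑ j, w j * (I j : ℝ) :=
        Finset.single_le_sum (f := fun j => w j * (I j : ℝ))
          (fun j _ => mul_nonneg (hw j).le (Nat.cast_nonneg _)) (Finset.mem_univ i)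
      have h3 : (I i : ℝ) ≤ (∑ j, w j * (I₀ j : ℝ)) / w i := by
        rw [le_div_iff₀ (hw i)]; linarith
      exact_mod_cast h3.trans (Nat.le_ceil _)
    refine (Set.finite_Iic
      (Finsupp.equivFunOnFinite.symm fun i => ⌈(∑ j, w j * (I₀ j : ℝ)) / w i⌉₊)).subset ?_
    intro I hI i
    simpa using key I hI i

/-- The restriction (truncation) of `f` to the compact face of its Newton diagram cut out by the
positive linear form `w`. -/
def facePart {n : ℕ} (w : Fin n → ℝ) (f : MvPowerSeries (Fin n) ℂ) : MvPolynomial (Fin n) ℂ :=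
  ∑ᶠ I ∈ faceSupport w f, MvPolynomial.monomial I (MvPowerSeries.coeff I f)

/-- `f` is Newton-non-degenerate: its restriction to each face (of each dimension) of its Newton
diagram defines a hypersurface without singular points in the torus `(ℂ*)ⁿ`. -/
def IsNewtonNondegenerate {n : ℕ} (f : MvPowerSeries (Fin n) ℂ) : Prop :=
  ∀ w : Fin n → ℝ, (∀ i, 0 < w i) → ∀ z : Fin n → ℂ, (∀ i, z i ≠ 0) →
    ¬ (MvPolynomial.eval z (facePart w f) = 0 ∧
      ∀ i, MvPolynomial.eval z (MvPolynomial.pderiv i (facePart w f)) = 0)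

/-- `D` is the Newton diagram of a commode singular hypersurface germ in `(ℂⁿ, 0)`. -/
def IsCommodeDiagram {n : ℕ} (D : Set (Fin n → ℝ)) : Prop :=
  ∃ f : MvPowerSeries (Fin n) ℂ,
    IsConvergent f ∧ IsSingularGerm f ∧ IsCommode f ∧ newtonDiagram f = D

/-! ### The ND-topological type of a germ -/

/-- `ψ` is (the Taylor expansion of) a locally analytic transformation `(ℂⁿ, 0) → (ℂⁿ, 0)`: its
components are convergent and vanish at the origin, and its Jacobian there is invertible. -/
def IsLocalTransformation {n : ℕ} (ψ : Fin n → MvPowerSeries (Fin n) ℂ) : Prop :=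
  (∀ i, IsConvergent (ψ i)) ∧ (∀ i, MvPowerSeries.constantCoeff (ψ i) = 0) ∧
    IsUnit (Matrix.of fun i j => MvPowerSeries.coeff (Finsupp.single j 1) (ψ i)).det

/-- The germ `{f = 0}` has ND-topological type `D`: a locally analytic transformation brings it to
a Newton-non-degenerate form whose Newton diagram is `D`. -/
def HasNDType {n : ℕ} (D : Set (Fin n → ℝ)) (f : MvPowerSeries (Fin n) ℂ) : Prop :=
  ∃ ψ : Fin n → MvPowerSeries (Fin n) ℂ, IsLocalTransformation ψ ∧
    newtonDiagram (MvPowerSeries.subst ψ f) = D ∧ IsNewtonNondegenerate (MvPowerSeries.subst ψ f)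

/-- The type `D` is `r`-determined: whether a germ has ND-topological type `D` depends only on its
`r`-jet. The degree of determinacy of `D` is the least such `r`. -/
def IsDetermined {n : ℕ} (D : Set (Fin n → ℝ)) (r : ℕ) : Prop :=
  ∀ f g : MvPowerSeries (Fin n) ℂ, IsConvergent f → IsConvergent g → HasNDType D f →
    (∀ I : Fin n →₀ ℕ, I.degree ≤ r → MvPowerSeries.coeff I f = MvPowerSeries.coeff I g) →
      HasNDType D g

/-! ### The parameter space of hypersurfaces and the strata -/

/-- The exponents of the monomials of degree `d` in the homogeneous coordinates
`x₀, …, xₙ` of `ℙⁿ`. -/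
abbrev Exponents (n d : ℕ) : Type :=
  {I : Fin (n + 1) →₀ ℕ // I ∈ Finset.finsuppAntidiag (Finset.univ : Finset (Fin (n + 1))) d}

/-- The parameter space of the hypersurfaces of degree `d` in `ℙⁿ`: the projective space of
dimension `(d+n choose n) - 1` whose homogeneous coordinates are the coefficients of a form. -/
abbrev HypersurfaceSpace (n d : ℕ) : Type := ℙ ℂ (Exponents n d → ℂ)

/-- The form `∑ a_I x^I` of degree `d` with the coefficients `a`. -/
def form {n d : ℕ} (a : Exponents n d → ℂ) : MvPolynomial (Fin (n + 1)) ℂ :=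
  ∑ I : Exponents n d, MvPolynomial.monomial I.1 (a I)

/-- The set of singular points of the projective hypersurface `{F = 0}`. -/
def singularPoints {n : ℕ} (F : MvPolynomial (Fin (n + 1)) ℂ) : Set (ℙ ℂ (Fin (n + 1) → ℂ)) :=
  {x | MvPolynomial.eval x.rep F = 0 ∧ ∀ i, MvPolynomial.eval x.rep (MvPolynomial.pderiv i F) = 0}

/-- The local equation `F (A · (1, z₁, …, zₙ))` of the hypersurface `{F = 0}` in the affine
coordinates `z` defined by an invertible matrix `A`; they are centred at the point of `ℙⁿ` given
by column `0` of `A`. -/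
def localEquation {n : ℕ} (F : MvPolynomial (Fin (n + 1)) ℂ)
    (A : Matrix (Fin (n + 1)) (Fin (n + 1)) ℂ) : MvPolynomial (Fin n) ℂ :=
  MvPolynomial.aeval
    (fun i => MvPolynomial.C (A i 0) +
      ∑ j : Fin n, MvPolynomial.C (A i j.succ) * MvPolynomial.X j) F

/-- The germ of `{F = 0}` at `x`, written in some affine coordinates centred at `x`,
has ND-topological type `D`. -/
def HasNDTypeAt {n : ℕ} (D : Set (Fin n → ℝ)) (F : MvPolynomial (Fin (n + 1)) ℂ)
    (x : ℙ ℂ (Fin (n + 1) → ℂ)) : Prop :=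
  ∃ A : Matrix (Fin (n + 1)) (Fin (n + 1)) ℂ, IsUnit A.det ∧ (∀ i, A i 0 = x.rep i) ∧
    HasNDType D (localEquation F A : MvPowerSeries (Fin n) ℂ)

/-- The ND-topological equisingular stratum of `D`: the hypersurfaces of degree `d` in `ℙⁿ` with
exactly one singular point, at which the germ has ND-topological type `D`. -/
def stratum (n d : ℕ) (D : Set (Fin n → ℝ)) : Set (HypersurfaceSpace n d) :=
  {p | ∃ x, singularPoints (form p.rep) = {x} ∧ HasNDTypeAt D (form p.rep) x}

/-! ### The two topologies of a projective space -/

/-- The Zariski topology of the complex projective space with homogeneous coordinates indexed by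
`ι`. The complements of hypersurfaces form a basis of it. -/
@[reducible] def zariskiTopology (ι : Type) : TopologicalSpace (ℙ ℂ (ι → ℂ)) :=
  TopologicalSpace.generateFrom
    {U | ∃ (k : ℕ) (F : MvPolynomial ι ℂ), F.IsHomogeneous k ∧
      U = {p | MvPolynomial.eval p.rep F ≠ 0}}

/-- The classical topology of the complex projective space: the quotient topology
of `ℂ^ι ∖ {0}`. -/
@[reducible] def classicalTopology (ι : Type) : TopologicalSpace (ℙ ℂ (ι → ℂ)) :=
  TopologicalSpace.coinduced (Projectivization.mk' ℂ) inferInstance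

/-- The closure in the classical topology. -/
def classicalClosure {ι : Type} (S : Set (ℙ ℂ (ι → ℂ))) : Set (ℙ ℂ (ι → ℂ)) :=
  @closure _ (classicalTopology ι) S

end NDStratum

end

noncomputable section
namespace NDStratum

/-! ### Polynomial functions and constructible subsets of affine space -/

open MvPolynomial Topology

/-! The affine cone over the stratum, without its vertex, is exactly the image of a polynomial map
`paramForm` on a dense constructible subset `goodParams` of an affine space. Every assertion about
the stratum follows from this (`conclusions_of_parametrization`).

Germs. A series is non-degenerate with diagram `D` iff its support lies in the set `E` of lattice
points of the Newton polyhedron and, for finitely many finite sets of exponents (the compact faces),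
its truncation is smooth in the torus (`exists_ndCondition`). As `D` is commode, the faces have
degree at most some `R`, and `E` contains all exponents of degree at least `R`. So the `R`-jet
decides, and `D` is `R`-determined. Modulo high order, coordinate changes and their inverses may be
taken polynomial: type `D` then means that the jet of the germ is that of `g ∘ φ`, with `g` a
non-degenerate polynomial supported in `E` and `φ` a polynomial coordinate change
(`hasNDType_iff_jet`).

Parameters. Move the singular point to `[1 : 0 : … : 0]`; setting the first coordinate equal to one
identifies the coefficients of a form with those of its local equation. If `D` is `r`-determined and
`r < d`, it suffices to prescribe the `r`-jet as that of `g ∘ φ`, to leave the other coefficients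
free, and to apply a linear change of coordinates (`mk_mem_stratum_iff_exists_goodParams`). The good
parameters are dense by general position: generic coefficients make every face smooth in the torus
(`ae_not_singular`), and since the powers `x_j ^ d` with `j ≥ 1` are among the free monomials, a
Bertini argument removes all other singular points (`ae_singular_subset`). Both rest on an easy form
of Sard's lemma.

Geometry. Chevalley's theorem gives constructibility, and density in an affine space gives
irreducibility. The classical closure equals the Zariski closure because a nonempty Zariski open
subset of an irreducible affine variety is classically dense (`mem_closure_of_ne_zero`); this comes
from Noether normalization and the continuity of roots. -/

/-- A function on affine space given by a polynomial. -/
def IsPoly {P : Type*} (f : (P → ℂ) → ℂ) : Prop := ∃ p : MvPolynomial P ℂ, ∀ x, f x = eval x p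

namespace IsPoly

variable {P Q : Type*} {f g : (P → ℂ) → ℂ}

theorem const (c : ℂ) : IsPoly fun _ : P → ℂ => c := ⟨C c, by simp⟩

theorem coord (i : P) : IsPoly fun x : P → ℂ => x i := ⟨X i, by simp⟩

theorem add (hf : IsPoly f) (hg : IsPoly g) : IsPoly fun x => f x + g x := by
  obtain ⟨p, hp⟩ := hf
  obtain ⟨q, hq⟩ := hg
  exact ⟨p + q, by simp [hp, hq]⟩

theorem mul (hf : IsPoly f) (hg : IsPoly g) : IsPoly fun x => f x * g x := by
  obtain ⟨p, hp⟩ := hf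
  obtain ⟨q, hq⟩ := hg
  exact ⟨p * q, by simp [hp, hq]⟩

theorem pow (hf : IsPoly f) (k : ℕ) : IsPoly fun x => f x ^ k := by
  obtain ⟨p, hp⟩ := hf
  exact ⟨p ^ k, by simp [hp]⟩

theorem sum {α : Type*} (s : Finset α) {f : α → (P → ℂ) → ℂ} (hf : ∀ a ∈ s, IsPoly (f a)) :
    IsPoly fun x => ∑ a ∈ s, f a x := by
  choose! p hp using hf
  exact ⟨∑ a ∈ s, p a, fun x => by
    rw [map_sum]; exact Finset.sum_congr rfl fun a ha => hp a ha x⟩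

theorem prod {α : Type*} (s : Finset α) {f : α → (P → ℂ) → ℂ} (hf : ∀ a ∈ s, IsPoly (f a)) :
    IsPoly fun x => ∏ a ∈ s, f a x := by
  choose! p hp using hf
  exact ⟨∏ a ∈ s, p a, fun x => by
    rw [map_prod]; exact Finset.prod_congr rfl fun a ha => hp a ha x⟩

theorem comp {f : (Q → ℂ) → ℂ} (hf : IsPoly f) {g : (P → ℂ) → Q → ℂ}
    (hg : ∀ j, IsPoly fun x => g x j) : IsPoly fun x => f (g x) := by
  obtain ⟨p, hp⟩ := hf
  choose q hq using hg
  refine ⟨bind₁ q p, fun x => ?_⟩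
  simp only [hp, show g x = fun j => eval x (q j) from funext fun j => hq j x]
  rw [← coe_aeval_eq_eval, ← coe_aeval_eq_eval, RingHom.coe_coe, RingHom.coe_coe, aeval_bind₁]

theorem continuous (hf : IsPoly f) : Continuous f := by
  obtain ⟨p, hp⟩ := hf
  rw [funext hp]
  exact p.continuous_eval

theorem det {m : Type*} [Fintype m] [DecidableEq m] {A : (P → ℂ) → Matrix m m ℂ}
    (hA : ∀ i j, IsPoly fun x => A x i j) : IsPoly fun x => (A x).det := by
  simp only [Matrix.det_apply']
  exact sum _ fun σ _ => (const _).mul (prod _ fun i _ => hA _ _)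

end IsPoly

/-- A constructible subset of affine space. -/
def IsCon {P : Type*} (S : Set (P → ℂ)) : Prop :=
  ∃ T : Set (PrimeSpectrum (MvPolynomial P ℂ)), IsConstructible T ∧
    ∀ x, x ∈ S ↔ (pointToPoint x : PrimeSpectrum (MvPolynomial P ℂ)) ∈ T

theorem mem_pointToPoint {P : Type*} (x : P → ℂ) (p : MvPolynomial P ℂ) :
    p ∈ (pointToPoint x : PrimeSpectrum (MvPolynomial P ℂ)).asIdeal ↔ eval x p = 0 := by
  rw [← aeval_eq_eval]
  exact mem_vanishingIdeal_singleton_iff x p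

namespace IsCon

variable {P Q : Type*} {S T : Set (P → ℂ)}

theorem inter (hS : IsCon S) (hT : IsCon T) : IsCon {x | x ∈ S ∧ x ∈ T} := by
  obtain ⟨S', hS', h⟩ := hS
  obtain ⟨T', hT', h'⟩ := hT
  exact ⟨S' ∩ T', hS'.inter hT', fun x => by simp [h, h']⟩

theorem not (hS : IsCon S) : IsCon {x | x ∉ S} := by
  obtain ⟨S', hS', h⟩ := hS
  exact ⟨S'ᶜ, hS'.compl, fun x => by simp [h]⟩

theorem forall_finite {α : Type*} [Finite α] {S : α → Set (P → ℂ)} (hS : ∀ a, IsCon (S a)) :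
    IsCon {x | ∀ a, x ∈ S a} := by
  choose S' hS' h using hS
  exact ⟨⋂ a, S' a, .iInter hS', fun x => by simp [h]⟩

theorem ne_zero {f : (P → ℂ) → ℂ} (hf : IsPoly f) : IsCon {x | f x ≠ 0} := by
  obtain ⟨p, hp⟩ := hf
  refine ⟨PrimeSpectrum.basicOpen p, PrimeSpectrum.isConstructible_basicOpen, fun x => ?_⟩
  have := mem_pointToPoint x p
  simp [hp, this]

theorem eq_zero {f : (P → ℂ) → ℂ} (hf : IsPoly f) : IsCon {x | f x = 0} := by
  simpa using (ne_zero hf).not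

theorem exists_finset {S : Set (P → ℂ)} (hS : IsCon S) :
    ∃ s : Finset (PrimeSpectrum.BasicConstructibleSetData (MvPolynomial P ℂ)),
      ∀ x, x ∈ S ↔ ∃ c ∈ s, (∀ i, eval x (c.g i) = 0) ∧ eval x c.f ≠ 0 := by
  obtain ⟨T, hT, h⟩ := hS
  obtain ⟨s, rfl⟩ := PrimeSpectrum.exists_constructibleSetData_iff.2 hT
  refine ⟨s, fun x => ?_⟩
  rw [h]
  simp only [PrimeSpectrum.ConstructibleSetData.toSet,
    PrimeSpectrum.BasicConstructibleSetData.toSet, Set.mem_iUnion, Set.mem_sdiff,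
    PrimeSpectrum.mem_zeroLocus, Set.singleton_subset_iff, Set.range_subset_iff, SetLike.mem_coe,
    mem_pointToPoint, exists_prop, ne_eq]

theorem preimage {S : Set (Q → ℂ)} (hS : IsCon S) {g : (P → ℂ) → Q → ℂ}
    (hg : ∀ j, IsPoly fun x => g x j) : IsCon {x | g x ∈ S} := by
  obtain ⟨s, hs⟩ := hS.exists_finset
  have key : ∀ q : MvPolynomial Q ℂ, IsPoly fun x => eval (g x) q := fun q =>
    IsPoly.comp ⟨q, fun _ => rfl⟩ hg
  have : IsCon {x | ∀ c : s, x ∈ {x | x ∉ {x | (∀ i, x ∈ {x | eval (g x) (c.1.g i) = 0}) ∧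
      x ∈ {x | eval (g x) c.1.f ≠ 0}}}} :=
    forall_finite fun c => (inter (forall_finite fun i => eq_zero (key _)) (ne_zero (key _))).not
  convert this.not using 1
  ext x
  simp [hs]

/-- Chevalley's theorem for a projection of affine spaces. -/
theorem exists_right [Finite P] [Finite Q] {S : Set (P ⊕ Q → ℂ)} (hS : IsCon S) :
    IsCon {x : P → ℂ | ∃ y : Q → ℂ, Sum.elim x y ∈ S} := by
  obtain ⟨s, hs⟩ := hS.exists_finset
  let T : Set (PrimeSpectrum (MvPolynomial (P ⊕ Q) ℂ)) :=
    PrimeSpectrum.ConstructibleSetData.toSet s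
  have hT : IsConstructible T := PrimeSpectrum.ConstructibleSetData.isConstructible_toSet s
  let φ : MvPolynomial P ℂ →ₐ[ℂ] MvPolynomial (P ⊕ Q) ℂ := rename Sum.inl
  have hφ : φ.toRingHom.FinitePresentation := by
    -- Finite presentation over `ℂ` descends to `φ` because the source is of finite type over `ℂ`.
    refine AlgHom.FinitePresentation.of_comp_finiteType (Algebra.ofId ℂ _) (g := φ) ?_ ?_
    · rw [Subsingleton.elim (φ.comp (Algebra.ofId ℂ _)) (Algebra.ofId ℂ _)]
      exact RingHom.finitePresentation_algebraMap.2
        (inferInstance : Algebra.FinitePresentation ℂ (MvPolynomial (P ⊕ Q) ℂ))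
    · exact RingHom.finiteType_algebraMap.2
        (inferInstance : Algebra.FiniteType ℂ (MvPolynomial P ℂ))
  refine ⟨_, PrimeSpectrum.isConstructible_comap_image hφ hT, fun x => ?_⟩
  have hmem : ∀ q : PrimeSpectrum (MvPolynomial (P ⊕ Q) ℂ), q ∈ T ↔
      ∃ c ∈ s, (∀ i, c.g i ∈ q.asIdeal) ∧ c.f ∉ q.asIdeal := fun q => by
    simp only [T, PrimeSpectrum.ConstructibleSetData.toSet,
      PrimeSpectrum.BasicConstructibleSetData.toSet, Set.mem_iUnion, Set.mem_sdiff,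
      PrimeSpectrum.mem_zeroLocus, Set.singleton_subset_iff, Set.range_subset_iff, SetLike.mem_coe,
      exists_prop]
  constructor
  · rintro ⟨y, hy⟩
    refine ⟨pointToPoint (Sum.elim x y), ?_, ?_⟩
    · rw [hmem]
      simpa only [mem_pointToPoint] using (hs _).1 hy
    · ext p
      rw [mem_pointToPoint]
      change φ p ∈ (pointToPoint (Sum.elim x y) :
        PrimeSpectrum (MvPolynomial (P ⊕ Q) ℂ)).asIdeal ↔ _
      rw [mem_pointToPoint]
      simp only [φ, eval_rename]
      rfl
  · rintro ⟨q, hq, hqx⟩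
    obtain ⟨c, hc, h1, h2⟩ := (hmem q).1 hq
    have hprime := q.isPrime
    -- The prime `q` over the closed point `x` need not be closed. By the Nullstellensatz its zero
    -- locus has a point `z` where `c.f` is nonzero, and `z` lies over `x` because `q` contains
    -- every `X i - x i`.
    have hv := MvPolynomial.IsPrime.vanishingIdeal_zeroLocus (K := ℂ) q.asIdeal
    rw [← hv, mem_vanishingIdeal_iff] at h2
    push Not at h2
    obtain ⟨z, hz, hz2⟩ := h2
    have hzx : ∀ i, z (Sum.inl i) = x i := fun i => by
      have : (X i - C (x i) : MvPolynomial P ℂ) ∈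
          (pointToPoint x : PrimeSpectrum (MvPolynomial P ℂ)).asIdeal := by
        rw [mem_pointToPoint]; simp
      rw [← hqx] at this
      have h3 := hz _ this
      simpa [φ, sub_eq_zero] using h3
    refine ⟨z ∘ Sum.inr, (hs _).2 ⟨c, hc, ?_⟩⟩
    have hz' : Sum.elim x (z ∘ Sum.inr) = z := by
      ext (i | j) <;> simp [hzx]
    rw [hz']
    exact ⟨fun i => by simpa [aeval_eq_eval] using hz _ (h1 i), by simpa [aeval_eq_eval] using hz2⟩

theorem exists_finite [Finite P] [Finite Q] {R : (P → ℂ) → (Q → ℂ) → Prop}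
    (h : IsCon {z : P ⊕ Q → ℂ | R (z ∘ Sum.inl) (z ∘ Sum.inr)}) :
    IsCon {x : P → ℂ | ∃ y, R x y} := by
  simpa using h.exists_right

theorem image [Finite P] [Finite Q] {S : Set (Q → ℂ)} (hS : IsCon S) {g : (Q → ℂ) → P → ℂ}
    (hg : ∀ j, IsPoly fun x => g x j) : IsCon (g '' S) := by
  have : IsCon {x : P → ℂ | ∃ y : Q → ℂ, y ∈ S ∧ ∀ j, g y j = x j} := by
    refine exists_finite (R := fun x y => y ∈ S ∧ ∀ j, g y j = x j) ?_
    refine inter (S := {z : P ⊕ Q → ℂ | z ∘ Sum.inr ∈ S})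
      (hS.preimage fun j => IsPoly.coord _) ?_
    refine forall_finite (S := fun j => {z : P ⊕ Q → ℂ | g (z ∘ Sum.inr) j = (z ∘ Sum.inl) j})
      fun j => ?_
    have h1 : IsPoly fun z : P ⊕ Q → ℂ => g (z ∘ Sum.inr) j + (-1) * z (Sum.inl j) :=
      ((hg j).comp fun j => IsPoly.coord _).add ((IsPoly.const _).mul (IsPoly.coord _))
    convert eq_zero h1 using 1
    ext z
    simp [← sub_eq_add_neg, sub_eq_zero]
  convert this using 1
  ext x
  simp [funext_iff]

end IsCon

end NDStratum
end

noncomputable section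
namespace NDStratum

/-! ### Zariski closures and classical closures -/

open MvPolynomial Topology Filter

/-- A ball for the sup norm is a product of discs, and a polynomial vanishing on a product of
infinite sets is zero. -/
theorem dense_eval_ne_zero {P : Type*} [Finite P] {p : MvPolynomial P ℂ} (hp : p ≠ 0) :
    Dense {x | eval x p ≠ 0} := by
  rw [← compl_compl {x | eval x p ≠ 0}, ← interior_eq_empty_iff_dense_compl,
    Set.eq_empty_iff_forall_notMem]
  intro x hx
  have := Fintype.ofFinite P
  rw [mem_interior_iff_mem_nhds, Metric.mem_nhds_iff] at hx
  obtain ⟨ε, hε, hx⟩ := hx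
  refine hp (MvPolynomial.funext_set (fun i => Metric.ball (x i) ε) (fun i => ?_) fun y hy => ?_)
  · exact infinite_of_mem_nhds (x i) (Metric.ball_mem_nhds _ hε)
  · have : y ∈ Metric.ball x ε := by
      rw [ball_pi _ hε]
      exact hy
    simpa using hx this

/-! ### Complex points of integral extensions of a polynomial ring -/

section IntegralExtension

variable {s : ℕ} {A : Type*} [CommRing A] [Algebra ℂ A]
  [Algebra (MvPolynomial (Fin s) ℂ) A]

/-- A complex point of `A` annihilates the specialized polynomials that annihilate an element. -/
theorem eval_map_of_aeval_eq_zero (χ : A →ₐ[ℂ] ℂ) (y : Fin s → ℂ)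
    (hχ : ∀ p, χ (algebraMap (MvPolynomial (Fin s) ℂ) A p) = eval y p) {a : A}
    {F : Polynomial (MvPolynomial (Fin s) ℂ)} (hF : Polynomial.aeval a F = 0) :
    (F.map (eval y)).eval (χ a) = 0 := by
  have h : (χ : A →+* ℂ).comp (algebraMap (MvPolynomial (Fin s) ℂ) A) = eval y :=
    RingHom.ext hχ
  have := congrArg (χ : A →+* ℂ) hF
  rw [Polynomial.aeval_def, Polynomial.hom_eval₂, h, map_zero] at this
  rw [Polynomial.eval_map]
  exact this

variable [Algebra.IsIntegral (MvPolynomial (Fin s) ℂ) A]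

/-- The polynomial ring is integrally closed, so the relations of `a` over it are the multiples of
the minimal polynomial, and all of them vanish at `(y, τ)`. Lying over then gives a maximal ideal of
`A` above that point, with residue field `ℂ` by the Nullstellensatz. -/
theorem exists_algHom_of_root [IsScalarTower ℂ (MvPolynomial (Fin s) ℂ) A] [IsDomain A] [Algebra.FiniteType ℂ A]
    [Module.IsTorsionFree (MvPolynomial (Fin s) ℂ) A] (a : A) (y : Fin s → ℂ) (τ : ℂ)
    (hτ : ((minpoly (MvPolynomial (Fin s) ℂ) a).map (eval y)).eval τ = 0) :
    ∃ χ : A →ₐ[ℂ] ℂ, (∀ p, χ (algebraMap (MvPolynomial (Fin s) ℂ) A p) = eval y p) ∧ χ a = τ := by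
  let θ : Polynomial (MvPolynomial (Fin s) ℂ) →+* ℂ := Polynomial.eval₂RingHom (eval y) τ
  let ρ : Polynomial (MvPolynomial (Fin s) ℂ) →+* A := (Polynomial.aeval a : Polynomial (MvPolynomial (Fin s) ℂ) →ₐ[MvPolynomial (Fin s) ℂ] A).toRingHom
  have hθ : Function.Surjective θ := fun c => ⟨Polynomial.C (C c), by simp [θ]⟩
  have hmax : (RingHom.ker θ).IsMaximal := RingHom.ker_isMaximal_of_surjective θ hθ
  let alg : Algebra (Polynomial (MvPolynomial (Fin s) ℂ)) A := ρ.toAlgebra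
  have htow : IsScalarTower (MvPolynomial (Fin s) ℂ) (Polynomial (MvPolynomial (Fin s) ℂ)) A := IsScalarTower.of_algebraMap_eq fun r => by
    change _ = ρ (Polynomial.C r)
    simp [ρ]
  have hint : Algebra.IsIntegral (Polynomial (MvPolynomial (Fin s) ℂ)) A := Algebra.IsIntegral.tower_top (MvPolynomial (Fin s) ℂ)
  have hker : RingHom.ker (algebraMap (Polynomial (MvPolynomial (Fin s) ℂ)) A) ≤ RingHom.ker θ := by
    intro p hp
    have hp' : Polynomial.aeval a p = 0 := hp
    obtain ⟨q, rfl⟩ := minpoly.isIntegrallyClosed_dvd (Algebra.IsIntegral.isIntegral (R := MvPolynomial (Fin s) ℂ) a) hp'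
    rw [RingHom.mem_ker, map_mul]
    have : θ (minpoly (MvPolynomial (Fin s) ℂ) a) = 0 := by
      rw [← hτ, Polynomial.eval_map]
      rfl
    rw [this, zero_mul]
  obtain ⟨M, hM, hMθ⟩ := Ideal.exists_ideal_over_maximal_of_isIntegral (RingHom.ker θ) hker
  let K := A ⧸ M
  let : Field K := Ideal.Quotient.field M
  have : Algebra.FiniteType ℂ K :=
    Algebra.FiniteType.of_surjective (Ideal.Quotient.mkₐ ℂ M) Ideal.Quotient.mk_surjective
  have : Module.Finite ℂ K := finite_of_finite_type_of_isJacobsonRing ℂ K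
  have hbij : Function.Bijective (algebraMap ℂ K) := IsAlgClosed.algebraMap_bijective_of_isIntegral
  let e : ℂ ≃ₐ[ℂ] K := AlgEquiv.ofBijective (Algebra.ofId ℂ K) hbij
  let χ : A →ₐ[ℂ] ℂ := e.symm.toAlgHom.comp (Ideal.Quotient.mkₐ ℂ M)
  have hχM : ∀ u ∈ M, χ u = 0 := fun u hu => by
    have : Ideal.Quotient.mkₐ ℂ M u = 0 := Ideal.Quotient.eq_zero_iff_mem.2 hu
    simp [χ, this]
  have key : ∀ p : Polynomial (MvPolynomial (Fin s) ℂ), χ (ρ p) = θ p := fun p => by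
    have h1 : p - Polynomial.C (C (θ p)) ∈ RingHom.ker θ := by
      simp [RingHom.mem_ker, θ]
    rw [← hMθ] at h1
    have h2 := hχM _ h1
    change χ (ρ (p - Polynomial.C (C (θ p)))) = 0 at h2
    have h3 : ρ (Polynomial.C (C (θ p))) = algebraMap ℂ A (θ p) := by
      simp only [ρ, AlgHom.toRingHom_eq_coe, RingHom.coe_coe, Polynomial.aeval_C]
      rw [IsScalarTower.algebraMap_apply ℂ (MvPolynomial (Fin s) ℂ) A]
      rfl
    rw [map_sub, map_sub, h3, AlgHom.commutes, sub_eq_zero] at h2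
    exact h2
  refine ⟨χ, fun p => ?_, ?_⟩
  · have := key (Polynomial.C p)
    simpa [ρ, θ] using this
  · have := key Polynomial.X
    simpa [ρ, θ] using this

/-- A point over `y` sends each generator to a root of its specialized minimal polynomial. -/
theorem finite_fibre {ι : Type*} [Finite ι] (b : ι → A) (hb : Algebra.adjoin ℂ (Set.range b) = ⊤)
    (y : Fin s → ℂ) :
    {χ : A →ₐ[ℂ] ℂ | ∀ p, χ (algebraMap (MvPolynomial (Fin s) ℂ) A p) = eval y p}.Finite := by
  let F : ι → Polynomial ℂ := fun i => (minpoly (MvPolynomial (Fin s) ℂ) (b i)).map (eval y)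
  have hF : ∀ i, F i ≠ 0 := fun i =>
    ((minpoly.monic (Algebra.IsIntegral.isIntegral (b i))).map _).ne_zero
  refine Set.Finite.of_finite_image (f := fun χ i => χ (b i))
    ((Set.Finite.pi' fun i => (F i).rootSet_finite ℂ).subset ?_) ?_
  · rintro _ ⟨χ, hχ, rfl⟩ i
    rw [Polynomial.mem_rootSet]
    exact ⟨hF i, by
      simpa [F] using eval_map_of_aeval_eq_zero χ y hχ
        (minpoly.aeval (MvPolynomial (Fin s) ℂ) (b i))⟩
  · intro χ _ χ' _ h
    refine AlgHom.ext_of_adjoin_eq_top hb ?_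
    rintro _ ⟨i, rfl⟩
    exact congrFun h i

end IntegralExtension

/-- The norms of the roots multiply to that of the constant coefficient, so they cannot all exceed
its `natDegree`-th root. -/
theorem exists_root_norm_pow_le {F : Polynomial ℂ} (hF : F.Monic) (hd : F.natDegree ≠ 0) :
    ∃ τ : ℂ, F.eval τ = 0 ∧ ‖τ‖ ^ F.natDegree ≤ ‖F.coeff 0‖ := by
  have hs : F.Splits := IsAlgClosed.splits F
  have hc : F.roots.card = F.natDegree := hs.natDegree_eq_card_roots.symm
  by_contra! hcon
  have h1 : ‖F.coeff 0‖ = (F.roots.map fun z => ‖z‖).prod := by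
    rw [hs.coeff_zero_eq_prod_roots_of_monic hF, norm_mul, norm_pow, norm_neg, norm_one, one_pow,
      one_mul]
    exact map_multiset_prod (normHom : ℂ →*₀ ℝ) _
  by_cases h0 : F.coeff 0 = 0
  · have := hcon 0 (by rw [← Polynomial.coeff_zero_eq_eval_zero, h0])
    simp [h0, hd] at this
  obtain ⟨δ, hδ0, hδ⟩ : ∃ δ : ℝ, 0 ≤ δ ∧ δ ^ F.natDegree = ‖F.coeff 0‖ :=
    ⟨‖F.coeff 0‖ ^ ((F.natDegree : ℝ)⁻¹), by positivity,
      Real.rpow_inv_natCast_pow (norm_nonneg _) hd⟩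
  have hlt : ∀ z ∈ F.roots, δ < ‖z‖ := fun z hz =>
    lt_of_pow_lt_pow_left₀ F.natDegree (norm_nonneg _)
      (hδ ▸ hcon z (Polynomial.isRoot_of_mem_roots hz))
  have hδ1 : 0 < δ := by
    refine lt_of_le_of_ne hδ0 fun h => h0 ?_
    rw [← norm_eq_zero, ← hδ, ← h, zero_pow hd]
  have h2 : (F.roots.map fun _ => δ).prod < (F.roots.map fun z => ‖z‖).prod :=
    Multiset.prod_map_lt_prod_map (by
      intro h
      rw [h] at hc
      exact hd (by simpa using hc.symm)) _ _ (fun _ _ => hδ1) hlt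
  rw [Multiset.map_const', Multiset.prod_replicate, hc, hδ, h1] at h2
  exact lt_irrefl _ h2


/-! ### Classical limits of complex points -/

section Limits

variable {s : ℕ}

theorem continuous_coeff_map_eval (F : Polynomial (MvPolynomial (Fin s) ℂ)) (j : ℕ) :
    Continuous fun y : Fin s → ℂ => (F.map (eval y)).coeff j := by
  simp only [Polynomial.coeff_map]
  exact (F.coeff j).continuous_eval

/-- The polynomial stays monic under specialization and its other coefficients are continuous in
`y`, so the Cauchy bound is uniform near `y₀`. This supplies the compactness needed for limits of
points. -/
theorem cauchyBound_map_eval_eventually_le {F : Polynomial (MvPolynomial (Fin s) ℂ)} (hF : F.Monic)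
    (y₀ : Fin s → ℂ) :
    ∃ K : ℝ, ∀ᶠ y in 𝓝 y₀, ∀ z : ℂ, (F.map (eval y)).eval z = 0 → ‖z‖ ≤ K := by
  have h1 : ∀ᶠ y in 𝓝 y₀, ∀ j ∈ Finset.range F.natDegree,
      ‖(F.map (eval y)).coeff j‖₊ < ‖(F.map (eval y₀)).coeff j‖₊ + 1 := by
    rw [Filter.eventually_all_finset]
    intro j _
    exact (continuous_coeff_map_eval F j).nnnorm.continuousAt.eventually_lt_const
      (lt_add_of_pos_right _ one_pos)
  refine ⟨(∑ j ∈ Finset.range F.natDegree, (‖(F.map (eval y₀)).coeff j‖₊ + 1) + 1 : NNReal), ?_⟩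
  filter_upwards [h1] with y hy z hz
  have hm : (F.map (eval y)).Monic := hF.map _
  have h2 := (Polynomial.IsRoot.norm_lt_cauchyBound hm.ne_zero hz).le
  have h3 : (F.map (eval y)).cauchyBound ≤
      ∑ j ∈ Finset.range F.natDegree, (‖(F.map (eval y₀)).coeff j‖₊ + 1) + 1 := by
    rw [Polynomial.cauchyBound, hm.leadingCoeff, hF.natDegree_map, nnnorm_one, div_one]
    gcongr
    refine Finset.sup_le fun j hj => (hy j hj).le.trans ?_
    exact Finset.single_le_sum (f := fun j => ‖(F.map (eval y₀)).coeff j‖₊ + 1)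
      (fun _ _ => zero_le) hj
  exact h2.trans (by exact_mod_cast h3)

/-- A nonempty Zariski open subset of an irreducible affine variety is dense in the classical
topology. -/
theorem mem_closure_of_finite {A : Type*} [CommRing A] [IsDomain A] [Algebra ℂ A]
    [Algebra (MvPolynomial (Fin s) ℂ) A] [IsScalarTower ℂ (MvPolynomial (Fin s) ℂ) A]
    [Algebra.IsIntegral (MvPolynomial (Fin s) ℂ) A] [Algebra.FiniteType ℂ A]
    [Module.IsTorsionFree (MvPolynomial (Fin s) ℂ) A]
    {ι : Type*} [Finite ι] (b : ι → A) (hb : Algebra.adjoin ℂ (Set.range b) = ⊤)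
    {f : A} (hf : f ≠ 0) (χ₀ : A →ₐ[ℂ] ℂ) :
    (fun i => χ₀ (b i)) ∈ closure {v | ∃ χ : A →ₐ[ℂ] ℂ, χ f ≠ 0 ∧ v = fun i => χ (b i)} := by
  classical
  let y₀ : Fin s → ℂ := fun j => χ₀ (algebraMap (MvPolynomial (Fin s) ℂ) A (X j))
  have hy₀ : ∀ p, χ₀ (algebraMap (MvPolynomial (Fin s) ℂ) A p) = eval y₀ p := fun p => by
    have : (χ₀.comp (IsScalarTower.toAlgHom ℂ (MvPolynomial (Fin s) ℂ) A)) = aeval y₀ := by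
      ext j
      simp [y₀]
    simpa [← aeval_eq_eval] using DFunLike.congr_fun this p
  -- Since `f` divides `h`, it is nonzero at every point lying over some `y` with `h(y) ≠ 0`.
  obtain ⟨h, hh0, f', hf'⟩ : ∃ h : MvPolynomial (Fin s) ℂ, h ≠ 0 ∧ f ∣ algebraMap (MvPolynomial (Fin s) ℂ) A h := by
    exact (Algebra.IsIntegral.isIntegral (R := MvPolynomial (Fin s) ℂ) f).isAlgebraic.exists_nonzero_dvd
      (mem_nonZeroDivisors_of_ne_zero hf)
  -- Prime avoidance in the finite fibre over `y₀`: `a` vanishes at `χ₀` and at no other point of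
  -- the fibre, and so singles out `χ₀` among the possible limits.
  obtain ⟨a, ha0, ha⟩ : ∃ a : A, χ₀ a = 0 ∧ ∀ χ : A →ₐ[ℂ] ℂ,
      (∀ p, χ (algebraMap (MvPolynomial (Fin s) ℂ) A p) = eval y₀ p) → χ a = 0 → χ = χ₀ := by
    have hfin := (finite_fibre b hb y₀).subset (Set.sdiff_subset (t := {χ₀}))
    have key := Ideal.subset_union_prime (s := hfin.toFinset)
      (f := fun χ : A →ₐ[ℂ] ℂ => RingHom.ker χ) χ₀ χ₀
      (fun χ _ _ _ => RingHom.ker_isPrime χ) (I := RingHom.ker χ₀)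
    by_contra! hcon
    obtain ⟨χ, hχ, hle⟩ := key.1 (fun a ha => by
      obtain ⟨χ, h1, h2, h3⟩ := hcon a ha
      simp only [Set.mem_iUnion]
      exact ⟨χ, by simpa using ⟨h1, h3⟩, h2⟩)
    simp only [Set.Finite.mem_toFinset, Set.mem_sdiff,
      Set.mem_singleton_iff] at hχ
    refine hχ.2 (AlgHom.ext fun u => ?_)
    have : u - algebraMap ℂ A (χ₀ u) ∈ RingHom.ker χ₀ := by simp [RingHom.mem_ker]
    have := hle this
    simpa [RingHom.mem_ker, sub_eq_zero] using this
  set F := minpoly (MvPolynomial (Fin s) ℂ) a with hFdef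
  have hFm : F.Monic := minpoly.monic (Algebra.IsIntegral.isIntegral a)
  have hFd : F.natDegree ≠ 0 := (minpoly.natDegree_pos (Algebra.IsIntegral.isIntegral a)).ne'
  -- The smallest root of the specialized minimal polynomial of `a` is controlled by the constant
  -- coefficient, and it lifts to a point over `y`.
  have hχ : ∀ y : Fin s → ℂ, ∃ χ : A →ₐ[ℂ] ℂ,
      (∀ p, χ (algebraMap (MvPolynomial (Fin s) ℂ) A p) = eval y p) ∧
      ‖χ a‖ ^ F.natDegree ≤ ‖(F.map (eval y)).coeff 0‖ := fun y => by
    have hm : (F.map (eval y)).Monic := hFm.map _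
    have hn : (F.map (eval y)).natDegree = F.natDegree := hFm.natDegree_map _
    obtain ⟨τ, h1, h2⟩ := exists_root_norm_pow_le hm (hn ▸ hFd)
    obtain ⟨χ, h3, h4⟩ := exists_algHom_of_root a y τ h1
    exact ⟨χ, h3, by rw [h4, ← hn]; exact h2⟩
  choose χ hχ1 hχ2 using hχ
  have hdense : Dense {y : Fin s → ℂ | eval y h ≠ 0} := dense_eval_ne_zero hh0
  have hne : (𝓝 y₀ ⊓ 𝓟 {y | eval y h ≠ 0}).NeBot := mem_closure_iff_nhdsWithin_neBot.1 (hdense y₀)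
  -- Along an ultrafilter the bounded values `χ y u` converge for all `u : A` simultaneously, and
  -- the limits form a point of `A`.
  obtain ⟨U, hU⟩ := Ultrafilter.exists_le (𝓝 y₀ ⊓ 𝓟 {y | eval y h ≠ 0})
  have hU1 : (U : Filter (Fin s → ℂ)) ≤ 𝓝 y₀ := hU.trans inf_le_left
  have hU2 : ∀ᶠ y in (U : Filter (Fin s → ℂ)), eval y h ≠ 0 :=
    hU.trans inf_le_right (mem_principal_self _)
  have hlim : ∀ u : A, ∃ z : ℂ, Tendsto (fun y => χ y u) U (𝓝 z) := fun u => by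
    obtain ⟨K, hK⟩ := cauchyBound_map_eval_eventually_le
      (minpoly.monic (Algebra.IsIntegral.isIntegral (R := MvPolynomial (Fin s) ℂ) u)) y₀
    have h1 : ∀ᶠ y in (U : Filter (Fin s → ℂ)), χ y u ∈ Metric.closedBall (0 : ℂ) K := by
      filter_upwards [hU1 hK] with y hy
      rw [mem_closedBall_zero_iff]
      exact hy _ (eval_map_of_aeval_eq_zero (χ y) y (hχ1 y) (minpoly.aeval _ u))
    obtain ⟨z, _, hz⟩ := (isCompact_closedBall (0 : ℂ) K).ultrafilter_le_nhds (U.map fun y => χ y u)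
      (le_principal_iff.2 h1)
    exact ⟨z, hz⟩
  choose L hL using hlim
  let χ' : A →ₐ[ℂ] ℂ :=
    { toFun := L
      map_one' := tendsto_nhds_unique (hL 1) (by simp)
      map_mul' := fun u v => tendsto_nhds_unique (hL _) (by simpa using (hL u).mul (hL v))
      map_zero' := tendsto_nhds_unique (hL 0) (by simp)
      map_add' := fun u v => tendsto_nhds_unique (hL _) (by simpa using (hL u).add (hL v))
      commutes' := fun c => tendsto_nhds_unique (hL _) (by simp) }
  -- The limit lies over `y₀` and kills `a`: the constant coefficient of the minimal polynomial
  -- tends to its value at `y₀`, which is zero because `χ₀ a = 0`.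
  have hχ' : χ' = χ₀ := by
    refine ha χ' (fun p => ?_) ?_
    · refine tendsto_nhds_unique (hL _) ?_
      simp only [hχ1]
      exact p.continuous_eval.continuousAt.tendsto.mono_left hU1
    · have h1 : Tendsto (fun y => ‖(F.map (eval y)).coeff 0‖) U (𝓝 0) := by
        have h2 := (continuous_coeff_map_eval F 0).norm.continuousAt.tendsto (x := y₀)
        have h3 : (F.map (eval y₀)).coeff 0 = 0 := by
          have := eval_map_of_aeval_eq_zero χ₀ y₀ hy₀ (minpoly.aeval (MvPolynomial (Fin s) ℂ) a)
          rwa [ha0, ← Polynomial.coeff_zero_eq_eval_zero] at this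
        simp only [h3, norm_zero] at h2
        exact h2.mono_left hU1
      have h4 : Tendsto (fun y => ‖χ y a‖ ^ F.natDegree) U (𝓝 0) :=
        squeeze_zero (fun _ => by positivity) (fun y => hχ2 y) h1
      have h5 := tendsto_nhds_unique ((hL a).norm.pow F.natDegree) h4
      exact norm_eq_zero.1 (pow_eq_zero_iff hFd |>.1 h5)
  have hlimb : Tendsto (fun y i => χ y (b i)) U (𝓝 fun i => χ₀ (b i)) := by
    rw [tendsto_pi_nhds]
    intro i
    rw [← hχ']
    exact hL (b i)
  refine mem_closure_of_tendsto hlimb ?_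
  filter_upwards [hU2] with y hy
  refine ⟨χ y, fun h0 => hy ?_, rfl⟩
  rw [← hχ1 y, hf', map_mul, h0, zero_mul]

end Limits

/-- Noether normalization reduces this to a finite extension of a polynomial ring. -/
theorem mem_closure_of_ne_zero {A : Type*} [CommRing A] [IsDomain A] [Algebra ℂ A]
    [Algebra.FiniteType ℂ A] {ι : Type*} [Finite ι] (b : ι → A)
    (hb : Algebra.adjoin ℂ (Set.range b) = ⊤) {f : A} (hf : f ≠ 0) (χ₀ : A →ₐ[ℂ] ℂ) :
    (fun i => χ₀ (b i)) ∈ closure {v | ∃ χ : A →ₐ[ℂ] ℂ, χ f ≠ 0 ∧ v = fun i => χ (b i)} := by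
  obtain ⟨n, g, hginj, hgfin⟩ := exists_finite_inj_algHom_of_fg ℂ A
  let _ : Algebra (MvPolynomial (Fin n) ℂ) A := g.toRingHom.toAlgebra
  have : IsScalarTower ℂ (MvPolynomial (Fin n) ℂ) A := IsScalarTower.of_algebraMap_eq fun r =>
    (g.commutes r).symm
  have : Module.Finite (MvPolynomial (Fin n) ℂ) A := hgfin
  have : FaithfulSMul (MvPolynomial (Fin n) ℂ) A :=
    (faithfulSMul_iff_algebraMap_injective _ _).2 hginj
  have : Module.IsTorsionFree (MvPolynomial (Fin n) ℂ) A := inferInstance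
  exact mem_closure_of_finite (s := n) b hb hf χ₀

end NDStratum
end

/-! ### The classical closure of the image of a polynomial map -/

noncomputable section
namespace NDStratum

open MvPolynomial Topology Filter

/-- The classical closure of the image of a polynomial map contains the Zariski closure. -/
theorem mem_closure_range_of_forall_eval {P ι : Type*} [Finite P] [Finite ι]
    {Φ : (P → ℂ) → ι → ℂ} (hΦ : ∀ j, IsPoly fun x => Φ x j) {a : ι → ℂ}
    (ha : ∀ F : MvPolynomial ι ℂ, (∀ x, eval (Φ x) F = 0) → eval a F = 0) :
    a ∈ closure (Set.range Φ) := by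
  have hev : ∀ F : MvPolynomial ι ℂ, IsPoly fun x => eval (Φ x) F := fun F =>
    IsPoly.comp ⟨F, fun _ => rfl⟩ hΦ
  let I : Ideal (MvPolynomial ι ℂ) := vanishingIdeal ℂ (Set.range Φ)
  have hI : ∀ F, F ∈ I ↔ ∀ x, eval (Φ x) F = 0 := fun F => by
    simp [I, mem_vanishingIdeal_iff, aeval_eq_eval]
  have hprime : I.IsPrime := by
    refine ⟨fun h => ?_, fun {F G} hFG => ?_⟩
    · have := (hI 1).1 (h ▸ Submodule.mem_top) 0
      simp at this
    · obtain ⟨p, hp⟩ := hev F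
      obtain ⟨q, hq⟩ := hev G
      have : p * q = 0 := MvPolynomial.funext fun x => by
        have := (hI _).1 hFG x
        simpa [hp, hq] using this
      rcases mul_eq_zero.1 this with h | h
      · exact Or.inl ((hI F).2 fun x => by simp [hp, h])
      · exact Or.inr ((hI G).2 fun x => by simp [hq, h])
  obtain ⟨s, hs⟩ := (IsCon.image (S := Set.univ) (P := ι) (Q := P)
    ⟨Set.univ, .univ, by simp⟩ hΦ).exists_finset
  simp only [Set.image_univ] at hs
  -- Some piece of the image is a nonempty open part of the zero locus of `I`. Otherwise each piece
  -- has a polynomial outside `I` that vanishes on its points of the image; the product of these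
  -- vanishes on the whole image, contradicting that `I` is prime.
  obtain ⟨c, hcs, hcg, hcf⟩ : ∃ c ∈ s, (∀ i, c.g i ∈ I) ∧ c.f ∉ I := by
    by_contra! hcon
    have h1 : ∀ c ∈ s, ∃ G, G ∉ I ∧ ∀ x, (∀ i, eval (Φ x) (c.g i) = 0) →
        eval (Φ x) c.f ≠ 0 → eval (Φ x) G = 0 := fun c hc => by
      by_cases h : ∀ i, c.g i ∈ I
      · exact ⟨1, fun h1 => hprime.ne_top ((Ideal.eq_top_iff_one _).2 h1),
          fun x _ hx => absurd ((hI _).1 (hcon c hc h) x) hx⟩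
      · push Not at h
        obtain ⟨i, hi⟩ := h
        exact ⟨c.g i, hi, fun x hx _ => hx i⟩
    choose! G hG hG2 using h1
    have h2 : ∏ c ∈ s, G c ∈ I := (hI _).2 fun x => by
      obtain ⟨c, hc, h3, h4⟩ := (hs (Φ x)).1 ⟨x, rfl⟩
      rw [map_prod]
      exact Finset.prod_eq_zero hc (hG2 c hc x h3 h4)
    obtain ⟨c, hc, h⟩ := hprime.prod_mem_iff.1 h2
    exact hG c hc h
  let A := MvPolynomial ι ℂ ⧸ I
  let b : ι → A := fun i => Ideal.Quotient.mk I (X i)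
  have hb : Algebra.adjoin ℂ (Set.range b) = ⊤ := by
    have h1 : Set.range b = Ideal.Quotient.mkₐ ℂ I '' Set.range X := by
      rw [← Set.range_comp]
      rfl
    rw [h1, ← AlgHom.map_adjoin, MvPolynomial.adjoin_range_X, Algebra.map_top]
    exact (AlgHom.range_eq_top _).2 Ideal.Quotient.mk_surjective
  let χ₀ : A →ₐ[ℂ] ℂ := Ideal.Quotient.liftₐ I (aeval a) fun F hF => by
    rw [aeval_eq_eval]
    exact ha F ((hI F).1 hF)
  have key := mem_closure_of_ne_zero b hb (f := Ideal.Quotient.mk I c.f)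
    (fun h => hcf (Ideal.Quotient.eq_zero_iff_mem.1 h)) χ₀
  have h0 : (fun i => χ₀ (b i)) = a := by
    ext i
    change (aeval a) (X i) = a i
    simp
  rw [h0] at key
  refine closure_mono ?_ key
  rintro _ ⟨χ, hχ, rfl⟩
  have hF : ∀ F : MvPolynomial ι ℂ, eval (fun i => χ (b i)) F = χ (Ideal.Quotient.mk I F) := by
    intro F
    have : aeval (fun i => χ (b i)) = χ.comp (Ideal.Quotient.mkₐ ℂ I) := by
      ext i
      simp [b]
      rfl
    rw [← coe_aeval_eq_eval]
    exact DFunLike.congr_fun this F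
  refine (hs _).2 ⟨c, hcs, fun i => ?_, ?_⟩
  · rw [hF, Ideal.Quotient.eq_zero_iff_mem.2 (hcg i), map_zero]
  · rwa [hF]

/-! ### Transfer to projective space -/

section Projective

variable {ι : Type}

theorem eval_smul_of_isHomogeneous {k : ℕ} {F : MvPolynomial ι ℂ} (hF : F.IsHomogeneous k)
    (c : ℂ) (v : ι → ℂ) : eval (c • v) F = c ^ k * eval v F := by
  rw [eval_eq, eval_eq, Finset.mul_sum]
  refine Finset.sum_congr rfl fun d hd => ?_
  have hk : ∑ i ∈ d.support, d i = k := by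
    simpa [Finsupp.weight_apply, Finsupp.sum] using hF (mem_support_iff.1 hd)
  simp only [Pi.smul_apply, smul_eq_mul, mul_pow, Finset.prod_mul_distrib, Finset.prod_pow_eq_pow_sum,
    hk]
  ring

theorem eval_rep_eq_zero_iff {k : ℕ} {F : MvPolynomial ι ℂ} (hF : F.IsHomogeneous k)
    {v : ι → ℂ} (hv : v ≠ 0) :
    eval (Projectivization.mk ℂ v hv).rep F = 0 ↔ eval v F = 0 := by
  obtain ⟨u, hu⟩ := Projectivization.exists_smul_eq_mk_rep ℂ v hv
  rw [← hu, Units.smul_def, eval_smul_of_isHomogeneous hF]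
  simp

/-- The basic open sets of the Zariski topology. -/
def zariskiBasis (ι : Type) : Set (Set (ℙ ℂ (ι → ℂ))) :=
  {U | ∃ (k : ℕ) (F : MvPolynomial ι ℂ), F.IsHomogeneous k ∧ U = {p | eval p.rep F ≠ 0}}

theorem isTopologicalBasis_zariski :
    @TopologicalSpace.IsTopologicalBasis _ (zariskiTopology ι) (zariskiBasis ι) := by
  refine @TopologicalSpace.IsTopologicalBasis.mk _ (zariskiTopology ι) _ ?_ ?_ rfl
  · rintro _ ⟨k, F, hF, rfl⟩ _ ⟨l, G, hG, rfl⟩ x hx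
    exact ⟨_, ⟨k + l, F * G, hF.mul hG, rfl⟩, by simpa using hx, fun y hy => by simpa using hy⟩
  · refine Set.eq_univ_of_univ_subset (Set.subset_sUnion_of_mem ?_)
    exact ⟨0, 1, isHomogeneous_one _ _, by simp⟩

theorem isOpen_zariski {k : ℕ} {F : MvPolynomial ι ℂ} (hF : F.IsHomogeneous k) :
    @IsOpen _ (zariskiTopology ι) {p | eval p.rep F ≠ 0} :=
  TopologicalSpace.isOpen_generateFrom_of_mem ⟨k, F, hF, rfl⟩

/-- The nonzero vectors form a subspace of a Noetherian spectrum and map onto projective space.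
Constructibility in a general space is built from retrocompact open sets, and in a Noetherian space
every open set is one. -/
theorem noetherianSpace_zariski [Finite ι] :
    @TopologicalSpace.NoetherianSpace _ (zariskiTopology ι) := by
  let f : {v : ι → ℂ // v ≠ 0} → PrimeSpectrum (MvPolynomial ι ℂ) := fun v => pointToPoint v.1
  let _ : TopologicalSpace {v : ι → ℂ // v ≠ 0} := TopologicalSpace.induced f inferInstance
  let _ := zariskiTopology ι
  have hf : Topology.IsInducing f := ⟨rfl⟩
  have : TopologicalSpace.NoetherianSpace {v : ι → ℂ // v ≠ 0} := hf.noetherianSpace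
  refine TopologicalSpace.noetherianSpace_of_surjective (Projectivization.mk' ℂ) ?_ ?_
  · refine continuous_generateFrom_iff.2 ?_
    rintro _ ⟨k, F, hF, rfl⟩
    refine ⟨PrimeSpectrum.basicOpen F, (PrimeSpectrum.basicOpen F).2, ?_⟩
    ext ⟨v, hv⟩
    have h1 := mem_pointToPoint v F
    have h2 := eval_rep_eq_zero_iff hF hv
    simp only [f, Set.mem_preimage, SetLike.mem_coe, PrimeSpectrum.mem_basicOpen, h1,
      Projectivization.mk'_eq_mk, Set.mem_ofPred_eq, ne_eq, h2]
  · intro p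
    exact ⟨⟨p.rep, p.rep_nonzero⟩, by simp⟩

theorem isConstructible_of_isOpen_zariski [Finite ι] {U : Set (ℙ ℂ (ι → ℂ))}
    (hU : @IsOpen _ (zariskiTopology ι) U) : @IsConstructible _ (zariskiTopology ι) U := by
  let _ := zariskiTopology ι
  have := noetherianSpace_zariski (ι := ι)
  exact IsCompact.isConstructible (TopologicalSpace.NoetherianSpace.isCompact U) hU

/-- A polynomial on an affine chart of projective space, made homogeneous. -/
theorem exists_homogeneous_chart (i : ι) (g : MvPolynomial ι ℂ) :
    ∃ (k : ℕ) (G : MvPolynomial ι ℂ), G.IsHomogeneous k ∧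
      ∀ v : ι → ℂ, eval v G ≠ 0 ↔ v i ≠ 0 ∧ eval ((v i)⁻¹ • v) g ≠ 0 := by
  -- The extra factor `X i`, responsible for the `+ 1`, makes the form vanish off the chart.
  refine ⟨g.totalDegree + 1,
    (∑ d ∈ g.support, monomial d (coeff d g) * X i ^ (g.totalDegree - d.degree)) * X i,
    (IsHomogeneous.sum _ _ _ fun d hd => ?_).mul (isHomogeneous_X _ _), fun v => ?_⟩
  · have h1 := (isHomogeneous_monomial (coeff d g) (rfl : d.degree = d.degree)).mul
      ((isHomogeneous_X ℂ i).pow (g.totalDegree - d.degree))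
    have h2 : d.degree ≤ g.totalDegree := le_totalDegree hd
    rwa [one_mul, Nat.add_sub_cancel' h2] at h1
  · by_cases hv : v i = 0
    · simp [hv]
    have key : eval v (∑ d ∈ g.support,
        monomial d (coeff d g) * X i ^ (g.totalDegree - d.degree)) =
        v i ^ g.totalDegree * eval ((v i)⁻¹ • v) g := by
      rw [map_sum]
      have h1 := congrArg (eval ((v i)⁻¹ • v)) g.as_sum
      rw [map_sum] at h1
      rw [h1, Finset.mul_sum]
      refine Finset.sum_congr rfl fun d hd => ?_
      have h2 : d.degree ≤ g.totalDegree := le_totalDegree hd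
      rw [eval_smul_of_isHomogeneous (isHomogeneous_monomial (coeff d g) (rfl : d.degree = _))]
      simp only [map_mul, map_pow, eval_X]
      rw [pow_sub₀ _ hv h2, inv_pow]
      ring
    rw [map_mul, eval_X, key]
    simp [hv]

/-- On the chart where coordinate `i` is nonzero, membership is tested on the representative with
that coordinate equal to one. There each polynomial condition can be made homogeneous. -/
theorem isConstructible_of_isCon [Finite ι] {S : Set (ℙ ℂ (ι → ℂ))} {K : Set (ι → ℂ)}
    (hK : IsCon K) (hS : ∀ v (hv : v ≠ 0), Projectivization.mk ℂ v hv ∈ S ↔ v ∈ K) :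
    @IsConstructible _ (zariskiTopology ι) S := by
  obtain ⟨s, hs⟩ := hK.exists_finset
  have hO : ∀ (i : ι) (g : MvPolynomial ι ℂ), @IsConstructible _ (zariskiTopology ι)
      {p : ℙ ℂ (ι → ℂ) | p.rep i ≠ 0 ∧ eval ((p.rep i)⁻¹ • p.rep) g ≠ 0} := fun i g => by
    obtain ⟨k, G, hG, h⟩ := exists_homogeneous_chart i g
    simp only [← h]
    exact isConstructible_of_isOpen_zariski (isOpen_zariski hG)
  have hS' : S = ⋃ i : ι, ⋃ c : s,
      ({p : ℙ ℂ (ι → ℂ) | p.rep i ≠ 0 ∧ eval ((p.rep i)⁻¹ • p.rep) c.1.f ≠ 0} ∩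
      ⋂ j, {p : ℙ ℂ (ι → ℂ) | p.rep i ≠ 0 ∧ eval ((p.rep i)⁻¹ • p.rep) (c.1.g j) ≠ 0}ᶜ) := by
    ext p
    have h1 : ∀ i, p.rep i ≠ 0 → (p ∈ S ↔ (p.rep i)⁻¹ • p.rep ∈ K) := fun i hi => by
      have hne : (p.rep i)⁻¹ • p.rep ≠ 0 := smul_ne_zero (inv_ne_zero hi) p.rep_nonzero
      rw [← hS _ hne]
      have : Projectivization.mk ℂ ((p.rep i)⁻¹ • p.rep) hne = p := by
        conv_rhs => rw [← p.mk_rep]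
        rw [Projectivization.mk_eq_mk_iff']
        exact ⟨_, rfl⟩
      rw [this]
    simp only [Set.mem_iUnion, Set.mem_inter_iff, Set.mem_iInter, Set.mem_compl_iff,
      Set.mem_ofPred_eq, not_and, not_not]
    constructor
    · intro hp
      obtain ⟨i, hi⟩ := Function.ne_iff.1 p.rep_nonzero
      obtain ⟨c, hc, h2, h3⟩ := (hs _).1 ((h1 i hi).1 hp)
      exact ⟨i, ⟨c, hc⟩, ⟨hi, h3⟩, fun j _ => h2 j⟩
    · rintro ⟨i, c, ⟨hi, h2⟩, h3⟩
      exact (h1 i hi).2 ((hs _).2 ⟨c, c.2, fun j => h3 j hi, h2⟩)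
  rw [hS']
  let _ := zariskiTopology ι
  exact .iUnion fun i => .iUnion fun c => (hO i _).inter (.iInter fun j => (hO i _).compl)

/-- The consequences of a parametrization of a cone by a polynomial map on a dense constructible
set of parameters. -/
theorem conclusions_of_parametrization [Finite ι] {P : Type*} [Finite P]
    {S : Set (ℙ ℂ (ι → ℂ))} {G : Set (P → ℂ)} (hGd : Dense G) (hGc : IsCon G)
    {Φ : (P → ℂ) → ι → ℂ} (hΦ : ∀ j, IsPoly fun x => Φ x j) (h0 : ∀ x ∈ G, Φ x ≠ 0)
    (hS : ∀ v (hv : v ≠ 0), Projectivization.mk ℂ v hv ∈ S ↔ ∃ x ∈ G, Φ x = v) :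
    S.Nonempty ∧ @IsConstructible _ (zariskiTopology ι) S ∧
      @IsIrreducible _ (zariskiTopology ι) S ∧
      @IsClosed _ (zariskiTopology ι) (classicalClosure S) ∧
      @IsIrreducible _ (zariskiTopology ι) (classicalClosure S) := by
  have hmem : ∀ x (hx : x ∈ G), Projectivization.mk ℂ (Φ x) (h0 x hx) ∈ S := fun x hx =>
    (hS _ _).2 ⟨x, hx, rfl⟩
  have hne : S.Nonempty := by
    obtain ⟨x, hx⟩ := hGd.nonempty
    exact ⟨_, hmem x hx⟩
  have hpull : ∀ F : MvPolynomial ι ℂ, IsPoly fun x => eval (Φ x) F := fun F =>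
    IsPoly.comp ⟨F, fun _ => rfl⟩ hΦ
  have hbasis := isTopologicalBasis_zariski (ι := ι)
  have hirr : @IsIrreducible _ (zariskiTopology ι) S := by
    refine ⟨hne, ?_⟩
    -- An open set that meets `S` contains the images of all good parameters off the zero set of a
    -- nonzero polynomial. For two open sets the product of these polynomials is nonzero somewhere
    -- on the dense set `G`.
    have hex : ∀ U, @IsOpen _ (zariskiTopology ι) U → (S ∩ U).Nonempty →
        ∃ p : MvPolynomial P ℂ, p ≠ 0 ∧ ∀ x (hx : x ∈ G), eval x p ≠ 0 →
          Projectivization.mk ℂ (Φ x) (h0 x hx) ∈ U := by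
      rintro U hU ⟨q, hqS, hqU⟩
      obtain ⟨_, ⟨k, F, hF, rfl⟩, hqF, hFU⟩ :=
        @TopologicalSpace.IsTopologicalBasis.exists_subset_of_mem_open _ (zariskiTopology ι) _
          hbasis _ _ hqU hU
      obtain ⟨p, hp⟩ := hpull F
      rw [← q.mk_rep] at hqS
      obtain ⟨x, hx, hxq⟩ := (hS _ _).1 hqS
      refine ⟨p, fun hp0 => hqF ?_, fun x hx hpx => hFU ?_⟩
      · rw [← hxq]
        exact (hp x).trans (by rw [hp0, map_zero])
      · simp only [Set.mem_ofPred_eq, ne_eq, eval_rep_eq_zero_iff hF, hp]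
        exact hpx
    intro U V hU hV hSU hSV
    obtain ⟨p, hp0, hp⟩ := hex U hU hSU
    obtain ⟨q, hq0, hq⟩ := hex V hV hSV
    obtain ⟨x, hx, hxG⟩ := hGd.inter_open_nonempty {x | eval x (p * q) ≠ 0}
      (isOpen_ne_fun (p * q).continuous_eval continuous_const)
      (dense_eval_ne_zero (mul_ne_zero hp0 hq0)).nonempty
    simp only [map_mul, ne_eq, mul_eq_zero, not_or, Set.mem_ofPred_eq] at hx
    exact ⟨_, hmem x hxG, hp x hxG hx.1, hq x hxG hx.2⟩
  -- Zariski closed sets are classically closed, which gives one inclusion. Conversely, a polynomial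
  -- vanishing on the image of `Φ` vanishes on a representative of any point of the Zariski closure,
  -- so this representative is a classical limit of values of `Φ`, and by density of values on `G`.
  have hclosure : classicalClosure S = @closure _ (zariskiTopology ι) S := by
    refine Set.Subset.antisymm ?_ ?_
    · refine @closure_minimal _ (classicalTopology ι) _ _
        (@subset_closure _ (zariskiTopology ι) S) ?_
      refine IsClosed.mono (@isClosed_closure _ (zariskiTopology ι) S) ?_
      refine le_generateFrom ?_
      rintro _ ⟨k, F, hF, rfl⟩
      refine isOpen_coinduced.2 ?_
      have : Projectivization.mk' ℂ ⁻¹' {p : ℙ ℂ (ι → ℂ) | eval p.rep F ≠ 0} =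
          {v : {v : ι → ℂ // v ≠ 0} | eval v.1 F ≠ 0} := by
        ext ⟨v, hv⟩
        simp [Projectivization.mk'_eq_mk, eval_rep_eq_zero_iff hF hv]
      rw [this]
      exact isOpen_ne_fun (F.continuous_eval.comp continuous_subtype_val) continuous_const
    · intro p hp
      refine (@mem_closure_iff _ (classicalTopology ι) _ _).2 fun O hO hpO => ?_
      have hO' : IsOpen (Projectivization.mk' ℂ ⁻¹' O) := isOpen_coinduced.1 hO
      obtain ⟨W, hW, hWO⟩ := isOpen_induced_iff.1 hO'
      have hrep : p.rep ∈ closure (Set.range Φ) := by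
        refine mem_closure_range_of_forall_eval hΦ fun F hF => ?_
        have hcone : ∀ (c : ℂ), ∀ x ∈ G, c ≠ 0 → eval (c • Φ x) F = 0 := fun c x hx hc => by
          have h1 : c • Φ x ≠ 0 := smul_ne_zero hc (h0 x hx)
          have h2 : Projectivization.mk ℂ (c • Φ x) h1 ∈ S := by
            convert hmem x hx using 1
            rw [Projectivization.mk_eq_mk_iff']
            exact ⟨c, rfl⟩
          obtain ⟨x', hx', h3⟩ := (hS _ _).1 h2
          rw [← h3]
          exact hF x'
        -- Vanishing along a whole line through the origin passes to the homogeneous components, and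
        -- only these are seen by the topology of projective space.
        have hcomp : ∀ k, ∀ x ∈ G, eval (Φ x) (homogeneousComponent k F) = 0 := fun k x hx => by
          let f : Polynomial ℂ := ∑ l ∈ Finset.range (F.totalDegree + 1),
            Polynomial.C (eval (Φ x) (homogeneousComponent l F)) * Polynomial.X ^ l
          have hf : ∀ c, f.eval c = eval (c • Φ x) F := fun c => by
            conv_rhs => rw [← sum_homogeneousComponent F, map_sum]
            simp only [f, Polynomial.eval_finsetSum, Polynomial.eval_mul, Polynomial.eval_C,
              Polynomial.eval_pow, Polynomial.eval_X,
              eval_smul_of_isHomogeneous (homogeneousComponent_isHomogeneous _ F), mul_comm]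
          have hf0 : f = 0 := by
            refine Polynomial.eq_zero_of_infinite_isRoot f
              ((Set.finite_singleton (0 : ℂ)).infinite_compl.mono fun c hc => ?_)
            exact (hf c).trans (hcone c x hx hc)
          by_cases hk : k ≤ F.totalDegree
          · have := congrArg (fun f => Polynomial.coeff f k) hf0
            simpa [f, Polynomial.finsetSum_coeff, Polynomial.coeff_C_mul, Polynomial.coeff_X_pow,
              Nat.lt_succ_iff, hk] using this
          · rw [homogeneousComponent_eq_zero _ _ (not_le.1 hk), map_zero]
        rw [← sum_homogeneousComponent F, map_sum]
        refine Finset.sum_eq_zero fun k _ => ?_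
        by_contra hk
        obtain ⟨q, hqF, hqS⟩ := (@mem_closure_iff _ (zariskiTopology ι) _ _).1 hp _
          (isOpen_zariski (homogeneousComponent_isHomogeneous k F)) hk
        rw [← q.mk_rep] at hqS
        obtain ⟨x, hx, hxq⟩ := (hS _ _).1 hqS
        exact hqF (hxq ▸ hcomp k x hx)
      have hcont : Continuous Φ := continuous_pi fun j => (hΦ j).continuous
      have hrep' : p.rep ∈ closure (Φ '' G) := by
        have h1 : Set.range Φ ⊆ closure (Φ '' G) := by
          rw [← Set.image_univ, ← hGd.closure_eq]
          exact image_closure_subset_closure_image hcont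
        exact closure_minimal h1 isClosed_closure hrep
      have hpW : p.rep ∈ W := by
        have : (⟨p.rep, p.rep_nonzero⟩ : {v : ι → ℂ // v ≠ 0}) ∈ Subtype.val ⁻¹' W := by
          rw [hWO]
          simpa using hpO
        exact this
      obtain ⟨_, hvW, x, hx, rfl⟩ := mem_closure_iff.1 hrep' W hW hpW
      have : (⟨Φ x, h0 x hx⟩ : {v : ι → ℂ // v ≠ 0}) ∈ Projectivization.mk' ℂ ⁻¹' O := by
        rw [← hWO]
        exact hvW
      exact ⟨_, this, hmem x hx⟩
  refine ⟨hne, isConstructible_of_isCon (hGc.image hΦ) hS, hirr, ?_, ?_⟩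
  · rw [hclosure]
    exact @isClosed_closure _ (zariskiTopology ι) S
  · rw [hclosure]
    exact @IsIrreducible.closure _ (zariskiTopology ι) S hirr

end Projective

end NDStratum
end

noncomputable section
namespace NDStratum

/-! ### Newton polyhedra and support functions -/

open Topology Filter
open scoped Pointwise

variable {n : ℕ}

/-- The weight of an exponent with respect to a linear form. -/
def weight (w : Fin n → ℝ) (I : Fin n →₀ ℕ) : ℝ := ∑ i, w i * (I i : ℝ)

theorem finite_weight_le {w : Fin n → ℝ} (hw : ∀ i, 0 < w i) (b : ℝ) :
    {I : Fin n →₀ ℕ | weight w I ≤ b}.Finite := by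
  refine (Set.finite_Iic (Finsupp.equivFunOnFinite.symm fun i => ⌈b / w i⌉₊)).subset fun I hI i => ?_
  have h2 : w i * (I i : ℝ) ≤ weight w I :=
    Finset.single_le_sum (f := fun j => w j * (I j : ℝ))
      (fun j _ => mul_nonneg (hw j).le (Nat.cast_nonneg _)) (Finset.mem_univ i)
  have h3 : (I i : ℝ) ≤ b / w i := by
    rw [le_div_iff₀ (hw i)]
    linarith [hI.out]
  simpa using (by exact_mod_cast h3.trans (Nat.le_ceil _) : I i ≤ ⌈b / w i⌉₊)

theorem exists_weight_min {w : Fin n → ℝ} (hw : ∀ i, 0 < w i) {S : Set (Fin n →₀ ℕ)}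
    (hS : S.Nonempty) : ∃ I ∈ S, ∀ J ∈ S, weight w I ≤ weight w J := by
  obtain ⟨I₀, h₀⟩ := hS
  obtain ⟨I, ⟨hI, hI'⟩, hmin⟩ := Set.exists_min_image
    (S ∩ {I | weight w I ≤ weight w I₀}) (weight w)
    ((finite_weight_le hw _).subset Set.inter_subset_right) ⟨I₀, h₀, le_refl (weight w I₀)⟩
  refine ⟨I, hI, fun J hJ => ?_⟩
  by_cases h : weight w J ≤ weight w I₀
  · exact hmin J ⟨hJ, h⟩
  · exact hI'.out.trans (not_le.1 h).le

theorem faceSupport_nonempty {w : Fin n → ℝ} (hw : ∀ i, 0 < w i) {f : MvPowerSeries (Fin n) ℂ}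
    (hf : ∃ I, MvPowerSeries.coeff I f ≠ 0) : (faceSupport w f).Nonempty := by
  obtain ⟨I, hI, h⟩ := exists_weight_min hw (S := {I | MvPowerSeries.coeff I f ≠ 0}) hf
  exact ⟨I, hI, h⟩

theorem weight_le_of_mem_newtonPolyhedron {w : Fin n → ℝ} (hw : ∀ i, 0 < w i)
    {f : MvPowerSeries (Fin n) ℂ} {J : Fin n →₀ ℕ} (hJ : J ∈ faceSupport w f) {x : Fin n → ℝ}
    (hx : x ∈ newtonPolyhedron f) : weight w J ≤ ∑ i, w i * x i := by
  have hc : Convex ℝ {x : Fin n → ℝ | weight w J ≤ ∑ i, w i * x i} :=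
    convex_halfSpace_ge (f := fun x : Fin n → ℝ => ∑ i, w i * x i)
      ⟨fun x y => by simp [mul_add, Finset.sum_add_distrib], fun c x => by
        simp only [Pi.smul_apply, smul_eq_mul, Finset.mul_sum]
        exact Finset.sum_congr rfl fun i _ => by ring⟩ _
  refine convexHull_min ?_ hc hx
  rintro x ⟨I, hI, hIx⟩
  exact (hJ.2 I hI).trans (Finset.sum_le_sum fun i _ => mul_le_mul_of_nonneg_left (hIx i) (hw i).le)

theorem coe_mem_newtonPolyhedron {f : MvPowerSeries (Fin n) ℂ} {I : Fin n →₀ ℕ}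
    (hI : MvPowerSeries.coeff I f ≠ 0) : (fun i => (I i : ℝ)) ∈ newtonPolyhedron f :=
  subset_convexHull _ _ ⟨I, hI, fun _ => le_rfl⟩

theorem coe_mem_newtonDiagram {w : Fin n → ℝ} (hw : ∀ i, 0 < w i)
    {f : MvPowerSeries (Fin n) ℂ} {J : Fin n →₀ ℕ} (hJ : J ∈ faceSupport w f) :
    (fun i => (J i : ℝ)) ∈ newtonDiagram f :=
  ⟨coe_mem_newtonPolyhedron hJ.1, w, hw, fun _ hy => weight_le_of_mem_newtonPolyhedron hw hJ hy⟩

theorem weight_le_of_newtonDiagram_subset {f h : MvPowerSeries (Fin n) ℂ}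
    (hsub : newtonDiagram h ⊆ newtonDiagram f) {w : Fin n → ℝ} (hw : ∀ i, 0 < w i)
    {I J : Fin n →₀ ℕ} (hI : I ∈ faceSupport w h) (hJ : J ∈ faceSupport w f) :
    weight w J ≤ weight w I :=
  weight_le_of_mem_newtonPolyhedron hw hJ (hsub (coe_mem_newtonDiagram hw hI)).1

/-- The Newton polyhedron is closed: it is the sum of a polytope and the positive orthant. -/
theorem isClosed_newtonPolyhedron (f : MvPowerSeries (Fin n) ℂ) :
    IsClosed (newtonPolyhedron f) := by
  let M : Set (Fin n →₀ ℕ) := {I | Minimal (fun I => MvPowerSeries.coeff I f ≠ 0) I}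
  -- Dickson's lemma.
  have hM : M.Finite := WellQuasiOrderedLE.finite_of_isAntichain (setOfPred_minimal_antichain _)
  let c : (Fin n →₀ ℕ) → Fin n → ℝ := fun I i => (I i : ℝ)
  have hset : {x : Fin n → ℝ | ∃ I : Fin n →₀ ℕ, MvPowerSeries.coeff I f ≠ 0 ∧
      ∀ i, (I i : ℝ) ≤ x i} = c '' M + Set.Ici (0 : Fin n → ℝ) := by
    ext x
    constructor
    · rintro ⟨I, hI, hx⟩
      obtain ⟨J, hJI, hJ⟩ := exists_minimal_le_of_wellFoundedLT
        (fun I => MvPowerSeries.coeff I f ≠ 0) I hI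
      refine ⟨c J, ⟨J, hJ, rfl⟩, x - c J, fun i => ?_, by simp⟩
      have h1 : (J i : ℝ) ≤ I i := by exact_mod_cast hJI i
      simpa [c] using h1.trans (hx i)
    · rintro ⟨_, ⟨J, hJ, rfl⟩, y, hy, rfl⟩
      have hJ' : Minimal (fun I => MvPowerSeries.coeff I f ≠ 0) J := by simpa [M] using hJ
      exact ⟨J, hJ'.prop, fun i => by simpa [c] using hy i⟩
  have hIci : convexHull ℝ (Set.Ici (0 : Fin n → ℝ)) = Set.Ici 0 := (convex_Ici _).convexHull_eq
  rw [newtonPolyhedron, hset, convexHull_add, hIci]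
  exact isClosed_Ici.add_left_of_isCompact ((hM.image c).isCompact_convexHull (𝕜 := ℝ))

theorem add_smul_single_mem_newtonPolyhedron {f : MvPowerSeries (Fin n) ℂ} {I : Fin n →₀ ℕ}
    (hI : MvPowerSeries.coeff I f ≠ 0) (i : Fin n) {t : ℝ} (ht : 0 ≤ t) :
    (fun j => (I j : ℝ)) + t • Pi.single i 1 ∈ newtonPolyhedron f := by
  refine subset_convexHull _ _ ⟨I, hI, fun j => ?_⟩
  have : (0 : ℝ) ≤ (Pi.single i 1 : Fin n → ℝ) j := by
    by_cases h : j = i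
    · subst h; simp
    · simp [h]
  simpa using mul_nonneg ht this

/-- The Newton polyhedron is determined by its support function on positive linear forms. -/
theorem coe_mem_newtonPolyhedron_of_weight {f : MvPowerSeries (Fin n) ℂ}
    (hf : ∃ I, MvPowerSeries.coeff I f ≠ 0) {I : Fin n →₀ ℕ}
    (hI : ∀ w : Fin n → ℝ, (∀ i, 0 < w i) → ∀ J ∈ faceSupport w f, weight w J ≤ weight w I) :
    (fun i => (I i : ℝ)) ∈ newtonPolyhedron f := by
  by_contra hcon
  obtain ⟨φ, u, h1, h2⟩ := geometric_hahn_banach_point_closed (convex_convexHull ℝ _)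
    (isClosed_newtonPolyhedron f) hcon
  have hφ : ∀ x : Fin n → ℝ, φ x = ∑ i, φ (Pi.single i 1) * x i := fun x => by
    conv_lhs => rw [pi_eq_sum_univ' x, map_sum]
    refine Finset.sum_congr rfl fun i _ => ?_
    rw [map_smul, smul_eq_mul, mul_comm]
  obtain ⟨I₀, hI₀⟩ := hf
  -- A negative coefficient would make the separating form unbounded below on the polyhedron, along
  -- the ray in direction `i`.
  have hnn : ∀ i, 0 ≤ φ (Pi.single i 1) := fun i => by
    by_contra! hneg
    have h3 := h2 _ (coe_mem_newtonPolyhedron hI₀)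
    set a := φ (Pi.single i 1)
    set b := φ fun i => (I₀ i : ℝ)
    have h4 := h2 _ (add_smul_single_mem_newtonPolyhedron hI₀ i
      (t := (u - b) / a) (div_nonneg_of_nonpos (by linarith) hneg.le))
    rw [map_add, map_smul, smul_eq_mul] at h4
    have : (u - b) / a * a = u - b := div_mul_cancel₀ _ hneg.ne
    change u < b + (u - b) / a * a at h4
    linarith
  let S : ℝ := ∑ i, (I i : ℝ)
  have hS : 0 ≤ S := Finset.sum_nonneg fun i _ => Nat.cast_nonneg _
  set a := φ fun i => (I i : ℝ) with ha
  -- Coefficients of the separating form may be zero. Adding `δ` makes them positive, and `δ` is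
  -- small enough that the value at `I` rises by at most `δ * S ≤ u - a` and stays below the values
  -- on the polyhedron.
  let δ : ℝ := (u - a) / (S + 1)
  have hδ : 0 < δ := div_pos (by linarith) (by linarith)
  have hw : ∀ i, 0 < φ (Pi.single i 1) + δ := fun i => by linarith [hnn i]
  obtain ⟨J, hJ⟩ := faceSupport_nonempty hw ⟨I₀, hI₀⟩
  have h3 := hI _ hw J hJ
  have h4 := h2 _ (coe_mem_newtonPolyhedron hJ.1)
  have h5 : ∀ K : Fin n →₀ ℕ, weight (fun i => φ (Pi.single i 1) + δ) K =
      φ (fun i => (K i : ℝ)) + δ * ∑ i, (K i : ℝ) := fun K => by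
    rw [hφ, weight, Finset.mul_sum, ← Finset.sum_add_distrib]
    exact Finset.sum_congr rfl fun i _ => by ring
  rw [h5, h5] at h3
  have h6 : 0 ≤ δ * ∑ i, (J i : ℝ) :=
    mul_nonneg hδ.le (Finset.sum_nonneg fun i _ => Nat.cast_nonneg _)
  have h7 : δ * S ≤ u - a := by
    have : δ * (S + 1) = u - a := div_mul_cancel₀ _ (by linarith)
    nlinarith
  change _ ≤ a + δ * S at h3
  linarith

theorem newtonPolyhedron_subset {f h : MvPowerSeries (Fin n) ℂ}
    (hf : ∃ I, MvPowerSeries.coeff I f ≠ 0)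
    (hh : ∀ I, MvPowerSeries.coeff I h ≠ 0 → ∀ w : Fin n → ℝ, (∀ i, 0 < w i) →
      ∀ J ∈ faceSupport w f, weight w J ≤ weight w I) :
    newtonPolyhedron h ⊆ newtonPolyhedron f := by
  refine convexHull_min ?_ (convex_convexHull ℝ _)
  rintro x ⟨I, hI, hx⟩
  have h1 := coe_mem_newtonPolyhedron_of_weight hf (hh I hI)
  have h2 : newtonPolyhedron f + Set.Ici (0 : Fin n → ℝ) ⊆ newtonPolyhedron f := by
    have : {x : Fin n → ℝ | ∃ I : Fin n →₀ ℕ, MvPowerSeries.coeff I f ≠ 0 ∧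
        ∀ i, (I i : ℝ) ≤ x i} + Set.Ici (0 : Fin n → ℝ) ⊆ {x : Fin n → ℝ | ∃ I : Fin n →₀ ℕ,
        MvPowerSeries.coeff I f ≠ 0 ∧ ∀ i, (I i : ℝ) ≤ x i} := by
      rintro _ ⟨x, ⟨I, hI, hx⟩, y, hy, rfl⟩
      exact ⟨I, hI, fun i => (hx i).trans (le_add_of_nonneg_right (hy i))⟩
    have h3 := convexHull_mono (𝕜 := ℝ) this
    rwa [convexHull_add, (convex_Ici (0 : Fin n → ℝ)).convexHull_eq] at h3
  have h3 := h2 (Set.add_mem_add h1 (show x - (fun i => (I i : ℝ)) ∈ Set.Ici (0 : Fin n → ℝ) from fun i => by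
    simpa using hx i))
  simpa using h3

/-- The exponents lying in the Newton polyhedron of `f`, described by its support function. -/
def newtonExponents (f : MvPowerSeries (Fin n) ℂ) : Set (Fin n →₀ ℕ) :=
  {I | ∀ w : Fin n → ℝ, (∀ i, 0 < w i) → ∀ J ∈ faceSupport w f, weight w J ≤ weight w I}

theorem mem_newtonExponents {f : MvPowerSeries (Fin n) ℂ} {I : Fin n →₀ ℕ}
    (hI : MvPowerSeries.coeff I f ≠ 0) : I ∈ newtonExponents f := fun _ _ _ hJ => hJ.2 I hI

/-- The minimum of a positive linear form is attained at an exponent on the diagram, so the diagram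
determines the support function on positive forms, and this determines the polyhedron. -/
theorem newtonDiagram_eq_iff {f h : MvPowerSeries (Fin n) ℂ}
    (hf : ∃ I, MvPowerSeries.coeff I f ≠ 0) :
    newtonDiagram h = newtonDiagram f ↔
      (∀ I, MvPowerSeries.coeff I h ≠ 0 → I ∈ newtonExponents f) ∧
      ∀ w : Fin n → ℝ, (∀ i, 0 < w i) → ∃ I, MvPowerSeries.coeff I h ≠ 0 ∧
        ∀ J ∈ newtonExponents f, weight w I ≤ weight w J := by
  constructor
  · intro heq
    have hh : ∃ I, MvPowerSeries.coeff I h ≠ 0 := by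
      obtain ⟨J, hJ⟩ := faceSupport_nonempty (w := fun _ => 1) (fun _ => one_pos) hf
      have h1 := coe_mem_newtonDiagram (fun _ => one_pos) hJ
      rw [← heq] at h1
      obtain ⟨x, I, hI, _⟩ := convexHull_nonempty_iff.1 ⟨_, h1.1⟩
      exact ⟨I, hI⟩
    constructor
    · intro I hI w hw J hJ
      obtain ⟨K, hK⟩ := faceSupport_nonempty hw hh
      exact (weight_le_of_newtonDiagram_subset heq.le hw hK hJ).trans (hK.2 I hI)
    · intro w hw
      obtain ⟨K, hK⟩ := faceSupport_nonempty hw hh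
      obtain ⟨J, hJ⟩ := faceSupport_nonempty hw hf
      exact ⟨K, hK.1, fun J' hJ' =>
        (weight_le_of_newtonDiagram_subset heq.ge hw hJ hK).trans (hJ' w hw J hJ)⟩
  · rintro ⟨h1, h2⟩
    have hh : ∃ I, MvPowerSeries.coeff I h ≠ 0 := by
      obtain ⟨I, hI, _⟩ := h2 (fun _ => 1) (fun _ => one_pos)
      exact ⟨I, hI⟩
    have : newtonPolyhedron h = newtonPolyhedron f := by
      refine (newtonPolyhedron_subset hf h1).antisymm (newtonPolyhedron_subset hh ?_)
      intro I hI w hw J hJ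
      obtain ⟨K, hK, hK'⟩ := h2 w hw
      exact (hJ.2 K hK).trans (hK' I (mem_newtonExponents hI))
    rw [newtonDiagram, newtonDiagram, this]

/-! ### Non-degeneracy on a face in terms of coefficients -/

theorem facePart_eq_sum {w : Fin n → ℝ} (hw : ∀ i, 0 < w i) {h : MvPowerSeries (Fin n) ℂ}
    {T : Finset (Fin n →₀ ℕ)}
    (hT : ∀ I, I ∈ faceSupport w h ↔ I ∈ T ∧ MvPowerSeries.coeff I h ≠ 0) :
    facePart w h = ∑ I ∈ T, MvPolynomial.monomial I (MvPowerSeries.coeff I h) := by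
  classical
  rw [facePart, finsum_mem_eq_finite_toFinset_sum _ (faceSupport_finite w hw h)]
  refine Finset.sum_subset (fun I hI => ((hT I).1 (by simpa using hI)).1) fun I hI hI' => ?_
  have : MvPowerSeries.coeff I h = 0 := by
    by_contra h0
    exact hI' (by simpa using (hT I).2 ⟨hI, h0⟩)
  rw [this, map_zero]

/-- The value at `z` of the logarithmic derivatives of `∑_{I ∈ T} h_I z^I`. -/
def logGradient (T : Finset (Fin n →₀ ℕ)) (h : (Fin n →₀ ℕ) → ℂ) (z : Fin n → ℂ) (i : Fin n) : ℂ :=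
  ∑ I ∈ T, h I * (∏ j, z j ^ I j) * (I i : ℂ)

/-- On the torus `∂ᵢ` and `zᵢ ∂ᵢ` vanish together. The polynomial is quasi-homogeneous of weight `c
≠ 0`, so Euler's relation makes its value vanish with its derivatives. -/
theorem singular_iff_logGradient {w : Fin n → ℝ} {c : ℝ} (hc : c ≠ 0)
    {T : Finset (Fin n →₀ ℕ)} (hT : ∀ I ∈ T, weight w I = c) (a : (Fin n →₀ ℕ) → ℂ)
    {z : Fin n → ℂ} (hz : ∀ i, z i ≠ 0) :
    (MvPolynomial.eval z (∑ I ∈ T, MvPolynomial.monomial I (a I)) = 0 ∧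
      ∀ i, MvPolynomial.eval z (MvPolynomial.pderiv i
        (∑ I ∈ T, MvPolynomial.monomial I (a I))) = 0) ↔ ∀ i, logGradient T a z i = 0 := by
  have hev : ∀ I, MvPolynomial.eval z (MvPolynomial.monomial I (a I)) = a I * ∏ j, z j ^ I j :=
    fun I => by rw [MvPolynomial.eval_monomial, Finsupp.prod_fintype _ _ (by simp)]
  have hd : ∀ i, z i * MvPolynomial.eval z (MvPolynomial.pderiv i
      (∑ I ∈ T, MvPolynomial.monomial I (a I))) = logGradient T a z i := fun i => by
    rw [map_sum, map_sum, Finset.mul_sum, logGradient]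
    refine Finset.sum_congr rfl fun I _ => ?_
    have := congrArg (MvPolynomial.eval z) (MvPolynomial.X_mul_pderiv_monomial (i := i) (m := I)
      (r := a I))
    rw [map_mul, MvPolynomial.eval_X, map_nsmul, hev, nsmul_eq_mul] at this
    rw [this]
    ring
  constructor
  · rintro ⟨_, h⟩ i
    rw [← hd, h, mul_zero]
  · intro h
    refine ⟨?_, fun i => ?_⟩
    · have h1 : ∑ i, (w i : ℂ) * logGradient T a z i =
          c * MvPolynomial.eval z (∑ I ∈ T, MvPolynomial.monomial I (a I)) := by
        simp only [logGradient, Finset.mul_sum, map_sum, hev]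
        rw [Finset.sum_comm]
        refine Finset.sum_congr rfl fun I hI => ?_
        rw [← hT I hI, weight]
        push_cast
        rw [Finset.sum_mul]
        exact Finset.sum_congr rfl fun i _ => by ring
      simp only [h, mul_zero, Finset.sum_const_zero] at h1
      exact (mul_eq_zero.1 h1.symm).resolve_left (by exact_mod_cast hc)
    · have := hd i
      rw [h, mul_eq_zero] at this
      exact this.resolve_left (hz i)

/-- The condition on the coefficients of a series that its Newton diagram be a given one and that
the series be Newton-non-degenerate. -/
def NDCondition (E : Set (Fin n →₀ ℕ)) (𝒯 : Set (Finset (Fin n →₀ ℕ)))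
    (h : (Fin n →₀ ℕ) → ℂ) : Prop :=
  (∀ I, h I ≠ 0 → I ∈ E) ∧
    ∀ T ∈ 𝒯, ∀ z : Fin n → ℂ, (∀ i, z i ≠ 0) → ¬ ∀ i, logGradient T h z i = 0

theorem degree_eq_sum (I : Fin n →₀ ℕ) : I.degree = ∑ i, I i := by
  rw [Finsupp.degree_apply]
  exact Finset.sum_subset (Finset.subset_univ _) fun i _ hi => by simpa using hi

theorem exists_eq_single_of_degree_eq_one {I : Fin n →₀ ℕ} (hI : I.degree = 1) :
    ∃ i, I = Finsupp.single i 1 := by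
  obtain ⟨i, hi⟩ : ∃ i, I i ≠ 0 := by
    by_contra! hcon
    rw [show I = 0 from Finsupp.ext hcon] at hI
    simp at hI
  have h1 : Finsupp.single i 1 ≤ I := Finsupp.single_le_iff.2 (Nat.one_le_iff_ne_zero.2 hi)
  have h2 : (I - Finsupp.single i 1).degree = 0 := by
    have := congrArg Finsupp.degree (tsub_add_cancel_of_le h1)
    rw [map_add, hI, Finsupp.degree_single] at this
    omega
  refine ⟨i, ?_⟩
  have h3 : I - Finsupp.single i 1 = 0 := (Finsupp.degree_eq_zero_iff _).1 h2
  exact le_antisymm (tsub_eq_zero_iff_le.1 h3) h1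

/-- The members of `𝒯` are the sets where positive linear forms are minimal on `E`. There are
finitely many, since pure powers bound their degrees by `R`. Smoothness on all of them already
forces the support of `h` to reach every face, so no separate condition on the vertices is needed.
-/
theorem exists_ndCondition (hn : 1 ≤ n) {D : Set (Fin n → ℝ)} (hD : IsCommodeDiagram D) :
    ∃ (R : ℕ) (E : Set (Fin n →₀ ℕ)) (𝒯 : Set (Finset (Fin n →₀ ℕ))), 𝒯.Finite ∧
      (∀ I, R ≤ I.degree → I ∈ E) ∧ (∀ I, I.degree ≤ 1 → I ∉ E) ∧
      (∀ T ∈ 𝒯, (∀ I ∈ T, I ∈ E ∧ I.degree ≤ R) ∧ T.Nonempty ∧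
        ∃ (w : Fin n → ℝ) (c : ℝ), c ≠ 0 ∧ ∀ I ∈ T, weight w I = c) ∧
      ∀ h : MvPowerSeries (Fin n) ℂ, (newtonDiagram h = D ∧ IsNewtonNondegenerate h) ↔
        NDCondition E 𝒯 fun I => MvPowerSeries.coeff I h := by
  classical
  obtain ⟨f, _, hsing, hcom, rfl⟩ := hD
  choose m hm using hcom
  have hm0 : ∀ i, 0 < m i := fun i => by
    refine Nat.pos_of_ne_zero fun h => hm i ?_
    rw [h, Finsupp.single_zero, MvPowerSeries.coeff_zero_eq_constantCoeff_apply]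
    exact hsing.1
  -- Only `R > 0` and `m i ≤ R` matter.
  let R : ℕ := ∑ i, m i
  have hf : ∃ I, MvPowerSeries.coeff I f ≠ 0 := ⟨_, hm ⟨0, hn⟩⟩
  set E := newtonExponents f with hE
  have hlow : ∀ J, MvPowerSeries.coeff J f ≠ 0 → 2 ≤ J.degree := fun J hJ => by
    by_contra hlt
    have h1 : J.degree = 0 ∨ J.degree = 1 := by omega
    rcases h1 with h1 | h1
    · rw [(Finsupp.degree_eq_zero_iff J).1 h1] at hJ
      exact hJ hsing.1
    · obtain ⟨i, rfl⟩ := exists_eq_single_of_degree_eq_one h1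
      exact hJ (hsing.2 i)
  have hmE : ∀ i, Finsupp.single i (m i) ∈ E := fun i => mem_newtonExponents (hm i)
  -- The pure power minimizing `w k * m k` compares weight with degree, uniformly in `w`. This gives
  -- both `hhigh` and `hTdeg`.
  have hbound : ∀ w : Fin n → ℝ, (∀ i, 0 < w i) → ∃ J, MvPowerSeries.coeff J f ≠ 0 ∧
      0 < weight w J ∧ ∀ I, weight w J * (I.degree : ℝ) ≤ R * weight w I := by
    intro w hw
    obtain ⟨k, _, hk⟩ := Finset.exists_min_image Finset.univ (fun i => w i * m i)
      ⟨⟨0, hn⟩, Finset.mem_univ _⟩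
    have hwk : weight w (Finsupp.single k (m k)) = w k * m k := by
      rw [weight, Finset.sum_eq_single k] <;> simp +contextual [eq_comm]
    refine ⟨_, hm k, ?_, fun I => ?_⟩
    · rw [hwk]
      exact mul_pos (hw k) (by exact_mod_cast hm0 k)
    · rw [hwk, degree_eq_sum, weight, Nat.cast_sum, Finset.mul_sum, Finset.mul_sum]
      refine Finset.sum_le_sum fun i hi => ?_
      have h1 : (m i : ℝ) ≤ R := by
        exact_mod_cast Finset.single_le_sum (f := m) (fun _ _ => Nat.zero_le _) hi
      calc w k * m k * (I i : ℝ) ≤ w i * m i * I i :=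
            mul_le_mul_of_nonneg_right (hk i hi) (Nat.cast_nonneg _)
        _ ≤ w i * R * I i := by
            have := hw i
            gcongr
        _ = R * (w i * I i) := by ring
  have hR0 : (0 : ℝ) < R := by
    exact_mod_cast (hm0 ⟨0, hn⟩).trans_le
      (Finset.single_le_sum (f := m) (fun _ _ => Nat.zero_le _) (Finset.mem_univ _))
  have hhigh : ∀ I : Fin n →₀ ℕ, R ≤ I.degree → I ∈ E := by
    intro I hI w hw J hJ
    obtain ⟨K, hK, hK0, hKI⟩ := hbound w hw
    refine (hJ.2 K hK).trans ?_
    have h1 := hKI I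
    have h2 : (R : ℝ) ≤ I.degree := by exact_mod_cast hI
    refine le_of_mul_le_mul_left ?_ hR0
    calc (R : ℝ) * weight w K ≤ I.degree * weight w K := by gcongr
      _ ≤ _ := by linarith
  have hTdeg : ∀ w : Fin n → ℝ, (∀ i, 0 < w i) → ∀ I, (∀ J ∈ E, weight w I ≤ weight w J) →
      I.degree ≤ R := by
    intro w hw I hI
    obtain ⟨K, hK, hK0, hKI⟩ := hbound w hw
    have h1 := hI K (mem_newtonExponents hK)
    have h2 : weight w K * (I.degree : ℝ) ≤ weight w K * R := by
      refine (hKI I).trans ?_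
      rw [mul_comm (weight w K)]
      gcongr
    exact_mod_cast le_of_mul_le_mul_left h2 hK0
  have hdegfin : {I : Fin n →₀ ℕ | I.degree ≤ R}.Finite := by
    refine (finite_weight_le (w := fun _ => 1) (fun _ => one_pos) R).subset fun I hI => ?_
    simp only [weight, one_mul, Set.mem_ofPred_eq]
    rw [← Nat.cast_sum, ← degree_eq_sum]
    exact_mod_cast hI
  let 𝒯 : Set (Finset (Fin n →₀ ℕ)) := {T | ∃ w : Fin n → ℝ, (∀ i, 0 < w i) ∧
    ∀ I, I ∈ T ↔ I ∈ E ∧ ∀ J ∈ E, weight w I ≤ weight w J}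
  have hTw : ∀ w : Fin n → ℝ, (∀ i, 0 < w i) → ∃ T ∈ 𝒯,
      ∀ I, I ∈ T ↔ I ∈ E ∧ ∀ J ∈ E, weight w I ≤ weight w J := by
    intro w hw
    let S := {I | I ∈ E ∧ ∀ J ∈ E, weight w I ≤ weight w J}
    have hS : S.Finite := hdegfin.subset fun I hI => hTdeg w hw I hI.2
    exact ⟨hS.toFinset, ⟨w, hw, by simp [S]⟩, by simp [S]⟩
  refine ⟨R, E, 𝒯, ?_, hhigh, ?_, ?_, fun h => ?_⟩
  · refine (hdegfin.toFinset.powerset : Finset (Finset (Fin n →₀ ℕ))).finite_toSet.subset ?_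
    rintro T ⟨w, hw, hT⟩
    simp only [Finset.coe_powerset, Set.mem_preimage, Set.mem_powerset_iff]
    intro I hI
    simpa using hTdeg w hw I ((hT I).1 hI).2
  · intro I hI hIE
    obtain ⟨J, hJ⟩ := faceSupport_nonempty (w := fun _ => 1) (fun _ => one_pos) hf
    have h1 := hIE _ (fun _ => one_pos) J hJ
    simp only [weight, one_mul] at h1
    rw [← Nat.cast_sum, ← degree_eq_sum, ← Nat.cast_sum, ← degree_eq_sum] at h1
    have h2 : J.degree ≤ I.degree := by exact_mod_cast h1
    have := hlow J hJ.1
    omega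
  · rintro T ⟨w, hw, hT⟩
    obtain ⟨J, hJ⟩ := faceSupport_nonempty hw hf
    have hJE := mem_newtonExponents hJ.1
    have hJT : J ∈ T := (hT J).2 ⟨hJE, fun K hK => hK w hw J hJ⟩
    refine ⟨fun I hI => ⟨((hT I).1 hI).1, hTdeg w hw I ((hT I).1 hI).2⟩, ⟨J, hJT⟩,
      w, weight w J, ?_, fun I hI => ?_⟩
    · obtain ⟨i, hi⟩ : ∃ i, J i ≠ 0 := by
        by_contra! hcon
        have h0 : J = 0 := Finsupp.ext hcon
        have := hlow J hJ.1
        simp [h0] at this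
      refine (lt_of_lt_of_le ?_ (Finset.single_le_sum (f := fun j => w j * (J j : ℝ))
        (fun j _ => mul_nonneg (hw j).le (Nat.cast_nonneg _)) (Finset.mem_univ i))).ne'
      exact mul_pos (hw i) (by exact_mod_cast Nat.pos_of_ne_zero hi)
    · exact le_antisymm (((hT I).1 hI).2 J hJE) (((hT J).1 hJT).2 I ((hT I).1 hI).1)
  · rw [newtonDiagram_eq_iff hf, ← hE]
    have hface : (∀ I, MvPowerSeries.coeff I h ≠ 0 → I ∈ E) → ∀ w : Fin n → ℝ, (∀ i, 0 < w i) →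
        (∃ I, MvPowerSeries.coeff I h ≠ 0 ∧ ∀ J ∈ E, weight w I ≤ weight w J) →
        ∀ T : Finset (Fin n →₀ ℕ), (∀ I, I ∈ T ↔ I ∈ E ∧ ∀ J ∈ E, weight w I ≤ weight w J) →
        ∀ z : Fin n → ℂ, (∀ i, z i ≠ 0) →
        ((MvPolynomial.eval z (facePart w h) = 0 ∧
          ∀ i, MvPolynomial.eval z (MvPolynomial.pderiv i (facePart w h)) = 0) ↔
        ∀ i, logGradient T (fun I => MvPowerSeries.coeff I h) z i = 0) := by
      intro hsupp w hw hex T hT z hz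
      obtain ⟨K, hK, hKE⟩ := hex
      have hKT : K ∈ T := (hT K).2 ⟨hsupp K hK, hKE⟩
      have h1 : ∀ I, I ∈ faceSupport w h ↔ I ∈ T ∧ MvPowerSeries.coeff I h ≠ 0 := fun I => by
        constructor
        · rintro ⟨hI, hI'⟩
          exact ⟨(hT I).2 ⟨hsupp I hI, fun J hJ => (hI' K hK).trans (hKE J hJ)⟩, hI⟩
        · rintro ⟨hI, hI'⟩
          exact ⟨hI', fun J hJ => ((hT I).1 hI).2 J (hsupp J hJ)⟩
      have h2 : weight w K ≠ 0 := by
        obtain ⟨J, hJ⟩ := faceSupport_nonempty hw hf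
        obtain ⟨i, hi⟩ : ∃ i, K i ≠ 0 := by
          by_contra! hcon
          have h0 : K = 0 := Finsupp.ext hcon
          have h3 := hsupp K hK (fun _ => 1) (fun _ => one_pos)
          obtain ⟨J, hJ⟩ := faceSupport_nonempty (w := fun _ => 1) (fun _ => one_pos) hf
          have h4 := h3 J hJ
          simp only [weight, one_mul] at h4
          rw [← Nat.cast_sum, ← degree_eq_sum, ← Nat.cast_sum, ← degree_eq_sum, h0] at h4
          have h5 : J.degree ≤ 0 := by exact_mod_cast h4
          have := hlow J hJ.1
          omega
        refine (lt_of_lt_of_le ?_ (Finset.single_le_sum (f := fun j => w j * (K j : ℝ))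
          (fun j _ => mul_nonneg (hw j).le (Nat.cast_nonneg _)) (Finset.mem_univ i))).ne'
        exact mul_pos (hw i) (by exact_mod_cast Nat.pos_of_ne_zero hi)
      rw [facePart_eq_sum hw h1]
      exact singular_iff_logGradient h2 (fun I hI => le_antisymm (((hT I).1 hI).2 K (hsupp K hK))
        (hKE I ((hT I).1 hI).1)) _ hz
    constructor
    · rintro ⟨⟨h1, h2⟩, h3⟩
      refine ⟨h1, ?_⟩
      rintro T ⟨w, hw, hT⟩ z hz
      rw [← hface h1 w hw (h2 w hw) T hT z hz]
      exact h3 w hw z hz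
    · rintro ⟨h1, h2⟩
      have h4 : ∀ w : Fin n → ℝ, (∀ i, 0 < w i) → ∃ I, MvPowerSeries.coeff I h ≠ 0 ∧
          ∀ J ∈ E, weight w I ≤ weight w J := by
        intro w hw
        obtain ⟨T, hT𝒯, hT⟩ := hTw w hw
        by_contra! hcon
        -- If `h` missed the face, all its coefficients on `T` would vanish and every point of the
        -- torus would be singular.
        refine h2 T hT𝒯 (fun _ => 1) (fun _ => one_ne_zero) fun i => ?_
        refine Finset.sum_eq_zero fun I hI => ?_
        have : MvPowerSeries.coeff I h = 0 := by
          by_contra h0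
          obtain ⟨J, hJ, hlt⟩ := hcon I h0
          exact absurd (((hT I).1 hI).2 J hJ) (not_le.2 hlt)
        simp [this]
      refine ⟨⟨h1, h4⟩, fun w hw z hz => ?_⟩
      obtain ⟨T, hT𝒯, hT⟩ := hTw w hw
      rw [hface h1 w hw (h4 w hw) T hT z hz]
      exact h2 T hT𝒯 z hz

end NDStratum
end

noncomputable section
namespace NDStratum

/-! ### Jets and substitution -/

open MvPowerSeries

variable {n : ℕ}

/-- Two power series have the same jet of order `N`. -/
def JetEq (N : ℕ) (f g : MvPowerSeries (Fin n) ℂ) : Prop :=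
  ∀ I : Fin n →₀ ℕ, I.degree ≤ N → coeff I f = coeff I g

namespace JetEq

variable {N : ℕ} {f g h : MvPowerSeries (Fin n) ℂ}

theorem refl (f : MvPowerSeries (Fin n) ℂ) : JetEq N f f := fun _ _ => rfl

theorem symm (h : JetEq N f g) : JetEq N g f := fun I hI => (h I hI).symm

theorem trans (h₁ : JetEq N f g) (h₂ : JetEq N g h) : JetEq N f h := fun I hI =>
  (h₁ I hI).trans (h₂ I hI)

theorem mono {M : ℕ} (hMN : M ≤ N) (h : JetEq N f g) : JetEq M f g := fun I hI =>
  h I (hI.trans hMN)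

theorem iff_truncTotal : JetEq N f g ↔ truncTotal (N + 1) f = truncTotal (N + 1) g := by
  constructor
  · intro h
    ext I
    rw [coeff_truncTotal_eq_ite, coeff_truncTotal_eq_ite]
    split_ifs with hI
    · exact h I (Nat.lt_succ_iff.1 hI)
    · rfl
  · intro h I hI
    rw [← coeff_truncTotal f (Nat.lt_succ_iff.2 hI), ← coeff_truncTotal g (Nat.lt_succ_iff.2 hI), h]

theorem iff_order : JetEq N f g ↔ ((N + 1 : ℕ) : ℕ∞) ≤ (f - g).order := by
  constructor
  · intro h
    refine nat_le_order fun I hI => ?_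
    rw [map_sub, h I (Nat.lt_succ_iff.1 hI), sub_self]
  · intro h I hI
    have : coeff I (f - g) = 0 := coeff_of_lt_order
      (lt_of_lt_of_le (by exact_mod_cast Nat.lt_succ_iff.2 hI) h)
    rwa [map_sub, sub_eq_zero] at this

/-- Substituting series without constant term does not lower degrees, so low-degree terms of the
composite come from low-degree terms of the data. -/
theorem subst {a b : Fin n → MvPowerSeries (Fin n) ℂ} (ha : ∀ i, constantCoeff (a i) = 0)
    (hb : ∀ i, constantCoeff (b i) = 0) (hab : ∀ i, JetEq N (a i) (b i)) (hfg : JetEq N f g) :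
    JetEq N (f.subst a) (g.subst b) := by
  rw [iff_truncTotal] at hfg ⊢
  rw [truncTotal_subst ha, truncTotal_subst hb, hfg]
  simp only [iff_truncTotal.1 (hab _)]

theorem truncTotal (f : MvPowerSeries (Fin n) ℂ) :
    JetEq N (MvPowerSeries.truncTotal (N + 1) f : MvPowerSeries (Fin n) ℂ) f := fun I hI => by
  rw [MvPolynomial.coeff_coe, coeff_truncTotal f (Nat.lt_succ_iff.2 hI)]

end JetEq

theorem isConvergent_coe (p : MvPolynomial (Fin n) ℂ) :
    IsConvergent (p : MvPowerSeries (Fin n) ℂ) := by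
  refine ⟨1, one_pos, summable_of_ne_finset_zero (s := p.support) fun I hI => ?_⟩
  rw [MvPolynomial.coeff_coe, MvPolynomial.notMem_support_iff.1 hI]
  simp

/-! ### Approximate inverses -/

theorem le_order_add {f g : MvPowerSeries (Fin n) ℂ} {m : ℕ∞} (hf : m ≤ f.order)
    (hg : m ≤ g.order) : m ≤ (f + g).order := (le_min hf hg).trans min_order_le_add

theorem le_order_sum {α : Type*} (s : Finset α) {f : α → MvPowerSeries (Fin n) ℂ} {m : ℕ∞}
    (hf : ∀ a ∈ s, m ≤ (f a).order) : m ≤ (∑ a ∈ s, f a).order := by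
  classical
  induction s using Finset.induction_on with
  | empty => simp
  | insert a s ha ih =>
    rw [Finset.sum_insert ha]
    exact le_order_add (hf a (Finset.mem_insert_self _ _))
      (ih fun b hb => hf b (Finset.mem_insert_of_mem hb))

theorem le_order_mul' {f g : MvPowerSeries (Fin n) ℂ} {a b m : ℕ} (hf : (a : ℕ∞) ≤ f.order)
    (hg : (b : ℕ∞) ≤ g.order) (hm : m ≤ a + b) : (m : ℕ∞) ≤ (f * g).order :=
  le_trans (by exact_mod_cast hm) ((add_le_add hf hg).trans le_order_mul)

theorem le_order_smul' {f : MvPowerSeries (Fin n) ℂ} {m : ℕ∞} (c : ℂ) (hf : m ≤ f.order) :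
    m ≤ (c • f).order := hf.trans le_order_smul

/-- First order Taylor expansion of a polynomial in power series. -/
theorem le_order_aeval_add (k : ℕ) (ψ δ : Fin n → MvPowerSeries (Fin n) ℂ)
    (hψ : ∀ i, constantCoeff (ψ i) = 0) (hδ : ∀ i, ((k + 1 : ℕ) : ℕ∞) ≤ (δ i).order)
    (p : MvPolynomial (Fin n) ℂ) :
    ((k + 2 : ℕ) : ℕ∞) ≤ (MvPolynomial.aeval (fun i => ψ i + δ i) p - MvPolynomial.aeval ψ p -
      ∑ i, MvPolynomial.coeff (Finsupp.single i 1) p • δ i).order := by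
  have hψ1 : ∀ i, ((1 : ℕ) : ℕ∞) ≤ (ψ i).order := fun i => by
    exact_mod_cast one_le_order_iff_constCoeff_eq_zero.2 (hψ i)
  have hδ1 : ∀ i, ((1 : ℕ) : ℕ∞) ≤ (δ i).order := fun i =>
    le_trans (by exact_mod_cast Nat.le_add_left 1 k) (hδ i)
  induction p using MvPolynomial.induction_on with
  | C c =>
    have : ∀ i : Fin n, MvPolynomial.coeff (Finsupp.single i 1) (MvPolynomial.C c) = 0 := fun i => by
      rw [MvPolynomial.coeff_C, if_neg]
      exact (Finsupp.single_ne_zero.2 one_ne_zero).symm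
    simp [this]
  | add p q hp hq =>
    convert le_order_add hp hq using 2
    simp only [map_add, MvPolynomial.coeff_add, add_smul, Finset.sum_add_distrib]
    ring
  | mul_X p j hp =>
    set P := MvPolynomial.aeval ψ p with hP
    set P' := MvPolynomial.aeval (fun i => ψ i + δ i) p with hP'
    set ℓ := ∑ i, MvPolynomial.coeff (Finsupp.single i 1) p • δ i with hℓ
    set c := MvPolynomial.constantCoeff p with hc
    have h1 : ∑ i, MvPolynomial.coeff (Finsupp.single i 1) (p * MvPolynomial.X j) • δ i =
        c • δ j := by
      rw [Finset.sum_eq_single j]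
      · have := MvPolynomial.coeff_mul_X 0 j p
        rw [zero_add] at this
        rw [this, hc, MvPolynomial.constantCoeff_eq]
      · intro i _ hij
        rw [MvPolynomial.coeff_mul_X', if_neg, zero_smul]
        simpa [Finsupp.single_apply, eq_comm] using hij
      · simp
    have h2 : ((1 : ℕ) : ℕ∞) ≤ (P' - MvPowerSeries.C c).order := by
      have : constantCoeff (P' - MvPowerSeries.C c) = 0 := by
        have h3 : ((constantCoeff : MvPowerSeries (Fin n) ℂ →+* ℂ).comp
            (MvPolynomial.aeval (fun i => ψ i + δ i) :
              MvPolynomial (Fin n) ℂ →ₐ[ℂ] MvPowerSeries (Fin n) ℂ).toRingHom) =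
            MvPolynomial.constantCoeff := by
          have hδ0 : ∀ i, constantCoeff (δ i) = 0 := fun i =>
            one_le_order_iff_constCoeff_eq_zero.1 (by exact_mod_cast hδ1 i)
          ext i
          · simp [MvPowerSeries.algebraMap_apply]
          · simp [hψ, hδ0]
        rw [map_sub, constantCoeff_C, sub_eq_zero]
        exact RingHom.congr_fun h3 p
      exact_mod_cast one_le_order_iff_constCoeff_eq_zero.2 this
    have h3 : ((k + 1 : ℕ) : ℕ∞) ≤ (P' - P).order := by
      have h4 : ((k + 1 : ℕ) : ℕ∞) ≤ ℓ.order :=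
        le_order_sum _ fun i _ => le_order_smul' _ (hδ i)
      have := le_order_add (le_trans (by exact_mod_cast Nat.le_succ (k + 1)) hp) h4
      simpa using this
    -- The remainder for `p * X j` is `(P' - P) ψⱼ + (P' - c) δⱼ`, with orders at least `(k + 1) +
    -- 1` and `1 + (k + 1)`.
    have h5 := le_order_add (le_order_mul' (m := k + 2) h3 (hψ1 j) le_rfl)
      (le_order_mul' (m := k + 2) h2 (hδ j) (by omega))
    convert h5 using 2
    rw [h1, map_mul, map_mul, MvPolynomial.aeval_X, MvPolynomial.aeval_X, smul_eq_C_mul]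
    ring

/-- The Jacobian matrix at the origin. -/
def jacobian (φ : Fin n → MvPowerSeries (Fin n) ℂ) : Matrix (Fin n) (Fin n) ℂ :=
  Matrix.of fun i j => coeff (Finsupp.single j 1) (φ i)

/-- The chain rule at the origin. -/
theorem coeff_single_subst {δ : Fin n → MvPowerSeries (Fin n) ℂ}
    (hδ : ∀ i, constantCoeff (δ i) = 0) (f : MvPowerSeries (Fin n) ℂ) (j : Fin n) :
    coeff (Finsupp.single j 1) (f.subst δ) =
      ∑ i, coeff (Finsupp.single i 1) f * coeff (Finsupp.single j 1) (δ i) := by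
  have h0 : ∀ i, JetEq 1 (δ i) (δ i) := fun i => JetEq.refl _
  have h1 := JetEq.subst hδ hδ h0 (JetEq.truncTotal (N := 1) f).symm (Finsupp.single j 1) (by simp)
  rw [h1, subst_coe]
  -- The Taylor expansion is taken at the zero map, where the zeroth term is the constant
  -- coefficient.
  have h2 := le_order_aeval_add 0 0 δ (by simp) (fun i => by
    exact_mod_cast one_le_order_iff_constCoeff_eq_zero.2 (hδ i)) (truncTotal (1 + 1) f)
  have h3 := coeff_of_lt_order (d := Finsupp.single j 1) (lt_of_lt_of_le (by simp) h2)
  have h4 : ∀ p : MvPolynomial (Fin n) ℂ, MvPolynomial.aeval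
      (0 : Fin n → MvPowerSeries (Fin n) ℂ) p = MvPowerSeries.C (MvPolynomial.constantCoeff p) := by
    intro p
    rw [MvPolynomial.aeval_zero]
    rfl
  simp only [Pi.zero_apply, zero_add] at h3
  rw [map_sub, map_sub, h4, coeff_C, if_neg (Finsupp.single_ne_zero.2 one_ne_zero), sub_zero,
    sub_eq_zero] at h3
  rw [h3, map_sum]
  refine Finset.sum_congr rfl fun i _ => ?_
  rw [coeff_truncTotal _ (by simp), coeff_smul]

/-- Successive approximation: correcting `ψ` by `-M` applied to the error `e` changes the composite
by `-e` to first order, so each step raises the order of the error by one. -/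
theorem exists_right_inverse_aux {p : Fin n → MvPolynomial (Fin n) ℂ}
    (hp : ∀ i, MvPolynomial.constantCoeff (p i) = 0) {M : Matrix (Fin n) (Fin n) ℂ}
    (hM : (Matrix.of fun i j => MvPolynomial.coeff (Finsupp.single j 1) (p i)) * M = 1) (k : ℕ) :
    ∃ ψ : Fin n → MvPowerSeries (Fin n) ℂ, (∀ i, constantCoeff (ψ i) = 0) ∧
      ∀ i, ((k + 1 : ℕ) : ℕ∞) ≤ (MvPolynomial.aeval ψ (p i) - X i).order := by
  induction k with
  | zero =>
    refine ⟨0, by simp, fun i => ?_⟩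
    have : constantCoeff (MvPolynomial.aeval (0 : Fin n → MvPowerSeries (Fin n) ℂ) (p i) -
        X i) = 0 := by
      rw [MvPolynomial.aeval_zero, hp]
      simp
    exact_mod_cast one_le_order_iff_constCoeff_eq_zero.2 this
  | succ k ih =>
    obtain ⟨ψ, hψ, he⟩ := ih
    set e : Fin n → MvPowerSeries (Fin n) ℂ := fun i => MvPolynomial.aeval ψ (p i) - X i with he'
    let δ : Fin n → MvPowerSeries (Fin n) ℂ := fun j => ∑ l, (-M j l) • e l
    have hδ : ∀ j, ((k + 1 : ℕ) : ℕ∞) ≤ (δ j).order := fun j =>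
      le_order_sum _ fun l _ => le_order_smul' _ (he l)
    have hδ0 : ∀ j, constantCoeff (δ j) = 0 := fun j =>
      one_le_order_iff_constCoeff_eq_zero.1
        (le_trans (by exact_mod_cast Nat.le_add_left 1 k) (hδ j))
    refine ⟨fun i => ψ i + δ i, fun i => by rw [map_add, hψ, hδ0, add_zero], fun i => ?_⟩
    have h1 := le_order_aeval_add k ψ δ hψ hδ (p i)
    convert h1 using 2
    have h2 : ∑ j, MvPolynomial.coeff (Finsupp.single j 1) (p i) • δ j = -e i := by
      simp only [δ, Finset.smul_sum, smul_smul]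
      rw [Finset.sum_comm]
      have h3 : ∀ l, ∑ j, (MvPolynomial.coeff (Finsupp.single j 1) (p i) * -M j l) • e l =
          (-(1 : Matrix (Fin n) (Fin n) ℂ) i l) • e l := fun l => by
        rw [← Finset.sum_smul, ← hM, Matrix.mul_apply, ← Finset.sum_neg_distrib]
        simp
      simp only [h3, Matrix.one_apply]
      rw [Finset.sum_eq_single i] <;> simp +contextual [eq_comm]
    rw [h2, he']
    ring

/-- An inverse modulo order `N + 1` is enough for jets and can be truncated to a polynomial, which
settles convergence. Since `N ≥ 1`, the chain rule makes its Jacobian inverse to that of `φ`. -/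
theorem exists_right_inverse {φ : Fin n → MvPowerSeries (Fin n) ℂ}
    (hφ : ∀ i, constantCoeff (φ i) = 0) (hφd : IsUnit (jacobian φ).det) {N : ℕ} (hN : 1 ≤ N) :
    ∃ ψ : Fin n → MvPolynomial (Fin n) ℂ, (∀ i, MvPolynomial.constantCoeff (ψ i) = 0) ∧
      (∀ i I, N < Finsupp.degree I → MvPolynomial.coeff I (ψ i) = 0) ∧
      IsUnit (jacobian fun i => (ψ i : MvPowerSeries (Fin n) ℂ)).det ∧
      ∀ i, JetEq N ((φ i).subst fun j => (ψ j : MvPowerSeries (Fin n) ℂ)) (X i) := by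
  obtain ⟨ψ, hψ, hψφ⟩ := exists_right_inverse_aux (p := fun i => truncTotal (N + 1) (φ i))
    (M := (jacobian φ)⁻¹) (fun i => by rw [constantCoeff_truncTotal_eq_ite, hφ, ite_self]) (by
      rw [← Matrix.mul_nonsing_inv _ hφd]
      congr 1
      ext i j
      simp only [Matrix.of_apply, jacobian]
      rw [coeff_truncTotal]
      simpa using Nat.lt_of_succ_le hN) N
  have h0 : ∀ i, constantCoeff (truncTotal (N + 1) (ψ i) : MvPowerSeries (Fin n) ℂ) = 0 :=
    fun i => (JetEq.truncTotal (ψ i) 0 (by simp)).trans (hψ i)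
  have key : ∀ i, JetEq N ((φ i).subst fun j =>
      (truncTotal (N + 1) (ψ j) : MvPowerSeries (Fin n) ℂ)) (X i) := fun i => by
    refine (JetEq.subst h0 hψ (fun j => JetEq.truncTotal _) (JetEq.truncTotal (φ i)).symm).trans ?_
    rw [subst_coe]
    exact JetEq.iff_order.2 (hψφ i)
  refine ⟨fun i => truncTotal (N + 1) (ψ i), fun i => ?_, fun i I hI => ?_, ?_, key⟩
  · rw [constantCoeff_truncTotal_eq_ite, hψ, ite_self]
  · exact coeff_truncTotal_eq_zero _ hI
  · have h1 : jacobian φ * jacobian (fun i =>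
        (truncTotal (N + 1) (ψ i) : MvPowerSeries (Fin n) ℂ)) = 1 := by
      ext i j
      rw [Matrix.mul_apply]
      have := key i (Finsupp.single j 1) (by simpa using hN)
      rw [coeff_single_subst h0] at this
      simp only [jacobian, Matrix.of_apply]
      rw [this, coeff_X, Matrix.one_apply]
      simp [Finsupp.single_left_inj, eq_comm]
    exact Matrix.isUnit_det_of_left_inverse h1

/-! ### Germs of a given type in terms of jets -/

/-- The non-degeneracy condition depends on a jet only. -/
theorem NDCondition.of_jetEq {E : Set (Fin n →₀ ℕ)} {𝒯 : Set (Finset (Fin n →₀ ℕ))} {R : ℕ}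
    (hE : ∀ I, R ≤ Finsupp.degree I → I ∈ E) (h𝒯 : ∀ T ∈ 𝒯, ∀ I ∈ T, Finsupp.degree I ≤ R)
    {f g : MvPowerSeries (Fin n) ℂ} (hfg : JetEq R f g)
    (hf : NDCondition E 𝒯 fun I => coeff I f) : NDCondition E 𝒯 fun I => coeff I g := by
  refine ⟨fun I hI => ?_, fun T hT z hz => ?_⟩
  · by_cases h : R ≤ I.degree
    · exact hE I h
    · refine hf.1 I ?_
      change coeff I f ≠ 0
      rw [hfg I (not_le.1 h).le]
      exact hI
  · have : ∀ i, logGradient T (fun I => coeff I f) z i = logGradient T (fun I => coeff I g) z i :=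
      fun i => Finset.sum_congr rfl fun I hI => by
        simp only [hfg I (h𝒯 T hT I hI)]
    simp only [← this]
    exact hf.2 T hT z hz

theorem NDCondition.smul {E : Set (Fin n →₀ ℕ)} {𝒯 : Set (Finset (Fin n →₀ ℕ))}
    {h : (Fin n →₀ ℕ) → ℂ} (hh : NDCondition E 𝒯 h) {c : ℂ} (hc : c ≠ 0) :
    NDCondition E 𝒯 fun I => c * h I := by
  refine ⟨fun I hI => hh.1 I (right_ne_zero_of_mul hI), fun T hT z hz hcon => hh.2 T hT z hz ?_⟩
  intro i
  have h1 : logGradient T (fun I => c * h I) z i = c * logGradient T h z i := by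
    rw [logGradient, logGradient, Finset.mul_sum]
    exact Finset.sum_congr rfl fun I _ => by ring
  have h2 := hcon i
  rw [h1, mul_eq_zero] at h2
  exact h2.resolve_left hc

section GermType

variable {D : Set (Fin n → ℝ)} {R : ℕ} {E : Set (Fin n →₀ ℕ)} {𝒯 : Set (Finset (Fin n →₀ ℕ))}

theorem hasNDType_iff_ndCondition
    (hD : ∀ h : MvPowerSeries (Fin n) ℂ, (newtonDiagram h = D ∧ IsNewtonNondegenerate h) ↔
      NDCondition E 𝒯 fun I => coeff I h) (f : MvPowerSeries (Fin n) ℂ) :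
    HasNDType D f ↔ ∃ ψ : Fin n → MvPowerSeries (Fin n) ℂ, IsLocalTransformation ψ ∧
      NDCondition E 𝒯 fun I => coeff I (f.subst ψ) := by
  simp only [HasNDType, hD]

theorem HasNDType.smul
    (hD : ∀ h : MvPowerSeries (Fin n) ℂ, (newtonDiagram h = D ∧ IsNewtonNondegenerate h) ↔
      NDCondition E 𝒯 fun I => coeff I h) {f : MvPowerSeries (Fin n) ℂ} (hf : HasNDType D f)
    {c : ℂ} (hc : c ≠ 0) : HasNDType D (c • f) := by
  rw [hasNDType_iff_ndCondition hD] at hf ⊢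
  obtain ⟨ψ, hψ, h⟩ := hf
  refine ⟨ψ, hψ, ?_⟩
  rw [subst_smul (hasSubst_of_constantCoeff_zero hψ.2.1)]
  simpa using h.smul hc

/-- The coordinate change that works for `f` also works for `g`, since the `R`-jets of the two
composites agree. -/
theorem isDetermined_of_ndCondition
    (hE : ∀ I, R ≤ Finsupp.degree I → I ∈ E) (h𝒯 : ∀ T ∈ 𝒯, ∀ I ∈ T, Finsupp.degree I ≤ R)
    (hD : ∀ h : MvPowerSeries (Fin n) ℂ, (newtonDiagram h = D ∧ IsNewtonNondegenerate h) ↔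
      NDCondition E 𝒯 fun I => coeff I h) : IsDetermined D R := by
  intro f g _ _ hf hfg
  rw [hasNDType_iff_ndCondition hD] at hf ⊢
  obtain ⟨ψ, hψ, h⟩ := hf
  exact ⟨ψ, hψ, h.of_jetEq hE h𝒯 (JetEq.subst hψ.2.1 hψ.2.1 (fun i => JetEq.refl _) hfg)⟩

/-- A germ is of type `D` if and only if its jet is the composition of a polynomial that satisfies
the non-degeneracy condition and a polynomial change of coordinates. -/
theorem hasNDType_iff_jet
    (hE : ∀ I, R ≤ Finsupp.degree I → I ∈ E) (h𝒯 : ∀ T ∈ 𝒯, ∀ I ∈ T, Finsupp.degree I ≤ R)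
    (hD : ∀ h : MvPowerSeries (Fin n) ℂ, (newtonDiagram h = D ∧ IsNewtonNondegenerate h) ↔
      NDCondition E 𝒯 fun I => coeff I h) {N : ℕ} (hN : 1 ≤ N) (hRN : R ≤ N)
    (f : MvPowerSeries (Fin n) ℂ) :
    HasNDType D f ↔ ∃ (φ : Fin n → MvPolynomial (Fin n) ℂ) (g : MvPolynomial (Fin n) ℂ),
      (∀ i, MvPolynomial.constantCoeff (φ i) = 0) ∧
      (∀ i I, N < Finsupp.degree I → MvPolynomial.coeff I (φ i) = 0) ∧
      (jacobian fun i => (φ i : MvPowerSeries (Fin n) ℂ)).det ≠ 0 ∧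
      (∀ I, N < Finsupp.degree I → MvPolynomial.coeff I g = 0) ∧
      (NDCondition E 𝒯 fun I => MvPolynomial.coeff I g) ∧
      JetEq N f ((g : MvPowerSeries (Fin n) ℂ).subst fun j => (φ j : MvPowerSeries (Fin n) ℂ)) := by
  rw [hasNDType_iff_ndCondition hD]
  constructor
  · rintro ⟨ψ, hψ, h⟩
    -- With `φ` inverse to `ψ` up to order `N` and `g` the jet of `f ∘ ψ`, one has `g ∘ φ ≡ f ∘ ψ ∘
    -- φ ≡ f`.
    obtain ⟨φ, h1, h2, h3, h4⟩ := exists_right_inverse hψ.2.1 hψ.2.2 hN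
    have h1' : ∀ i, constantCoeff (φ i : MvPowerSeries (Fin n) ℂ) = 0 := fun i => by
      rw [← coeff_zero_eq_constantCoeff_apply, MvPolynomial.coeff_coe,
        ← MvPolynomial.constantCoeff_eq, h1]
    refine ⟨φ, truncTotal (N + 1) (f.subst ψ), h1, h2, h3.ne_zero,
      fun I hI => coeff_truncTotal_eq_zero _ hI, ?_, ?_⟩
    · have := h.of_jetEq hE h𝒯 ((JetEq.truncTotal (N := N) (f.subst ψ)).symm.mono hRN)
      simpa only [MvPolynomial.coeff_coe] using this
    · refine JetEq.symm ((JetEq.subst h1' h1' (fun i => JetEq.refl _)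
        (JetEq.truncTotal (N := N) (f.subst ψ))).trans ?_)
      rw [subst_comp_subst_apply (hasSubst_of_constantCoeff_zero hψ.2.1)
        (hasSubst_of_constantCoeff_zero h1')]
      have h5 : JetEq N (f.subst fun i => (ψ i).subst fun j => (φ j : MvPowerSeries (Fin n) ℂ))
          (f.subst (X : Fin n → MvPowerSeries (Fin n) ℂ)) :=
        JetEq.subst (fun i => constantCoeff_subst_eq_zero (hasSubst_of_constantCoeff_zero h1') h1'
          (hψ.2.1 i)) (by simp) h4 (JetEq.refl _)
      rw [subst_self] at h5
      exact h5
  · rintro ⟨φ, g, h1, h2, h3, h4, h5, h6⟩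
    have h1' : ∀ i, constantCoeff (φ i : MvPowerSeries (Fin n) ℂ) = 0 := fun i => by
      rw [← coeff_zero_eq_constantCoeff_apply, MvPolynomial.coeff_coe,
        ← MvPolynomial.constantCoeff_eq, h1]
    obtain ⟨ψ, k1, k2, k3, k4⟩ := exists_right_inverse h1' h3.isUnit hN
    have k1' : ∀ i, constantCoeff (ψ i : MvPowerSeries (Fin n) ℂ) = 0 := fun i => by
      rw [← coeff_zero_eq_constantCoeff_apply, MvPolynomial.coeff_coe,
        ← MvPolynomial.constantCoeff_eq, k1]
    refine ⟨fun i => ψ i, ⟨fun i => isConvergent_coe _, k1', k3⟩, ?_⟩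
    refine NDCondition.of_jetEq hE h𝒯 (f := (g : MvPowerSeries (Fin n) ℂ)) (JetEq.mono hRN ?_)
      (by simpa only [MvPolynomial.coeff_coe] using h5)
    refine JetEq.symm ((JetEq.subst k1' k1' (fun i => JetEq.refl _) h6).trans ?_)
    rw [subst_comp_subst_apply (hasSubst_of_constantCoeff_zero h1')
        (hasSubst_of_constantCoeff_zero k1')]
    have h7 : JetEq N ((g : MvPowerSeries (Fin n) ℂ).subst fun i =>
        (φ i : MvPowerSeries (Fin n) ℂ).subst fun j => (ψ j : MvPowerSeries (Fin n) ℂ))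
        ((g : MvPowerSeries (Fin n) ℂ).subst (X : Fin n → MvPowerSeries (Fin n) ℂ)) :=
      JetEq.subst (fun i => constantCoeff_subst_eq_zero (hasSubst_of_constantCoeff_zero k1') k1'
        (h1' i)) (by simp) k4 (JetEq.refl _)
    rw [subst_self] at h7
    exact h7

end GermType

end NDStratum
end

noncomputable section
namespace NDStratum

/-! ### Sard's lemma and generic polynomials -/

open MeasureTheory Topology

/-- A form of Sard's lemma: a map whose fibres contain germs of lines has a null image. -/
theorem volume_image_eq_zero_of_constant {P : Type*} [Fintype P] {F : (P → ℂ) → P → ℂ}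
    {s : Set (P → ℂ)} (hF : ∀ y ∈ s, DifferentiableAt ℂ F y)
    (hv : ∀ y ∈ s, ∃ v : P → ℂ, v ≠ 0 ∧ ∀ᶠ t in 𝓝 (0 : ℂ), F (y + t • v) = F y) :
    volume (F '' s) = 0 := by
  refine addHaar_image_eq_zero_of_det_fderivWithin_eq_zero volume
    (f' := fun y => (fderiv ℂ F y).restrictScalars ℝ)
    (fun y hy => ((hF y hy).hasFDerivAt.restrictScalars ℝ).hasFDerivWithinAt) fun y hy => ?_
  obtain ⟨v, hv0, hv⟩ := hv y hy
  have h1 : HasDerivAt (fun t : ℂ => F (y + t • v)) (fderiv ℂ F y v) 0 :=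
    (hF y hy).hasFDerivAt.hasLineDerivAt v
  -- `F` is constant along `v`, so the differential has a kernel and its real determinant is zero.
  have h2 : fderiv ℂ F y v = 0 :=
    h1.unique ((hasDerivAt_const (0 : ℂ) (F y)).congr_of_eventuallyEq hv)
  have h3 : LinearMap.det ((fderiv ℂ F y).restrictScalars ℝ : (P → ℂ) →ₗ[ℝ] P → ℂ) = 0 := by
    rw [LinearMap.det_eq_zero_iff_ker_ne_bot, Submodule.ne_bot_iff]
    exact ⟨v, by simpa using h2, hv0⟩
  exact h3

theorem differentiableAt_eval {P : Type*} [Fintype P] (p : MvPolynomial P ℂ) (x : P → ℂ) :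
    DifferentiableAt ℂ (fun x => MvPolynomial.eval x p) x :=
  (AnalyticOnNhd.eval_mvPolynomial (𝕜 := ℂ) p x (Set.mem_univ x)).differentiableAt

/-- By Fubini it suffices that `p` has finitely many zeros on each line of direction `v`, where `v`
is chosen so that the leading form of `p` does not vanish at it. -/
theorem ae_eval_ne_zero {P : Type} [Fintype P] {p : MvPolynomial P ℂ} (hp : p ≠ 0) :
    ∀ᵐ x : P → ℂ, MvPolynomial.eval x p ≠ 0 := by
  set d := p.totalDegree with hd
  have htop : MvPolynomial.homogeneousComponent d p ≠ 0 := by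
    obtain ⟨m, hm, hmd⟩ := Finset.exists_mem_eq_sup p.support
      (MvPolynomial.support_nonempty.2 hp) fun s => s.sum fun _ e => e
    intro h
    have h1 := congrArg (MvPolynomial.coeff m) h
    rw [MvPolynomial.coeff_homogeneousComponent, if_pos] at h1
    · exact MvPolynomial.mem_support_iff.1 hm h1
    · exact hmd.symm
  obtain ⟨v, hv⟩ : ∃ v, MvPolynomial.eval v (MvPolynomial.homogeneousComponent d p) ≠ 0 := by
    by_contra! h
    exact htop (MvPolynomial.funext fun x => by simpa using h x)
  refine ae_mem_of_ae_add_linearMap_mem (LinearMap.toSpanSingleton ℂ (P → ℂ) v) volume volume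
    (s := {x | MvPolynomial.eval x p ≠ 0}) ?_ fun y => ?_
  · exact (isOpen_ne_fun (MvPolynomial.continuous_eval p) continuous_const).measurableSet
  -- For `t ≠ 0` this is `t ^ d * p (y + t⁻¹ v)`, and its value at `0` is the leading form at `v`.
  let q : Polynomial ℂ := ∑ k ∈ Finset.range (d + 1), Polynomial.X ^ (d - k) *
    MvPolynomial.aeval (fun i => Polynomial.C (v i) + Polynomial.X * Polynomial.C (y i))
      (MvPolynomial.homogeneousComponent k p)
  have hq : ∀ t, q.eval t = ∑ k ∈ Finset.range (d + 1), t ^ (d - k) *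
      MvPolynomial.eval (v + t • y) (MvPolynomial.homogeneousComponent k p) := by
    intro t
    rw [Polynomial.eval_finsetSum]
    refine Finset.sum_congr rfl fun k _ => ?_
    rw [Polynomial.eval_mul, Polynomial.eval_pow, Polynomial.eval_X, ← Polynomial.coe_evalRingHom,
      MvPolynomial.aeval_def, MvPolynomial.hom_eval₂, MvPolynomial.eval, MvPolynomial.coe_eval₂Hom]
    congr 2
    · ext; simp
    · ext i
      simp only [Polynomial.coe_evalRingHom, Polynomial.eval_add,
        Polynomial.eval_mul, Polynomial.eval_C, Polynomial.eval_X, Pi.add_apply, Pi.smul_apply,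
        smul_eq_mul]
  have hq0 : q ≠ 0 := by
    intro h
    have h1 := hq 0
    rw [h, Polynomial.eval_zero, Finset.sum_range_succ, Finset.sum_eq_zero] at h1
    · simp at h1
      exact hv h1.symm
    · intro k hk
      rw [Finset.mem_range] at hk
      rw [zero_pow (by omega), zero_mul]
  have hfin : {s : ℂ | s ≠ 0 ∧ MvPolynomial.eval (y + s • v) p = 0}.Finite := by
    refine Set.Finite.of_finite_image (f := fun s : ℂ => s⁻¹) ?_ inv_injective.injOn
    refine (Polynomial.finite_setOfPred_isRoot hq0).subset ?_
    rintro _ ⟨s, ⟨hs, h0⟩, rfl⟩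
    change q.eval s⁻¹ = 0
    have h2 : ∀ k ∈ Finset.range (d + 1), s⁻¹ ^ (d - k) *
        MvPolynomial.eval (v + s⁻¹ • y) (MvPolynomial.homogeneousComponent k p) =
        s⁻¹ ^ d * MvPolynomial.eval (y + s • v) (MvPolynomial.homogeneousComponent k p) := by
      intro k hk
      rw [Finset.mem_range] at hk
      have : v + s⁻¹ • y = s⁻¹ • (y + s • v) := by
        rw [smul_add, smul_smul, inv_mul_cancel₀ hs, one_smul, add_comm]
      rw [this, eval_smul_of_isHomogeneous (MvPolynomial.homogeneousComponent_isHomogeneous k p),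
        ← mul_assoc, ← pow_add, Nat.sub_add_cancel (by omega)]
    rw [hq, Finset.sum_congr rfl h2, ← Finset.mul_sum, ← map_sum,
      MvPolynomial.sum_homogeneousComponent, h0, mul_zero]
  refine ((hfin.union (Set.finite_singleton 0)).countable.ae_notMem volume).mono fun s hs => ?_
  by_contra h
  refine hs ?_
  by_cases h0 : s = 0
  · exact Or.inr h0
  · exact Or.inl ⟨h0, by simpa using h⟩

/-- The restriction of a generic polynomial to a face is smooth in the torus. -/
theorem ae_not_singular {n : ℕ} {P : Type*} [Fintype P] (κ : P → Fin n →₀ ℕ) {T : Finset P}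
    (hT : T.Nonempty) {w : Fin n → ℝ} {c : ℝ} (hc : c ≠ 0) (hw : ∀ p ∈ T, weight w (κ p) = c) :
    ∀ᵐ x : P → ℂ, ∀ z : Fin n → ℂ, (∀ i, z i ≠ 0) →
      ¬ ∀ i, ∑ p ∈ T, x p * (∏ j, z j ^ κ p j) * κ p i = 0 := by
  classical
  let v : P → Fin n → ℂ := fun p i => κ p i
  -- `B` indexes a basis of the span of the exponents in `T`.
  obtain ⟨B, hBT, -, hspan, hli⟩ := exists_linearIndepOn_extension (K := ℂ) (v := v)
    (s := ∅) (t := (T : Set P)) (by simp) (Set.empty_subset _)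
  lift B to Finset P using T.finite_toSet.subset hBT
  have hBT' : B ⊆ T := by exact_mod_cast hBT
  have hl : ∀ p, ∃ l : P → ℂ, p ∈ T → ∑ e ∈ B, l e • v e = v p := by
    intro p
    by_cases hp : p ∈ T
    · obtain ⟨l, hl⟩ := (Submodule.mem_span_image_finset_iff_exists_fun (R := ℂ)).1
        (hspan ⟨p, hp, rfl⟩)
      refine ⟨fun e => if he : e ∈ B then l ⟨e, he⟩ else 0, fun _ => ?_⟩
      rw [← hl, ← Finset.sum_coe_sort B]
      exact Finset.sum_congr rfl fun e _ => by simp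
    · exact ⟨0, fun h => absurd h hp⟩
  choose l hl using hl
  have hwc : ∀ p ∈ T, ∑ i, (w i : ℂ) * v p i = c := fun p hp => by
    rw [← hw p hp, weight]
    push_cast
    rfl
  -- All exponents of `T` lie on the hyperplane `w = c` with `c ≠ 0`.
  have hl1 : ∀ p ∈ T, ∑ e ∈ B, l p e = 1 := by
    intro p hp
    have h1 := hwc p hp
    rw [← hl p hp] at h1
    simp only [Finset.sum_apply, Pi.smul_apply, smul_eq_mul, Finset.mul_sum] at h1
    rw [Finset.sum_comm] at h1
    have h2 : ∀ e ∈ B, ∑ i, (w i : ℂ) * (l p e * v e i) = l p e * c := fun e he => by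
      rw [← hwc e (hBT' he), Finset.mul_sum]
      exact Finset.sum_congr rfl fun i _ => by ring
    rw [Finset.sum_congr rfl h2, ← Finset.sum_mul] at h1
    exact mul_right_cancel₀ (Complex.ofReal_ne_zero.2 hc) (h1.trans (one_mul _).symm)
  have hB : B.Nonempty := by
    obtain ⟨p, hp⟩ := hT
    by_contra h
    rw [Finset.not_nonempty_iff_eq_empty] at h
    have := hl1 p hp
    simp [h] at this
  -- If `x` is singular at `z`, independence of `B` solves the equations for `x q`, `q ∈ B`, in
  -- terms of the other coefficients and the logarithms of the monomials in `B`. The `B`-slots of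
  -- `y` hold those logarithms. Adding a common constant to them does not change `F`, by `hl1`, so
  -- Sard's lemma applies.
  let F : (P → ℂ) → P → ℂ := fun y q => if q ∈ B then
    - ∑ p ∈ T \ B, l p q * y p * Complex.exp (∑ e ∈ B, l p e * y e - y q) else y q
  have hF : volume (F '' Set.univ) = 0 := by
    refine volume_image_eq_zero_of_constant (fun y _ => ?_) fun y _ =>
      ⟨fun q => if q ∈ B then 1 else 0, fun h => ?_, Filter.Eventually.of_forall fun t => ?_⟩
    · refine differentiableAt_pi.2 fun q => ?_
      by_cases hq : q ∈ B
      · simp only [F, if_pos hq]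
        fun_prop
      · simp only [F, if_neg hq]
        fun_prop
    · obtain ⟨e, he⟩ := hB
      simpa [he] using congrFun h e
    · ext q
      by_cases hq : q ∈ B
      · simp only [F, if_pos hq]
        congr 1
        refine Finset.sum_congr rfl fun p hp => ?_
        rw [Finset.mem_sdiff] at hp
        have h1 : ∑ e ∈ B, l p e * (y + t • fun q => if q ∈ B then (1 : ℂ) else 0) e =
            ∑ e ∈ B, l p e * y e + t := by
          have h2 : t = ∑ e ∈ B, l p e * t := by rw [← Finset.sum_mul, hl1 p hp.1, one_mul]
          conv_rhs => rw [h2, ← Finset.sum_add_distrib]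
          refine Finset.sum_congr rfl fun e he => ?_
          simp [he]
          ring
        rw [h1]
        simp [hq, hp.2]
      · simp [F, hq]
  refine measure_mono_null (fun x hx => ?_) hF
  simp only [Set.mem_compl_iff] at hx
  have hx' : ∃ z : Fin n → ℂ, (∀ i, z i ≠ 0) ∧
      ∀ i, ∑ p ∈ T, x p * (∏ j, z j ^ κ p j) * κ p i = 0 := by
    by_contra! h
    refine hx fun z hz h0 => ?_
    obtain ⟨i, hi⟩ := h z hz
    exact hi (h0 i)
  obtain ⟨z, hz, h0⟩ := hx'
  let ℓ : P → ℂ := fun p => ∑ j, Complex.log (z j) * κ p j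
  have hℓ : ∀ p, ∏ j, z j ^ κ p j = Complex.exp (ℓ p) := fun p => by
    rw [Complex.exp_sum]
    refine Finset.prod_congr rfl fun j _ => ?_
    rw [mul_comm, Complex.exp_nat_mul, Complex.exp_log (hz j)]
  have hℓl : ∀ p ∈ T, ℓ p = ∑ e ∈ B, l p e * ℓ e := by
    intro p hp
    simp only [ℓ, Finset.mul_sum]
    rw [Finset.sum_comm]
    refine Finset.sum_congr rfl fun j _ => ?_
    have := congrFun (hl p hp) j
    simp only [Finset.sum_apply, Pi.smul_apply, smul_eq_mul, v] at this
    rw [← this, Finset.mul_sum]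
    exact Finset.sum_congr rfl fun e _ => by ring
  let u : P → ℂ := fun p => x p * Complex.exp (ℓ p)
  have hu : ∑ p ∈ T, u p • v p = 0 := by
    ext i
    have := h0 i
    simp only [hℓ] at this
    simpa [u, v] using this
  have hu' : ∑ e ∈ B, (u e + ∑ p ∈ T \ B, u p * l p e) • v e = 0 := by
    rw [← hu, ← Finset.sum_sdiff hBT', add_comm (∑ p ∈ T \ B, u p • v p)]
    simp only [add_smul, Finset.sum_add_distrib, Finset.sum_smul]
    congr 1
    rw [Finset.sum_comm]
    refine Finset.sum_congr rfl fun p hp => ?_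
    rw [← hl p (Finset.mem_sdiff.1 hp).1, Finset.smul_sum]
    exact Finset.sum_congr rfl fun e _ => by rw [smul_smul]
  have hu0 := (linearIndepOn_finset_iff.1 hli) _ hu'
  refine ⟨fun q => if q ∈ B then ℓ q else x q, Set.mem_univ _, ?_⟩
  ext q
  by_cases hq : q ∈ B
  · simp only [F, if_pos hq]
    have h1 := hu0 q hq
    have h2 : x q = u q * Complex.exp (-ℓ q) := by
      rw [mul_assoc, ← Complex.exp_add, add_neg_cancel, Complex.exp_zero, mul_one]
    rw [h2, eq_neg_of_add_eq_zero_left h1, neg_mul, Finset.sum_mul]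
    congr 1
    refine Finset.sum_congr rfl fun p hp => ?_
    rw [Finset.mem_sdiff] at hp
    have h3 : ∑ e ∈ B, l p e * (if e ∈ B then ℓ e else x e) = ℓ p := by
      rw [hℓl p hp.1]
      exact Finset.sum_congr rfl fun e he => by rw [if_pos he]
    rw [h3, if_neg hp.2, sub_eq_add_neg, Complex.exp_add]
    simp only [u]
    ring
  · simp [F, hq]

end NDStratum
end

noncomputable section
namespace NDStratum

/-! ### A theorem of Bertini type -/

open MeasureTheory Topology

theorem hasDerivAt_eval {P : Type*} [Fintype P] (p : MvPolynomial P ℂ) {γ : ℂ → P → ℂ} {v : P → ℂ}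
    {t : ℂ} (hγ : ∀ i, HasDerivAt (fun s => γ s i) (v i) t) :
    HasDerivAt (fun s => MvPolynomial.eval (γ s) p)
      (∑ i, v i * MvPolynomial.eval (γ t) (MvPolynomial.pderiv i p)) t := by
  classical
  induction p using MvPolynomial.induction_on with
  | C a => simpa using hasDerivAt_const t a
  | add p q hp hq =>
    simp only [map_add, mul_add, Finset.sum_add_distrib]
    exact hp.add hq
  | mul_X p j hp =>
    simp only [map_mul, MvPolynomial.eval_X]
    refine (hp.mul (hγ j)).congr_deriv ?_
    simp only [Derivation.leibniz, MvPolynomial.pderiv_X, smul_eq_mul, map_add, map_mul,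
      MvPolynomial.eval_X, mul_add, Finset.sum_add_distrib]
    rw [add_comm, Finset.sum_mul]
    congr 1
    · rw [Finset.sum_eq_single j]
      · simp [mul_comm]
      · intro i _ hij
        simp [hij.symm]
      · simp
    · exact Finset.sum_congr rfl fun i _ => by ring

variable {n : ℕ}

/-- The point whose first coordinate is `t`, whose other coordinates are those of `y` on `S` and
`0` outside `S`. -/
def supportPoint (S : Finset (Fin n)) (t : ℂ) (y : Fin n → ℂ) : Fin (n + 1) → ℂ :=
  Fin.cons t fun j => if j ∈ S then y j else 0

theorem smul_supportPoint (S : Finset (Fin n)) (c t : ℂ) (y : Fin n → ℂ) :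
    c • supportPoint S t y = supportPoint S (c * t) (c • y) := by
  ext i
  refine Fin.cases ?_ (fun j => ?_) i
  · simp [supportPoint]
  · simp [supportPoint]

theorem exists_eval_supportPoint (S : Finset (Fin n)) (t : ℂ) (p : MvPolynomial (Fin (n + 1)) ℂ) :
    ∃ q : MvPolynomial (Fin n) ℂ, ∀ y,
      MvPolynomial.eval (supportPoint S t y) p = MvPolynomial.eval y q := by
  refine ⟨MvPolynomial.aeval (Fin.cons (MvPolynomial.C t)
    fun j => if j ∈ S then MvPolynomial.X j else 0) p, fun y => ?_⟩
  rw [MvPolynomial.aeval_def, MvPolynomial.hom_eval₂, MvPolynomial.eval, MvPolynomial.coe_eval₂Hom]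
  congr 1
  · ext; simp
  · ext i
    refine Fin.cases ?_ (fun j => ?_) i
    · simp [supportPoint]
    · by_cases hj : j ∈ S <;> simp [supportPoint, hj]

theorem differentiable_eval_supportPoint (S : Finset (Fin n)) (t : ℂ)
    (p : MvPolynomial (Fin (n + 1)) ℂ) :
    Differentiable ℂ fun y => MvPolynomial.eval (supportPoint S t y) p := by
  obtain ⟨q, hq⟩ := exists_eval_supportPoint S t p
  simp only [hq]
  exact fun y => differentiableAt_eval q y

/-- If the first partial derivative of a form vanishes on a coordinate subspace, then its partial
derivatives along the subspace do not depend on the first coordinate. -/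
theorem eval_pderiv_supportPoint_eq {d : ℕ} {G : MvPolynomial (Fin (n + 1)) ℂ}
    (hG : G.IsHomogeneous d) {S : Finset (Fin n)}
    (h : ∀ y, MvPolynomial.eval (supportPoint S 1 y) (MvPolynomial.pderiv 0 G) = 0)
    {i : Fin n} (hi : i ∈ S) (y : Fin n → ℂ) :
    MvPolynomial.eval (supportPoint S 1 y) (MvPolynomial.pderiv i.succ G) =
      MvPolynomial.eval (supportPoint S 0 y) (MvPolynomial.pderiv i.succ G) := by
  have h1 : ∀ (t : ℂ) (y : Fin n → ℂ), t ≠ 0 →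
      MvPolynomial.eval (supportPoint S t y) (MvPolynomial.pderiv 0 G) = 0 := by
    intro t y ht
    have : supportPoint S t y = t • supportPoint S 1 (t⁻¹ • y) := by
      rw [smul_supportPoint, smul_smul, mul_inv_cancel₀ ht, one_smul, mul_one]
    rw [this, eval_smul_of_isHomogeneous hG.pderiv, h, mul_zero]
  have hline : ∀ (y : Fin n → ℂ) (t : ℂ), HasDerivAt (fun s => supportPoint S s y)
      (supportPoint S 1 0) t := by
    intro y t
    refine hasDerivAt_pi.2 fun i => ?_
    refine Fin.cases ?_ (fun j => ?_) i
    · simpa [supportPoint] using hasDerivAt_id' t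
    · simpa [supportPoint] using hasDerivAt_const t _
  have h2 : ∀ (y : Fin n → ℂ) (t : ℂ),
      MvPolynomial.eval (supportPoint S t y) (MvPolynomial.pderiv 0 G) = 0 := by
    intro y t
    have hc : Continuous fun s => MvPolynomial.eval (supportPoint S s y) (MvPolynomial.pderiv 0 G) :=
      (MvPolynomial.continuous_eval _).comp
        (continuous_iff_continuousAt.2 fun t => (hline y t).continuousAt)
    have := hc.ext_on (dense_compl_singleton (0 : ℂ)) continuous_const
      (g := fun _ => (0 : ℂ)) fun s hs => h1 s y hs
    exact congrFun this t
  -- On the subspace `G` does not depend on the first coordinate; differentiating this identity in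
  -- direction `i` gives the claim.
  have h3 : ∀ y, MvPolynomial.eval (supportPoint S 1 y) G =
      MvPolynomial.eval (supportPoint S 0 y) G := by
    intro y
    have hd : ∀ t, HasDerivAt (fun s => MvPolynomial.eval (supportPoint S s y) G) 0 t := by
      intro t
      refine (hasDerivAt_eval G (hasDerivAt_pi.1 (hline y t))).congr_deriv ?_
      rw [Fin.sum_univ_succ, h2]
      simp [supportPoint]
    exact is_const_of_deriv_eq_zero (fun t => (hd t).differentiableAt) (fun t => (hd t).deriv) 1 0
  have h4 : ∀ t : ℂ, HasDerivAt (fun s : ℂ => MvPolynomial.eval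
      (supportPoint S t (y + s • Pi.single i 1)) G)
      (MvPolynomial.eval (supportPoint S t y) (MvPolynomial.pderiv i.succ G)) 0 := by
    intro t
    have := hasDerivAt_eval G (γ := fun s => supportPoint S t (y + s • Pi.single i 1))
      (v := Pi.single i.succ 1) (t := 0) ?_
    · refine this.congr_deriv ?_
      rw [Finset.sum_eq_single i.succ]
      · simp
      · intro j _ hj
        simp [hj]
      · simp
    · intro j
      refine Fin.cases ?_ (fun j => ?_) j
      · simpa [supportPoint] using hasDerivAt_const (0 : ℂ) t
      · by_cases hj : j = i
        · subst hj
          simpa [supportPoint, hi] using (hasDerivAt_id (0 : ℂ)).const_add (y j)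
        · simpa [supportPoint, hj, Pi.single_apply] using hasDerivAt_const (0 : ℂ) _
  have h5 := h4 1
  simp only [h3] at h5
  exact h5.unique (h4 0)

/-- The coefficients on `S` for which the point with the coordinates `y` is singular. -/
def singularCoeff (G : MvPolynomial (Fin (n + 1)) ℂ) (d : ℕ) (S : Finset (Fin n)) (t : ℂ)
    (y : Fin n → ℂ) (i : Fin n) : ℂ :=
  if i ∈ S then - MvPolynomial.eval (supportPoint S t y) (MvPolynomial.pderiv i.succ G) /
    (d * y i ^ (d - 1)) else y i

theorem differentiableAt_singularCoeff (G : MvPolynomial (Fin (n + 1)) ℂ) {d : ℕ} (hd : d ≠ 0)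
    (S : Finset (Fin n)) (t : ℂ) {y : Fin n → ℂ} (hy : ∀ i ∈ S, y i ≠ 0) :
    DifferentiableAt ℂ (singularCoeff G d S t) y := by
  refine differentiableAt_pi.2 fun i => ?_
  by_cases hi : i ∈ S
  · simp only [singularCoeff, if_pos hi]
    have h1 : DifferentiableAt ℂ (fun y : Fin n → ℂ => (d : ℂ) * y i ^ (d - 1)) y := by fun_prop
    have h2 : (d : ℂ) * y i ^ (d - 1) ≠ 0 :=
      mul_ne_zero (Nat.cast_ne_zero.2 hd) (pow_ne_zero _ (hy i hi))
    simp only [div_eq_mul_inv]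
    exact (differentiable_eval_supportPoint S t _ y).fun_neg.fun_mul (h1.fun_inv h2)
  · simp only [singularCoeff, if_neg hi]
    fun_prop

/-- On `S` the map is a quotient of expressions of degree `d - 1` in the coordinates in `S`, hence
constant under scaling them, and Sard's lemma applies. -/
theorem volume_image_singularCoeff_zero {G : MvPolynomial (Fin (n + 1)) ℂ} {d : ℕ} (hd : d ≠ 0)
    (hG : G.IsHomogeneous d) {S : Finset (Fin n)} (hS : S.Nonempty) :
    volume (singularCoeff G d S 0 '' {y | ∀ i ∈ S, y i ≠ 0}) = 0 := by
  refine volume_image_eq_zero_of_constant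
    (fun y hy => differentiableAt_singularCoeff G hd S 0 hy)
    fun y hy => ⟨fun i => if i ∈ S then y i else 0, fun h => ?_, ?_⟩
  · obtain ⟨i, hi⟩ := hS
    have := congrFun h i
    simp only [if_pos hi] at this
    exact hy i hi this
  · have : ∀ᶠ t in 𝓝 (0 : ℂ), 1 + t ≠ 0 :=
      (continuous_const.add continuous_id).continuousAt.eventually_ne (by simp)
    filter_upwards [this] with t ht
    ext i
    by_cases hi : i ∈ S
    · have h1 : supportPoint S 0 (y + t • fun i => if i ∈ S then y i else 0) =
          (1 + t) • supportPoint S 0 y := by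
        rw [smul_supportPoint]
        ext j
        refine Fin.cases ?_ (fun j => ?_) j
        · simp [supportPoint]
        · by_cases hj : j ∈ S <;> simp [supportPoint, hj]
          ring
      have h2 : (y + t • fun i => if i ∈ S then y i else 0) i = (1 + t) * y i := by
        simp [hi]
        ring
      have h3 := hy i hi
      simp only [singularCoeff, if_pos hi]
      rw [h1, h2, eval_smul_of_isHomogeneous hG.pderiv, mul_pow]
      have h4 := pow_ne_zero (d - 1) ht
      have h5 := pow_ne_zero (d - 1) h3
      have h6 : (d : ℂ) ≠ 0 := Nat.cast_ne_zero.2 hd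
      field_simp
    · simp [singularCoeff, hi]

/-- The equation `∂₀ G = 0` either cuts out a null set of `y`, whose differentiable image is null,
or holds on the whole subspace. In the latter case the first coordinate is irrelevant and the case
of first coordinate `0` applies. -/
theorem volume_image_singularCoeff_one {G : MvPolynomial (Fin (n + 1)) ℂ} {d : ℕ} (hd : d ≠ 0)
    (hG : G.IsHomogeneous d) {S : Finset (Fin n)} (hS : S.Nonempty) :
    volume (singularCoeff G d S 1 '' {y | (∀ i ∈ S, y i ≠ 0) ∧
      MvPolynomial.eval (supportPoint S 1 y) (MvPolynomial.pderiv 0 G) = 0}) = 0 := by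
  obtain ⟨q, hq⟩ := exists_eval_supportPoint S 1 (MvPolynomial.pderiv 0 G)
  by_cases hq0 : q = 0
  · have h : ∀ y, MvPolynomial.eval (supportPoint S 1 y) (MvPolynomial.pderiv 0 G) = 0 :=
      fun y => by rw [hq, hq0, map_zero]
    refine measure_mono_null ?_ (volume_image_singularCoeff_zero hd hG hS)
    rintro _ ⟨y, hy, rfl⟩
    refine ⟨y, hy.1, ?_⟩
    ext i
    by_cases hi : i ∈ S
    · simp only [singularCoeff, if_pos hi, eval_pderiv_supportPoint_eq hG h hi]
    · simp [singularCoeff, hi]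
  · refine addHaar_image_eq_zero_of_differentiableOn_of_addHaar_eq_zero volume
      (fun y hy => ((differentiableAt_singularCoeff G hd S 1 hy.1).restrictScalars
        ℝ).differentiableWithinAt) ?_
    refine measure_mono_null (fun y hy => ?_) (ae_eval_ne_zero hq0)
    simpa [← hq] using hy.2

theorem eval_pderiv_zero_add_sum (G : MvPolynomial (Fin (n + 1)) ℂ) (d : ℕ) (c : Fin n → ℂ)
    (x : Fin (n + 1) → ℂ) :
    MvPolynomial.eval x (MvPolynomial.pderiv 0
      (G + ∑ j : Fin n, MvPolynomial.C (c j) * MvPolynomial.X j.succ ^ d)) =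
    MvPolynomial.eval x (MvPolynomial.pderiv 0 G) := by
  simp only [map_add, map_sum, Derivation.leibniz, Derivation.leibniz_pow, MvPolynomial.pderiv_C,
    MvPolynomial.pderiv_X]
  simp

theorem eval_pderiv_succ_add_sum (G : MvPolynomial (Fin (n + 1)) ℂ) (d : ℕ) (c : Fin n → ℂ)
    (x : Fin (n + 1) → ℂ) (i : Fin n) :
    MvPolynomial.eval x (MvPolynomial.pderiv i.succ
      (G + ∑ j : Fin n, MvPolynomial.C (c j) * MvPolynomial.X j.succ ^ d)) =
    MvPolynomial.eval x (MvPolynomial.pderiv i.succ G) + c i * (d * x i.succ ^ (d - 1)) := by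
  simp only [map_add, map_sum, Derivation.leibniz, Derivation.leibniz_pow, MvPolynomial.pderiv_C,
    MvPolynomial.pderiv_X]
  congr 1
  rw [Finset.sum_eq_single i]
  · simp
  · intro j _ hj
    simp [hj]
  · simp

/-- The singular points of a generic member of the linear system spanned by a form and the powers
of all coordinates but the first one lie in the base locus. -/
theorem ae_singular_subset {d : ℕ} (hd : d ≠ 0) {G : MvPolynomial (Fin (n + 1)) ℂ}
    (hG : G.IsHomogeneous d) : ∀ᵐ c : Fin n → ℂ, ∀ x : Fin (n + 1) → ℂ,
      (∀ i, MvPolynomial.eval x (MvPolynomial.pderiv i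
        (G + ∑ j : Fin n, MvPolynomial.C (c j) * MvPolynomial.X j.succ ^ d)) = 0) →
      ∀ j : Fin n, x j.succ = 0 := by
  have h0 : ∀ S : Finset (Fin n), ∀ᵐ c : Fin n → ℂ, S.Nonempty →
      c ∉ singularCoeff G d S 0 '' {y | ∀ i ∈ S, y i ≠ 0} := by
    intro S
    by_cases hS : S.Nonempty
    · filter_upwards [measure_eq_zero_iff_ae_notMem.1 (volume_image_singularCoeff_zero hd hG hS)]
        with c hc _ using hc
    · exact Filter.Eventually.of_forall fun c h => absurd h hS
  have h1 : ∀ S : Finset (Fin n), ∀ᵐ c : Fin n → ℂ, S.Nonempty →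
      c ∉ singularCoeff G d S 1 '' {y | (∀ i ∈ S, y i ≠ 0) ∧
        MvPolynomial.eval (supportPoint S 1 y) (MvPolynomial.pderiv 0 G) = 0} := by
    intro S
    by_cases hS : S.Nonempty
    · filter_upwards [measure_eq_zero_iff_ae_notMem.1 (volume_image_singularCoeff_one hd hG hS)]
        with c hc _ using hc
    · exact Filter.Eventually.of_forall fun c h => absurd h hS
  filter_upwards [ae_all_iff.2 h0, ae_all_iff.2 h1] with c hc0 hc1 x hx
  by_contra! hne
  -- Stratify by the coordinates that do not vanish, where the derivative of `X j.succ ^ d` can be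
  -- divided by.
  let S : Finset (Fin n) := {j | x j.succ ≠ 0}
  have hmem : ∀ j, j ∈ S ↔ x j.succ ≠ 0 := fun j => by simp [S]
  have hS : S.Nonempty := by
    obtain ⟨j, hj⟩ := hne
    exact ⟨j, (hmem j).2 hj⟩
  -- The equations `∂ᵢ = 0`, `i ∈ S`, solve for `c i`. The entries off `S` carry `c` itself, so that
  -- the map goes from `ℂⁿ` to `ℂⁿ`; the factor `u` serves to normalize the first coordinate to `1`
  -- when it is nonzero.
  have key : ∀ (u : ℂ) (hu : u ≠ 0), singularCoeff G d S (u * x 0)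
      (fun j => if j ∈ S then u * x j.succ else c j) = c := by
    intro u hu
    ext i
    by_cases hi : i ∈ S
    · have h2 : supportPoint S (u * x 0) (fun j => if j ∈ S then u * x j.succ else c j) = u • x := by
        ext j
        refine Fin.cases ?_ (fun j => ?_) j
        · simp [supportPoint]
        · by_cases hj : j ∈ S
          · simp [supportPoint, hj]
          · have : x j.succ = 0 := by simpa [hmem] using hj
            simp [supportPoint, hj, this]
      have h3 := hx i.succ
      rw [eval_pderiv_succ_add_sum] at h3
      simp only [singularCoeff, if_pos hi]
      rw [h2, eval_smul_of_isHomogeneous hG.pderiv, eq_neg_of_add_eq_zero_left h3, mul_pow]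
      have h4 := pow_ne_zero (d - 1) hu
      have h5 := pow_ne_zero (d - 1) ((hmem i).1 hi)
      have h6 : (d : ℂ) ≠ 0 := Nat.cast_ne_zero.2 hd
      field_simp
    · simp [singularCoeff, hi]
  have hy : ∀ (u : ℂ) (hu : u ≠ 0), ∀ i ∈ S,
      (fun j => if j ∈ S then u * x j.succ else c j) i ≠ 0 := by
    intro u hu i hi
    simp only [if_pos hi]
    exact mul_ne_zero hu ((hmem i).1 hi)
  by_cases hx0 : x 0 = 0
  · refine hc0 S hS ⟨_, hy 1 one_ne_zero, ?_⟩
    have := key 1 one_ne_zero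
    rwa [hx0, mul_zero] at this
  · have hu : (x 0)⁻¹ ≠ 0 := inv_ne_zero hx0
    have h2 := key _ hu
    rw [inv_mul_cancel₀ hx0] at h2
    refine hc1 S hS ⟨_, ⟨hy _ hu, ?_⟩, h2⟩
    have h3 : supportPoint S 1 (fun j => if j ∈ S then (x 0)⁻¹ * x j.succ else c j) =
        (x 0)⁻¹ • x := by
      ext j
      refine Fin.cases ?_ (fun j => ?_) j
      · simp [supportPoint, hx0]
      · by_cases hj : j ∈ S
        · simp [supportPoint, hj]
        · have : x j.succ = 0 := by simpa [hmem] using hj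
          simp [supportPoint, hj, this]
    have h4 := hx 0
    rw [eval_pderiv_zero_add_sum] at h4
    rw [h3, eval_smul_of_isHomogeneous hG.pderiv, h4, mul_zero]

end NDStratum
end

noncomputable section
namespace NDStratum

/-! ### Linear changes of homogeneous coordinates -/

open MvPolynomial

variable {n d : ℕ}

theorem mem_exponents_iff (I : Fin (n + 1) →₀ ℕ) :
    I ∈ Finset.finsuppAntidiag (Finset.univ : Finset (Fin (n + 1))) d ↔ I.degree = d := by
  rw [Finset.mem_finsuppAntidiag, degree_eq_sum]
  simp

theorem form_isHomogeneous (a : Exponents n d → ℂ) : (form a).IsHomogeneous d :=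
  IsHomogeneous.sum _ _ _ fun I _ => isHomogeneous_monomial _ ((mem_exponents_iff I.1).1 I.2)

theorem coeff_form (a : Exponents n d → ℂ) (I : Exponents n d) : coeff I.1 (form a) = a I := by
  classical
  rw [form, coeff_sum, Finset.sum_eq_single I]
  · simp
  · intro J _ hJ
    rw [coeff_monomial, if_neg (fun h => hJ (Subtype.ext h))]
  · simp

theorem form_coeff {F : MvPolynomial (Fin (n + 1)) ℂ} (hF : F.IsHomogeneous d) :
    (form fun I : Exponents n d => coeff I.1 F) = F := by
  ext I
  by_cases hI : I.degree = d
  · exact coeff_form _ ⟨I, (mem_exponents_iff I).2 hI⟩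
  · rw [hF.coeff_eq_zero hI, (form_isHomogeneous _).coeff_eq_zero hI]

theorem form_smul (c : ℂ) (a : Exponents n d → ℂ) : form (c • a) = c • form a := by
  simp [form, Finset.smul_sum, smul_monomial]

/-- The composition of a polynomial and a linear map. -/
def linearSubst (A : Matrix (Fin (n + 1)) (Fin (n + 1)) ℂ) :
    MvPolynomial (Fin (n + 1)) ℂ →ₐ[ℂ] MvPolynomial (Fin (n + 1)) ℂ :=
  aeval fun i => ∑ j, C (A i j) * X j

theorem eval_linearSubst (A : Matrix (Fin (n + 1)) (Fin (n + 1)) ℂ) (x : Fin (n + 1) → ℂ)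
    (F : MvPolynomial (Fin (n + 1)) ℂ) : eval x (linearSubst A F) = eval (A.mulVec x) F := by
  rw [linearSubst, aeval_def, hom_eval₂, eval, coe_eval₂Hom]
  congr 1
  · ext; simp
  · ext i; simp [Matrix.mulVec, dotProduct]

theorem linearSubst_linearSubst (A B : Matrix (Fin (n + 1)) (Fin (n + 1)) ℂ)
    (F : MvPolynomial (Fin (n + 1)) ℂ) :
    linearSubst A (linearSubst B F) = linearSubst (B * A) F :=
  MvPolynomial.funext fun x => by simp only [eval_linearSubst, Matrix.mulVec_mulVec]

theorem linearSubst_one (F : MvPolynomial (Fin (n + 1)) ℂ) : linearSubst 1 F = F :=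
  MvPolynomial.funext fun x => by simp only [eval_linearSubst, Matrix.one_mulVec]

theorem linearSubst_isHomogeneous (A : Matrix (Fin (n + 1)) (Fin (n + 1)) ℂ)
    {F : MvPolynomial (Fin (n + 1)) ℂ} (hF : F.IsHomogeneous d) :
    (linearSubst A F).IsHomogeneous d := by
  rw [← one_mul d]
  refine hF.aeval _ fun i => IsHomogeneous.sum _ _ _ fun j _ => ?_
  simpa using (isHomogeneous_C _ (A i j)).mul (isHomogeneous_X ℂ j)

theorem eval_localEquation (F : MvPolynomial (Fin (n + 1)) ℂ)
    (A : Matrix (Fin (n + 1)) (Fin (n + 1)) ℂ) (z : Fin n → ℂ) :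
    eval z (localEquation F A) = eval (A.mulVec (Fin.cons 1 z)) F := by
  rw [localEquation, aeval_def, hom_eval₂, eval, coe_eval₂Hom]
  congr 1
  · ext; simp
  · ext i; simp [Matrix.mulVec, dotProduct, Fin.sum_univ_succ]

theorem localEquation_linearSubst (F : MvPolynomial (Fin (n + 1)) ℂ)
    (A : Matrix (Fin (n + 1)) (Fin (n + 1)) ℂ) :
    localEquation (linearSubst A F) 1 = localEquation F A :=
  MvPolynomial.funext fun x => by
    rw [eval_localEquation, eval_localEquation, eval_linearSubst, Matrix.one_mulVec]

theorem localEquation_smul_left (c : ℂ) (F : MvPolynomial (Fin (n + 1)) ℂ)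
    (A : Matrix (Fin (n + 1)) (Fin (n + 1)) ℂ) :
    localEquation (c • F) A = c • localEquation F A := by
  simp [localEquation]

theorem localEquation_smul_right (c : ℂ) {F : MvPolynomial (Fin (n + 1)) ℂ}
    (hF : F.IsHomogeneous d) (A : Matrix (Fin (n + 1)) (Fin (n + 1)) ℂ) :
    localEquation F (c • A) = c ^ d • localEquation F A :=
  MvPolynomial.funext fun x => by
    rw [eval_localEquation, smul_eval, eval_localEquation, Matrix.smul_mulVec,
      eval_smul_of_isHomogeneous hF]

theorem eval_pderiv_linearSubst (A : Matrix (Fin (n + 1)) (Fin (n + 1)) ℂ)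
    (F : MvPolynomial (Fin (n + 1)) ℂ) (y : Fin (n + 1) → ℂ) (j : Fin (n + 1)) :
    eval y (pderiv j (linearSubst A F)) =
      A.transpose.mulVec (fun i => eval (A.mulVec y) (pderiv i F)) j := by
  have h1 := hasDerivAt_eval (linearSubst A F) (γ := fun s => y + s • Pi.single j 1)
    (v := Pi.single j 1) (t := 0) fun i => by
      simpa using ((hasDerivAt_id' (0 : ℂ)).mul_const ((Pi.single j 1 : Fin (n + 1) → ℂ) i)).const_add
        (y i)
  have h2 := hasDerivAt_eval F (γ := fun s => A.mulVec y + s • A.col j) (v := A.col j) (t := 0)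
    fun i => by
      simpa using ((hasDerivAt_id' (0 : ℂ)).mul_const (A.col j i)).const_add (A.mulVec y i)
  simp only [eval_linearSubst, Matrix.mulVec_add, Matrix.mulVec_smul, Matrix.mulVec_single_one] at h1
  have h3 := h1.unique h2
  rw [Finset.sum_eq_single j (fun i _ hij => by simp [hij]) (by simp)] at h3
  simpa [Matrix.mulVec, dotProduct] using h3

theorem singular_linearSubst_iff {A : Matrix (Fin (n + 1)) (Fin (n + 1)) ℂ} (hA : IsUnit A.det)
    (F : MvPolynomial (Fin (n + 1)) ℂ) (y : Fin (n + 1) → ℂ) :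
    (∀ i, eval y (pderiv i (linearSubst A F)) = 0) ↔
      ∀ i, eval (A.mulVec y) (pderiv i F) = 0 := by
  simp only [eval_pderiv_linearSubst]
  constructor
  · intro h i
    have h1 : A.transpose.mulVec (fun i => eval (A.mulVec y) (pderiv i F)) = A.transpose.mulVec 0 := by
      rw [Matrix.mulVec_zero]
      exact _root_.funext h
    exact congrFun (Matrix.mulVec_injective_of_isUnit
      ((Matrix.isUnit_iff_isUnit_det _).2 (by rwa [Matrix.det_transpose])) h1) i
  · intro h i
    rw [show (fun i => eval (A.mulVec y) (pderiv i F)) = 0 from _root_.funext h, Matrix.mulVec_zero]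
    rfl

/-- By Euler's relation, with `d ≠ 0`, the vanishing of the form follows from that of its
derivatives. -/
theorem mk_mem_singularPoints_iff {F : MvPolynomial (Fin (n + 1)) ℂ} (hd : d ≠ 0)
    (hF : F.IsHomogeneous d) {w : Fin (n + 1) → ℂ} (hw : w ≠ 0) :
    Projectivization.mk ℂ w hw ∈ singularPoints F ↔ ∀ i, eval w (pderiv i F) = 0 := by
  have h1 : (∀ i, eval w (pderiv i F) = 0) → eval w F = 0 := by
    intro h
    have h2 := congrArg (eval w) hF.sum_X_mul_pderiv
    rw [map_sum, Finset.sum_eq_zero (fun i _ => by rw [map_mul, h, mul_zero]), nsmul_eq_mul,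
      map_mul, map_natCast] at h2
    exact (mul_eq_zero.1 h2.symm).resolve_left (Nat.cast_ne_zero.2 hd)
  change (eval (Projectivization.mk ℂ w hw).rep F = 0 ∧
    ∀ i, eval (Projectivization.mk ℂ w hw).rep (pderiv i F) = 0) ↔ _
  rw [eval_rep_eq_zero_iff hF hw]
  simp only [eval_rep_eq_zero_iff hF.pderiv hw]
  exact ⟨fun h => h.2, fun h => ⟨h1 h, h⟩⟩

theorem eq_smul_single_of_tail_eq_zero {y : Fin (n + 1) → ℂ} (hy : ∀ j : Fin n, y j.succ = 0) :
    y = y 0 • Pi.single 0 1 := by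
  ext i
  refine Fin.cases ?_ (fun j => ?_) i
  · simp
  · simp [hy]

/-- The points of the stratum in terms of coordinates centred at the singular point. -/
theorem mk_mem_stratum_iff {D : Set (Fin n → ℝ)} (hd : d ≠ 0)
    (hD : ∀ (f : MvPowerSeries (Fin n) ℂ) (c : ℂ), c ≠ 0 → HasNDType D f → HasNDType D (c • f))
    {v : Exponents n d → ℂ} (hv : v ≠ 0) :
    Projectivization.mk ℂ v hv ∈ stratum n d D ↔
      ∃ A : Matrix (Fin (n + 1)) (Fin (n + 1)) ℂ, IsUnit A.det ∧
        (∀ y, (∀ i, eval y (pderiv i (linearSubst A (form v))) = 0) ↔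
          ∀ j : Fin n, y j.succ = 0) ∧
        HasNDType D (localEquation (linearSubst A (form v)) 1 : MvPowerSeries (Fin n) ℂ) := by
  have hD' : ∀ (p : MvPolynomial (Fin n) ℂ) (c : ℂ), c ≠ 0 →
      HasNDType D (p : MvPowerSeries (Fin n) ℂ) →
      HasNDType D ((c • p : MvPolynomial (Fin n) ℂ) : MvPowerSeries (Fin n) ℂ) := by
    intro p c hc h
    have : ((c • p : MvPolynomial (Fin n) ℂ) : MvPowerSeries (Fin n) ℂ) =
      c • (p : MvPowerSeries (Fin n) ℂ) := by
      ext I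
      simp
    rw [this]
    exact hD _ c hc h
  obtain ⟨a, ha⟩ := Projectivization.exists_smul_eq_mk_rep ℂ v hv
  have ha0 : (a : ℂ) ≠ 0 := a.ne_zero
  have hform : form (Projectivization.mk ℂ v hv).rep = (a : ℂ) • form v := by
    rw [← ha, Units.smul_def, form_smul]
  have hF := form_isHomogeneous v
  have hsing : singularPoints ((a : ℂ) • form v) = singularPoints (form v) := by
    ext x
    simp [singularPoints, ha0]
  have hloc : ∀ A, HasNDType D (localEquation ((a : ℂ) • form v) A : MvPowerSeries (Fin n) ℂ) ↔
      HasNDType D (localEquation (form v) A : MvPowerSeries (Fin n) ℂ) := by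
    intro A
    rw [localEquation_smul_left]
    refine ⟨fun h => ?_, fun h => hD' _ _ ha0 h⟩
    have := hD' _ _ (inv_ne_zero ha0) h
    rwa [smul_smul, inv_mul_cancel₀ ha0, one_smul] at this
  change (∃ x, singularPoints (form (Projectivization.mk ℂ v hv).rep) = {x} ∧
    HasNDTypeAt D (form (Projectivization.mk ℂ v hv).rep) x) ↔ _
  simp only [hform, hsing, HasNDTypeAt, hloc, localEquation_linearSubst]
  constructor
  · rintro ⟨x, hx, A, hA, hA0, hAD⟩
    have hcol : A.mulVec (Pi.single 0 1) = x.rep := by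
      rw [Matrix.mulVec_single_one]
      exact _root_.funext hA0
    have hinj : Function.Injective A.mulVec :=
      Matrix.mulVec_injective_of_isUnit ((Matrix.isUnit_iff_isUnit_det _).2 hA)
    refine ⟨A, hA, fun y => ?_, hAD⟩
    rw [singular_linearSubst_iff hA]
    constructor
    · intro h
      have hy : ∃ t : ℂ, A.mulVec y = t • x.rep := by
        by_cases hy : A.mulVec y = 0
        · exact ⟨0, by rw [hy, zero_smul]⟩
        · have h1 := (mk_mem_singularPoints_iff hd hF hy).2 h
          rw [hx, Set.mem_singleton_iff, ← x.mk_rep, Projectivization.mk_eq_mk_iff'] at h1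
          obtain ⟨t, ht⟩ := h1
          exact ⟨t, ht.symm⟩
      obtain ⟨t, ht⟩ := hy
      rw [← hcol, ← Matrix.mulVec_smul] at ht
      rw [hinj ht]
      simp
    · intro h i
      have hxs : x ∈ singularPoints (form v) := by rw [hx]; rfl
      rw [eq_smul_single_of_tail_eq_zero h, Matrix.mulVec_smul, hcol,
        eval_smul_of_isHomogeneous hF.pderiv, hxs.2 i, mul_zero]
  · rintro ⟨A, hA, hAs, hAD⟩
    have hinj : Function.Injective A.mulVec :=
      Matrix.mulVec_injective_of_isUnit ((Matrix.isUnit_iff_isUnit_det _).2 hA)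
    have hw : A.mulVec (Pi.single 0 1) ≠ 0 := by
      intro h
      have := hinj (h.trans (Matrix.mulVec_zero A).symm)
      simpa using congrFun this 0
    obtain ⟨b, hb⟩ := Projectivization.exists_smul_eq_mk_rep ℂ _ hw
    have hb0 : (b : ℂ) ≠ 0 := b.ne_zero
    -- The first column must be the chosen representative of the point, hence the factor `b`; it
    -- multiplies the local equation by `b ^ d`.
    refine ⟨Projectivization.mk ℂ _ hw, ?_, (b : ℂ) • A, ?_, fun i => ?_, ?_⟩
    · ext p
      rw [Set.mem_singleton_iff]
      constructor
      · induction p using Projectivization.ind with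
        | h u hu =>
          rw [mk_mem_singularPoints_iff hd hF hu]
          intro h
          have hAu : A.mulVec (A⁻¹.mulVec u) = u := by
            rw [Matrix.mulVec_mulVec, Matrix.mul_nonsing_inv _ hA, Matrix.one_mulVec]
          have h1 := (singular_linearSubst_iff hA (form v) (A⁻¹.mulVec u)).2 (by rwa [hAu])
          have h2 := eq_smul_single_of_tail_eq_zero ((hAs _).1 h1)
          rw [Projectivization.mk_eq_mk_iff']
          refine ⟨A⁻¹.mulVec u 0, ?_⟩
          rw [← Matrix.mulVec_smul, ← h2, hAu]
      · rintro rfl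
        rw [mk_mem_singularPoints_iff hd hF hw, ← singular_linearSubst_iff hA, hAs]
        simp
    · rw [Matrix.det_smul]
      exact ((hb0.isUnit).pow _).mul hA
    · rw [← hb, Matrix.mulVec_single_one, Units.smul_def]
      rfl
    · rw [localEquation_smul_right _ hF]
      exact hD' _ _ (pow_ne_zero _ hb0) hAD

/-! ### The coefficients of the local equation -/

theorem localEquation_form (b : Exponents n d → ℂ) :
    localEquation (form b) 1 = ∑ I : Exponents n d, monomial I.1.tail (b I) :=
  MvPolynomial.funext fun z => by
    rw [eval_localEquation, Matrix.one_mulVec, form, map_sum, map_sum]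
    refine Finset.sum_congr rfl fun I _ => ?_
    rw [eval_monomial, eval_monomial, Finsupp.prod_fintype _ _ (by simp),
      Finsupp.prod_fintype _ _ (by simp), Fin.prod_univ_succ]
    simp [Finsupp.tail_apply]

theorem degree_tail (I : Fin (n + 1) →₀ ℕ) : I.degree = I 0 + I.tail.degree := by
  simp only [degree_eq_sum, Fin.sum_univ_succ, Finsupp.tail_apply]

/-- The exponent of the first coordinate is recovered from the total degree `d`, so no two monomials
merge. -/
theorem coeff_localEquation_form (b : Exponents n d → ℂ) (I : Exponents n d) :
    coeff I.1.tail (localEquation (form b) 1) = b I := by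
  classical
  rw [localEquation_form, coeff_sum, Finset.sum_eq_single I]
  · simp
  · intro J _ hJ
    rw [coeff_monomial, if_neg]
    intro h
    have h1 := (mem_exponents_iff I.1).1 I.2
    have h2 := (mem_exponents_iff J.1).1 J.2
    rw [degree_tail] at h1 h2
    refine hJ (Subtype.ext ?_)
    rw [← Finsupp.cons_tail J.1, ← Finsupp.cons_tail I.1, h, show J.1 0 = I.1 0 by rw [h] at h2; omega]
  · simp

/-- The exponent of degree `d` of the homogenization of a monomial. -/
def homogenizeExponent (J : Fin n →₀ ℕ) (hJ : J.degree ≤ d) : Exponents n d :=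
  ⟨Finsupp.cons (d - J.degree) J, by
    rw [mem_exponents_iff, degree_tail, Finsupp.tail_cons, Finsupp.cons_zero]
    omega⟩

end NDStratum
end

noncomputable section
namespace NDStratum

/-! ### Families of polynomials -/

open MvPolynomial MeasureTheory

/-- A family of polynomials whose coefficients are polynomials in the parameters. -/
def IsPolyFamily {P σ : Type*} (F : (P → ℂ) → MvPolynomial σ ℂ) : Prop :=
  ∃ Q : MvPolynomial σ (MvPolynomial P ℂ), ∀ x, F x = map (eval x) Q

namespace IsPolyFamily

variable {P σ τ : Type*} {F G : (P → ℂ) → MvPolynomial σ ℂ}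

theorem const (p : MvPolynomial σ ℂ) : IsPolyFamily fun _ : P → ℂ => p :=
  ⟨map C p, fun x => by
    rw [map_map, show (eval x).comp C = RingHom.id ℂ from RingHom.ext fun c => eval_C c, map_id]⟩

theorem monomial {f : (P → ℂ) → ℂ} (I : σ →₀ ℕ) (hf : IsPoly f) :
    IsPolyFamily fun x => MvPolynomial.monomial I (f x) := by
  obtain ⟨p, hp⟩ := hf
  exact ⟨MvPolynomial.monomial I p, fun x => by simp only [map_monomial, hp]⟩

theorem mul (hF : IsPolyFamily F) (hG : IsPolyFamily G) : IsPolyFamily fun x => F x * G x := by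
  obtain ⟨p, hp⟩ := hF
  obtain ⟨q, hq⟩ := hG
  exact ⟨p * q, fun x => by simp only [map_mul, hp, hq]⟩

theorem sum {α : Type*} (s : Finset α) {F : α → (P → ℂ) → MvPolynomial σ ℂ}
    (hF : ∀ a ∈ s, IsPolyFamily (F a)) : IsPolyFamily fun x => ∑ a ∈ s, F a x := by
  choose! p hp using hF
  exact ⟨∑ a ∈ s, p a, fun x => by
    rw [map_sum]
    exact Finset.sum_congr rfl fun a ha => hp a ha x⟩

theorem aeval (hF : IsPolyFamily F) {f : σ → (P → ℂ) → MvPolynomial τ ℂ}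
    (hf : ∀ i, IsPolyFamily (f i)) :
    IsPolyFamily fun x => MvPolynomial.aeval (fun i => f i x) (F x) := by
  obtain ⟨Q, hQ⟩ := hF
  choose q hq using hf
  exact ⟨bind₁ q Q, fun x => by
    simp only [hQ, hq]
    exact (map_bind₁ _ q Q).symm⟩

theorem pderiv (hF : IsPolyFamily F) (i : σ) : IsPolyFamily fun x => MvPolynomial.pderiv i (F x) := by
  obtain ⟨Q, hQ⟩ := hF
  exact ⟨MvPolynomial.pderiv i Q, fun x => by simp only [hQ, pderiv_map]⟩

theorem coeff (hF : IsPolyFamily F) (I : σ →₀ ℕ) : IsPoly fun x => MvPolynomial.coeff I (F x) := by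
  obtain ⟨Q, hQ⟩ := hF
  exact ⟨MvPolynomial.coeff I Q, fun x => by simp only [hQ, coeff_map]⟩

theorem eval (hF : IsPolyFamily F) {f : σ → (P → ℂ) → ℂ} (hf : ∀ i, IsPoly (f i)) :
    IsPoly fun x => MvPolynomial.eval (fun i => f i x) (F x) := by
  obtain ⟨Q, hQ⟩ := hF
  choose q hq using hf
  refine ⟨MvPolynomial.eval q Q, fun x => ?_⟩
  dsimp only
  rw [hQ, eval_map]
  refine Eq.trans ?_ (hom_eval₂ Q (RingHom.id _) (MvPolynomial.eval x) q).symm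
  rw [RingHom.comp_id]
  congr 1
  ext i
  exact hq i x

theorem comp {Q : Type*} (hF : IsPolyFamily F) {g : (Q → ℂ) → P → ℂ}
    (hg : ∀ j, IsPoly fun x => g x j) : IsPolyFamily fun x => F (g x) := by
  obtain ⟨q, hq⟩ := hF
  choose p hp using hg
  refine ⟨map (bind₁ p : MvPolynomial P ℂ →+* MvPolynomial Q ℂ) q, fun x => ?_⟩
  dsimp only
  have key : MvPolynomial.eval (g x) = (MvPolynomial.eval x).comp
      (bind₁ p : MvPolynomial P ℂ →+* MvPolynomial Q ℂ) :=
    MvPolynomial.ringHom_ext (fun c => by simp) fun j => by simpa using hp j x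
  rw [hq, map_map, key]

end IsPolyFamily

/-! ### The parametrization of the stratum -/

variable {n d N : ℕ}

/-- The exponents of degree at most `N`. -/
abbrev JetIndex (n N : ℕ) : Type := {J : Fin n →₀ ℕ // J.degree ≤ N}

instance : Fintype (JetIndex n N) :=
  @Fintype.ofFinite _ (Finsupp.finite_of_degree_le N).to_subtype

/-- The polynomial with the given coefficients. -/
def jetPoly (c : JetIndex n N → ℂ) : MvPolynomial (Fin n) ℂ := ∑ J, monomial J.1 (c J)

theorem coeff_jetPoly (c : JetIndex n N → ℂ) (J : JetIndex n N) : coeff J.1 (jetPoly c) = c J := by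
  classical
  rw [jetPoly, coeff_sum, Finset.sum_eq_single J]
  · simp
  · intro I _ hI
    rw [coeff_monomial, if_neg (fun h => hI (Subtype.ext h))]
  · simp

theorem coeff_jetPoly_of_lt (c : JetIndex n N → ℂ) {I : Fin n →₀ ℕ} (hI : N < I.degree) :
    coeff I (jetPoly c) = 0 := by
  classical
  rw [jetPoly, coeff_sum]
  refine Finset.sum_eq_zero fun J _ => ?_
  rw [coeff_monomial, if_neg]
  rintro rfl
  exact absurd J.2 (not_le.2 hI)

theorem jetPoly_eq {c : JetIndex n N → ℂ} {p : MvPolynomial (Fin n) ℂ}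
    (hp : ∀ I, N < Finsupp.degree I → coeff I p = 0) (h : ∀ J : JetIndex n N, c J = coeff J.1 p) :
    jetPoly c = p := by
  ext I
  by_cases hI : I.degree ≤ N
  · rw [coeff_jetPoly c ⟨I, hI⟩, h]
  · rw [coeff_jetPoly_of_lt c (not_le.1 hI), hp I (not_le.1 hI)]

theorem isPolyFamily_jetPoly {P : Type*} {c : (P → ℂ) → JetIndex n N → ℂ}
    (hc : ∀ J, IsPoly fun x => c x J) : IsPolyFamily fun x => jetPoly (c x) :=
  IsPolyFamily.sum _ fun J _ => IsPolyFamily.monomial _ (hc J)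

/-- The parameters: a linear change of the homogeneous coordinates, a change of the local
coordinates, a germ with a given Newton diagram, and the coefficients of a form. -/
abbrev Params (n d N : ℕ) : Type :=
  (Fin (n + 1) × Fin (n + 1)) ⊕ (Fin n × JetIndex n N) ⊕ JetIndex n N ⊕ Exponents n d

def paramMatrix (x : Params n d N → ℂ) : Matrix (Fin (n + 1)) (Fin (n + 1)) ℂ :=
  Matrix.of fun i j => x (Sum.inl (i, j))

-- The slot of the constant term is a dummy, so that the origin is fixed while the parameters range
-- over a full affine space. Slots outside `E` in `paramGerm` play the same role.
open Classical in
def paramMap (x : Params n d N → ℂ) (i : Fin n) : MvPolynomial (Fin n) ℂ :=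
  jetPoly fun J : JetIndex n N => if J.1 = 0 then 0 else x (Sum.inr (Sum.inl (i, J)))

open Classical in
def paramGerm (E : Set (Fin n →₀ ℕ)) (x : Params n d N → ℂ) : MvPolynomial (Fin n) ℂ :=
  jetPoly fun J : JetIndex n N => if J.1 ∈ E then x (Sum.inr (Sum.inr (Sum.inl J))) else 0

/-- The coefficients of the form whose local equation has the `r`-jet of the composition of the germ
and the change of the local coordinates. -/
def paramCoeff (E : Set (Fin n →₀ ℕ)) (r : ℕ) (x : Params n d N → ℂ) (I : Exponents n d) : ℂ :=
  if I.1.tail.degree ≤ r then coeff I.1.tail (aeval (paramMap x) (paramGerm E x))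
  else x (Sum.inr (Sum.inr (Sum.inr I)))

def paramForm (E : Set (Fin n →₀ ℕ)) (r : ℕ) (x : Params n d N → ℂ) (I : Exponents n d) : ℂ :=
  coeff I.1 (linearSubst (paramMatrix x) (form (paramCoeff E r x)))

/-- Only one inclusion for the singular locus is imposed. The other is automatic once the germ has
type `D` and `r ≥ 1`, by `eval_pderiv_form_eq_zero`. -/
def goodParams (E : Set (Fin n →₀ ℕ)) (𝒯 : Set (Finset (Fin n →₀ ℕ))) (r : ℕ) :
    Set (Params n d N → ℂ) :=
  {x | (paramMatrix x).det ≠ 0 ∧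
    (jacobian fun i => (paramMap x i : MvPowerSeries (Fin n) ℂ)).det ≠ 0 ∧
    (∀ T ∈ 𝒯, ∀ z : Fin n → ℂ, (∀ i, z i ≠ 0) →
      ¬ ∀ i, logGradient T (fun I => coeff I (paramGerm E x)) z i = 0) ∧
    ∀ y : Fin (n + 1) → ℂ, (∀ i, eval y (pderiv i (form (paramCoeff E r x))) = 0) →
      ∀ j : Fin n, y j.succ = 0}

theorem isPolyFamily_paramMap (i : Fin n) : IsPolyFamily fun x : Params n d N → ℂ => paramMap x i := by
  refine isPolyFamily_jetPoly fun J => ?_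
  by_cases hJ : J.1 = 0
  · simp only [if_pos hJ]
    exact IsPoly.const 0
  · simp only [if_neg hJ]
    exact IsPoly.coord _

theorem isPolyFamily_paramGerm (E : Set (Fin n →₀ ℕ)) :
    IsPolyFamily fun x : Params n d N → ℂ => paramGerm E x := by
  refine isPolyFamily_jetPoly fun J => ?_
  by_cases hJ : J.1 ∈ E
  · simp only [if_pos hJ]
    exact IsPoly.coord _
  · simp only [if_neg hJ]
    exact IsPoly.const 0

theorem isPoly_paramCoeff (E : Set (Fin n →₀ ℕ)) (r : ℕ) (I : Exponents n d) :
    IsPoly fun x : Params n d N → ℂ => paramCoeff E r x I := by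
  by_cases hI : I.1.tail.degree ≤ r
  · simp only [paramCoeff, if_pos hI]
    exact ((isPolyFamily_paramGerm E).aeval isPolyFamily_paramMap).coeff _
  · simp only [paramCoeff, if_neg hI]
    exact IsPoly.coord _

theorem isPolyFamily_form (E : Set (Fin n →₀ ℕ)) (r : ℕ) :
    IsPolyFamily fun x : Params n d N → ℂ => form (paramCoeff E r x) :=
  IsPolyFamily.sum _ fun I _ => IsPolyFamily.monomial _ (isPoly_paramCoeff E r I)

theorem isPoly_paramForm (E : Set (Fin n →₀ ℕ)) (r : ℕ) (I : Exponents n d) :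
    IsPoly fun x : Params n d N → ℂ => paramForm E r x I :=
  IsPolyFamily.coeff ((isPolyFamily_form E r).aeval fun _ => IsPolyFamily.sum _ fun j _ =>
    (IsPolyFamily.monomial 0 (IsPoly.coord _)).mul (IsPolyFamily.const (X j))) I.1

theorem isPoly_det_paramMatrix : IsPoly fun x : Params n d N → ℂ => (paramMatrix x).det :=
  IsPoly.det fun _ _ => IsPoly.coord _

theorem isPoly_det_jacobian_paramMap : IsPoly fun x : Params n d N → ℂ =>
    (jacobian fun i => (paramMap x i : MvPowerSeries (Fin n) ℂ)).det := by
  refine IsPoly.det fun i j => ?_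
  simp only [jacobian, Matrix.of_apply, coeff_coe]
  exact (isPolyFamily_paramMap i).coeff _

/-- The quantifiers over `z` and `y` are projections of constructible sets, so Chevalley's theorem
eliminates them. -/
theorem isCon_goodParams (E : Set (Fin n →₀ ℕ)) {𝒯 : Set (Finset (Fin n →₀ ℕ))} (h𝒯 : 𝒯.Finite)
    (r : ℕ) : IsCon (goodParams E 𝒯 r : Set (Params n d N → ℂ)) := by
  have h3 : IsCon {x : Params n d N → ℂ | ∀ T : 𝒯, x ∉ {x : Params n d N → ℂ |
      ∃ z : Fin n → ℂ, (∀ i, z i ≠ 0) ∧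
        ∀ i, logGradient T.1 (fun I => coeff I (paramGerm E x)) z i = 0}} := by
    have := h𝒯.to_subtype
    refine IsCon.forall_finite fun T => IsCon.not (IsCon.exists_finite ?_)
    refine IsCon.inter (S := {z : Params n d N ⊕ Fin n → ℂ | ∀ i, z (Sum.inr i) ≠ 0})
      (IsCon.forall_finite fun i => IsCon.ne_zero (IsPoly.coord (Sum.inr i)))
      (IsCon.forall_finite fun i => IsCon.eq_zero ?_)
    refine IsPoly.sum _ fun I _ => (IsPoly.mul ?_ ?_).mul (IsPoly.const _)
    · exact ((isPolyFamily_paramGerm E).comp fun j => IsPoly.coord (Sum.inl j)).coeff I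
    · exact IsPoly.prod _ fun j _ => (IsPoly.coord (Sum.inr j)).pow _
  have h4 : IsCon {x : Params n d N → ℂ | x ∉ {x : Params n d N → ℂ |
      ∃ y : Fin (n + 1) → ℂ, (∀ i, eval y (pderiv i (form (paramCoeff E r x))) = 0) ∧
        ¬ ∀ j : Fin n, y j.succ = 0}} := by
    refine IsCon.not (IsCon.exists_finite ?_)
    refine IsCon.inter (S := {z : Params n d N ⊕ Fin (n + 1) → ℂ |
      ∀ i, eval (z ∘ Sum.inr) (pderiv i (form (paramCoeff E r (z ∘ Sum.inl)))) = 0})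
      (IsCon.forall_finite fun i => IsCon.eq_zero ?_)
      (IsCon.not (S := {z : Params n d N ⊕ Fin (n + 1) → ℂ | ∀ j : Fin n, z (Sum.inr j.succ) = 0})
        (IsCon.forall_finite fun j => IsCon.eq_zero (IsPoly.coord (Sum.inr j.succ))))
    exact (((isPolyFamily_form E r).comp fun j => IsPoly.coord (Sum.inl j)).pderiv i).eval
      fun j => IsPoly.coord (Sum.inr j)
  convert (IsCon.ne_zero isPoly_det_paramMatrix).inter
    ((IsCon.ne_zero isPoly_det_jacobian_paramMap).inter (h3.inter h4)) using 1
  ext x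
  simp only [goodParams, Set.mem_ofPred_eq, not_exists, not_and, Subtype.forall, not_not]

end NDStratum
end

noncomputable section
namespace NDStratum

/-! ### The density of the good parameters -/

open MvPolynomial MeasureTheory

variable {n d N : ℕ}

theorem IsPoly.ae_ne_zero {P : Type} [Fintype P] {f : (P → ℂ) → ℂ} (hf : IsPoly f) {x : P → ℂ}
    (hx : f x ≠ 0) : ∀ᵐ y : P → ℂ, f y ≠ 0 := by
  obtain ⟨p, hp⟩ := hf
  simp only [hp]
  refine ae_eval_ne_zero ?_
  rintro rfl
  simp [hp] at hx

theorem ae_det_paramMatrix_ne_zero : ∀ᵐ x : Params n d N → ℂ, (paramMatrix x).det ≠ 0 := by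
  refine isPoly_det_paramMatrix.ae_ne_zero
    (x := Sum.elim (fun p => (1 : Matrix (Fin (n + 1)) (Fin (n + 1)) ℂ) p.1 p.2) 0) ?_
  have : paramMatrix (d := d) (N := N)
      (Sum.elim (fun p => (1 : Matrix (Fin (n + 1)) (Fin (n + 1)) ℂ) p.1 p.2) 0) = 1 := by
    ext i j
    rfl
  rw [this, Matrix.det_one]
  exact one_ne_zero

theorem ae_det_jacobian_ne_zero (hN : 1 ≤ N) : ∀ᵐ x : Params n d N → ℂ,
    (jacobian fun i => (paramMap x i : MvPowerSeries (Fin n) ℂ)).det ≠ 0 := by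
  classical
  refine isPoly_det_jacobian_paramMap.ae_ne_zero
    (x := Sum.elim 0 (Sum.elim (fun p => if p.2.1 = Finsupp.single p.1 1 then 1 else 0) 0)) ?_
  rw [show jacobian _ = 1 from ?_, Matrix.det_one]
  · exact one_ne_zero
  · ext i j
    have h1 := coeff_jetPoly (N := N) (fun J : JetIndex n N => if J.1 = 0 then (0 : ℂ) else
      if J.1 = Finsupp.single i 1 then 1 else 0) ⟨Finsupp.single j 1, by simpa using hN⟩
    simp only [Finsupp.single_eq_zero, one_ne_zero, if_false, Finsupp.single_left_inj,
      ne_eq, not_false_eq_true] at h1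
    simp only [jacobian, Matrix.of_apply, coeff_coe, Matrix.one_apply, paramMap, Sum.elim_inr,
      Sum.elim_inl, eq_comm (a := i)]
    exact h1

/-- The exponents of the monomials whose coefficients are parameters. -/
def paramExponent : Params n d N → Fin n →₀ ℕ
  | Sum.inr (Sum.inr (Sum.inl J)) => J.1
  | _ => 0

theorem ae_not_logGradient {E : Set (Fin n →₀ ℕ)} {T : Finset (Fin n →₀ ℕ)}
    (hT : T.Nonempty) (hTE : ∀ I ∈ T, I ∈ E ∧ Finsupp.degree I ≤ N) {w : Fin n → ℝ} {c : ℝ}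
    (hc : c ≠ 0) (hw : ∀ I ∈ T, weight w I = c) :
    ∀ᵐ x : Params n d N → ℂ, ∀ z : Fin n → ℂ, (∀ i, z i ≠ 0) →
      ¬ ∀ i, logGradient T (fun I => coeff I (paramGerm E x)) z i = 0 := by
  classical
  let T' : Finset (Params n d N) := Finset.univ.filter fun p =>
    ∃ J : JetIndex n N, p = Sum.inr (Sum.inr (Sum.inl J)) ∧ J.1 ∈ T
  have hmem : ∀ p, p ∈ T' ↔ ∃ J : JetIndex n N, p = Sum.inr (Sum.inr (Sum.inl J)) ∧ J.1 ∈ T :=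
    fun p => by simp [T']
  have hT' : T'.Nonempty := by
    obtain ⟨I, hI⟩ := hT
    exact ⟨_, (hmem _).2 ⟨⟨I, (hTE I hI).2⟩, rfl, hI⟩⟩
  have hw' : ∀ p ∈ T', weight w (paramExponent p) = c := by
    intro p hp
    obtain ⟨J, rfl, hJ⟩ := (hmem p).1 hp
    exact hw J.1 hJ
  filter_upwards [ae_not_singular paramExponent hT' hc hw'] with x hx z hz h
  refine hx z hz fun i => ?_
  rw [← h i, logGradient]
  refine Finset.sum_nbij paramExponent ?_ ?_ ?_ ?_
  · intro p hp
    obtain ⟨J, rfl, hJ⟩ := (hmem p).1 hp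
    exact hJ
  · intro p hp q hq hpq
    obtain ⟨J, rfl, hJ⟩ := (hmem p).1 hp
    obtain ⟨K, rfl, hK⟩ := (hmem q).1 hq
    have : J = K := Subtype.ext hpq
    rw [this]
  · intro I hI
    exact ⟨_, (hmem _).2 ⟨⟨I, (hTE I hI).2⟩, rfl, hI⟩, rfl⟩
  · intro p hp
    obtain ⟨J, rfl, hJ⟩ := (hmem p).1 hp
    simp only [paramExponent]
    rw [paramGerm, coeff_jetPoly, if_pos (hTE _ hJ).1]

/-- The exponent of the `d`-th power of a homogeneous coordinate other than the first one. -/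
def powerExponent (d : ℕ) (j : Fin n) : Exponents n d :=
  ⟨Finsupp.single j.succ d, by simp⟩

theorem form_add_sum_single (b : Exponents n d → ℂ) (c : Fin n → ℂ) :
    form (b + ∑ j, Pi.single (powerExponent d j) (c j)) =
      form b + ∑ j : Fin n, C (c j) * X j.succ ^ d := by
  classical
  simp only [form, Pi.add_apply, Finset.sum_apply, map_add, map_sum, Finset.sum_add_distrib]
  congr 1
  rw [Finset.sum_comm]
  refine Finset.sum_congr rfl fun j _ => ?_
  rw [Finset.sum_eq_single (powerExponent d j)]
  · rw [Pi.single_eq_same, C_mul_X_pow_eq_monomial]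
    rfl
  · intro I _ hI
    rw [Pi.single_eq_of_ne hI, map_zero]
  · simp

/-- The parameters are changed in such a way that multiples of powers of coordinates are added to
the form. -/
def addPowers (x : Params n d N → ℂ) (c : Fin n → ℂ) : Params n d N → ℂ :=
  x + Sum.elim (fun _ => 0) (Sum.elim (fun _ => 0) (Sum.elim (fun _ => 0) (∑ j, Pi.single (powerExponent d j) (c j))))

theorem paramMatrix_addPowers (x : Params n d N → ℂ) (c : Fin n → ℂ) :
    paramMatrix (addPowers x c) = paramMatrix x := by
  ext i j
  simp [paramMatrix, addPowers]

theorem paramMap_addPowers (x : Params n d N → ℂ) (c : Fin n → ℂ) :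
    paramMap (addPowers x c) = paramMap x := by
  ext1 i
  simp [paramMap, addPowers]

theorem paramGerm_addPowers (E : Set (Fin n →₀ ℕ)) (x : Params n d N → ℂ) (c : Fin n → ℂ) :
    paramGerm E (addPowers x c) = paramGerm E x := by
  simp [paramGerm, addPowers]

/-- As `r < d`, the local monomial of `X j.succ ^ d` lies beyond the prescribed `r`-jet, so its
coefficient is free. -/
theorem paramCoeff_addPowers {r : ℕ} (hrd : r < d) (E : Set (Fin n →₀ ℕ)) (x : Params n d N → ℂ)
    (c : Fin n → ℂ) : paramCoeff E r (addPowers x c) =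
      paramCoeff E r x + ∑ j, Pi.single (powerExponent d j) (c j) := by
  ext I
  by_cases hI : I.1.tail.degree ≤ r
  · rw [paramCoeff, if_pos hI, paramMap_addPowers, paramGerm_addPowers, Pi.add_apply, paramCoeff, if_pos hI, Finset.sum_apply,
      Finset.sum_eq_zero, add_zero]
    intro j _
    rw [Pi.single_eq_of_ne]
    rintro rfl
    have : (powerExponent d j).1.tail = Finsupp.single j d := by
      ext i
      simp [powerExponent, Finsupp.tail_apply, Finsupp.single_apply]
    rw [this, Finsupp.degree_single] at hI
    omega
  · rw [paramCoeff, if_neg hI, Pi.add_apply, paramCoeff, if_neg hI]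
    rfl

theorem continuous_addPowers (x : Params n d N → ℂ) : Continuous (addPowers x) := by
  classical
  refine continuous_pi fun p => ?_
  simp only [addPowers, Pi.add_apply]
  refine continuous_const.add ?_
  rcases p with p | p | p | p
  · exact continuous_const
  · exact continuous_const
  · exact continuous_const
  · simp only [Sum.elim_inr, Finset.sum_apply, Pi.single_apply]
    refine continuous_finsetSum _ fun j _ => ?_
    split
    · exact continuous_apply j
    · exact continuous_const

/-- The first three conditions hold almost everywhere. From such a point, Bertini's theorem is
applied only along the slice `addPowers x`, which leaves those conditions intact and passes
arbitrarily close to `x` through points satisfying the fourth. -/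
theorem dense_goodParams {E : Set (Fin n →₀ ℕ)} {𝒯 : Set (Finset (Fin n →₀ ℕ))} (h𝒯 : 𝒯.Finite)
    (hT : ∀ T ∈ 𝒯, (∀ I ∈ T, I ∈ E ∧ Finsupp.degree I ≤ N) ∧ T.Nonempty ∧
      ∃ (w : Fin n → ℝ) (c : ℝ), c ≠ 0 ∧ ∀ I ∈ T, weight w I = c)
    (hN : 1 ≤ N) {r : ℕ} (hrd : r < d) :
    Dense (goodParams E 𝒯 r : Set (Params n d N → ℂ)) := by
  have h3 : ∀ᵐ x : Params n d N → ℂ, ∀ T ∈ 𝒯, ∀ z : Fin n → ℂ, (∀ i, z i ≠ 0) →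
      ¬ ∀ i, logGradient T (fun I => coeff I (paramGerm E x)) z i = 0 := by
    rw [ae_ball_iff h𝒯.countable]
    intro T hTT
    obtain ⟨h1, h2, w, c, hc, hw⟩ := hT T hTT
    exact ae_not_logGradient h2 h1 hc hw
  have hd := Measure.dense_of_ae (ae_det_paramMatrix_ne_zero.and ((ae_det_jacobian_ne_zero hN).and h3))
  rw [dense_iff_inter_open] at hd ⊢
  intro U hU hUne
  obtain ⟨x, hxU, hx1, hx2, hx3⟩ := hd U hU hUne
  have hb := Measure.dense_of_ae (ae_singular_subset (Nat.ne_zero_of_lt hrd)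
    (form_isHomogeneous (paramCoeff E r x)))
  have h0 : addPowers x 0 = x := by
    ext p
    rcases p with p | p | p | p <;> simp [addPowers]
  obtain ⟨c, hcU, hc⟩ := hb.inter_open_nonempty (addPowers x ⁻¹' U)
    (hU.preimage (continuous_addPowers x)) ⟨0, by rwa [Set.mem_preimage, h0]⟩
  refine ⟨addPowers x c, hcU, ?_, ?_, ?_, ?_⟩
  · rwa [paramMatrix_addPowers]
  · rwa [paramMap_addPowers]
  · rwa [paramGerm_addPowers]
  · rw [paramCoeff_addPowers hrd, form_add_sum_single]
    exact hc

end NDStratum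
end

noncomputable section
namespace NDStratum

/-! ### The stratum is parametrized by the good parameters -/

open MvPolynomial MeasureTheory

variable {n d N : ℕ}

theorem subst_coe_eq_coe_aeval (φ : Fin n → MvPolynomial (Fin n) ℂ) (g : MvPolynomial (Fin n) ℂ) :
    (g : MvPowerSeries (Fin n) ℂ).subst (fun j => (φ j : MvPowerSeries (Fin n) ℂ)) =
      (aeval φ g : MvPolynomial (Fin n) ℂ) := by
  rw [MvPowerSeries.subst_coe]
  induction g using MvPolynomial.induction_on with
  | C a =>
    rw [algHom_C, algHom_C, MvPolynomial.algebraMap_eq, coe_C]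
    rfl
  | add p q hp hq => rw [map_add, map_add, coe_add, hp, hq]
  | mul_X p i hp => rw [map_mul, map_mul, coe_mul, hp, aeval_X, aeval_X]

theorem constantCoeff_paramMap (x : Params n d N → ℂ) (i : Fin n) :
    constantCoeff (paramMap x i) = 0 := by
  rw [constantCoeff_eq]
  exact (coeff_jetPoly _ ⟨0, by simp⟩).trans (if_pos rfl)

theorem coeff_paramMap_of_lt (x : Params n d N → ℂ) (i : Fin n) {I : Fin n →₀ ℕ}
    (hI : N < I.degree) : coeff I (paramMap x i) = 0 := coeff_jetPoly_of_lt _ hI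

theorem coeff_paramGerm_of_lt (E : Set (Fin n →₀ ℕ)) (x : Params n d N → ℂ) {I : Fin n →₀ ℕ}
    (hI : N < I.degree) : coeff I (paramGerm E x) = 0 := coeff_jetPoly_of_lt _ hI

theorem mem_of_coeff_paramGerm_ne_zero {E : Set (Fin n →₀ ℕ)} {x : Params n d N → ℂ}
    {I : Fin n →₀ ℕ} (hI : coeff I (paramGerm E x) ≠ 0) : I ∈ E := by
  by_contra h
  by_cases hN : I.degree ≤ N
  · exact hI ((coeff_jetPoly _ ⟨I, hN⟩).trans (if_neg h))
  · exact hI (coeff_paramGerm_of_lt E x (not_le.1 hN))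

section GermType

variable {D : Set (Fin n → ℝ)} {R : ℕ} {E : Set (Fin n →₀ ℕ)} {𝒯 : Set (Finset (Fin n →₀ ℕ))}

/-- Germs of type `D` are singular. -/
theorem HasNDType.coeff_eq_zero
    (hE : ∀ I, R ≤ Finsupp.degree I → I ∈ E) (hE1 : ∀ I, Finsupp.degree I ≤ 1 → I ∉ E)
    (h𝒯 : ∀ T ∈ 𝒯, ∀ I ∈ T, Finsupp.degree I ≤ R)
    (hD : ∀ h : MvPowerSeries (Fin n) ℂ, (newtonDiagram h = D ∧ IsNewtonNondegenerate h) ↔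
      NDCondition E 𝒯 fun I => MvPowerSeries.coeff I h)
    {f : MvPowerSeries (Fin n) ℂ} (hf : HasNDType D f) {I : Fin n →₀ ℕ} (hI : I.degree ≤ 1) :
    MvPowerSeries.coeff I f = 0 := by
  obtain ⟨φ, g, h1, -, -, -, h5, h6⟩ :=
    (hasNDType_iff_jet hE h𝒯 hD (le_max_right R 1) (le_max_left R 1) f).1 hf
  have h1' : ∀ i, MvPowerSeries.constantCoeff (φ i : MvPowerSeries (Fin n) ℂ) = 0 := fun i => by
    rw [← MvPowerSeries.coeff_zero_eq_constantCoeff_apply, coeff_coe, ← constantCoeff_eq, h1]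
  have hg : ∀ J : Fin n →₀ ℕ, J.degree ≤ 1 → coeff J g = 0 := fun J hJ => by
    by_contra h
    exact hE1 J hJ (h5.1 J h)
  rw [h6 I (hI.trans (le_max_right R 1))]
  rcases Nat.le_one_iff_eq_zero_or_eq_one.1 hI with h | h
  · rw [Finsupp.degree_eq_zero_iff] at h
    rw [h, MvPowerSeries.coeff_zero_eq_constantCoeff_apply]
    refine MvPowerSeries.constantCoeff_subst_eq_zero
      (MvPowerSeries.hasSubst_of_constantCoeff_zero h1') h1' ?_
    rw [← MvPowerSeries.coeff_zero_eq_constantCoeff_apply, coeff_coe]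
    exact hg 0 (by simp)
  · obtain ⟨j, rfl⟩ := exists_eq_single_of_degree_eq_one h
    rw [coeff_single_subst h1']
    refine Finset.sum_eq_zero fun i _ => ?_
    rw [coeff_coe, hg _ (by simp), zero_mul]

theorem hasNDType_paramGerm
    (hE : ∀ I, R ≤ Finsupp.degree I → I ∈ E) (h𝒯 : ∀ T ∈ 𝒯, ∀ I ∈ T, Finsupp.degree I ≤ R)
    (hD : ∀ h : MvPowerSeries (Fin n) ℂ, (newtonDiagram h = D ∧ IsNewtonNondegenerate h) ↔
      NDCondition E 𝒯 fun I => MvPowerSeries.coeff I h)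
    (hN : 1 ≤ N) (hRN : R ≤ N) {r : ℕ} {x : Params n d N → ℂ} (hx : x ∈ goodParams E 𝒯 r) :
    HasNDType D (aeval (paramMap x) (paramGerm E x) : MvPolynomial (Fin n) ℂ) := by
  rw [hasNDType_iff_jet hE h𝒯 hD hN hRN]
  refine ⟨paramMap x, paramGerm E x, constantCoeff_paramMap x,
    fun i I hI => coeff_paramMap_of_lt x i hI, hx.2.1, fun I hI => coeff_paramGerm_of_lt E x hI,
    ⟨fun I hI => mem_of_coeff_paramGerm_ne_zero hI, hx.2.2.1⟩, ?_⟩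
  rw [subst_coe_eq_coe_aeval]
  exact JetEq.refl _

/-- Types of singular germs are not determined by the value of a germ. -/
theorem one_le_of_isDetermined (hn : 1 ≤ n)
    (hE : ∀ I, R ≤ Finsupp.degree I → I ∈ E) (hE1 : ∀ I, Finsupp.degree I ≤ 1 → I ∉ E)
    (h𝒯 : ∀ T ∈ 𝒯, ∀ I ∈ T, Finsupp.degree I ≤ R)
    (hD : ∀ h : MvPowerSeries (Fin n) ℂ, (newtonDiagram h = D ∧ IsNewtonNondegenerate h) ↔
      NDCondition E 𝒯 fun I => MvPowerSeries.coeff I h)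
    {f : MvPolynomial (Fin n) ℂ} (hf : HasNDType D (f : MvPowerSeries (Fin n) ℂ)) {r : ℕ}
    (hr : IsDetermined D r) : 1 ≤ r := by
  by_contra h
  obtain rfl : r = 0 := by omega
  let i : Fin n := ⟨0, hn⟩
  -- Adding a variable keeps the `0`-jet but makes the germ smooth.
  have h1 := hr f (f + X i : MvPolynomial (Fin n) ℂ) (isConvergent_coe _) (isConvergent_coe _) hf
    fun I hI => by
      rw [Nat.le_zero, Finsupp.degree_eq_zero_iff] at hI
      subst hI
      rw [coeff_coe, coeff_coe]
      simp
  have h2 := hf.coeff_eq_zero hE hE1 h𝒯 hD (I := Finsupp.single i 1) (by simp)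
  have h3 := h1.coeff_eq_zero hE hE1 h𝒯 hD (I := Finsupp.single i 1) (by simp)
  rw [coeff_coe] at h2 h3
  simp [h2] at h3

/-- Every monomial has degree at least two in the coordinates that vanish at `y`, so each derivative
retains one of them. -/
theorem eval_pderiv_form_eq_zero {b : Exponents n d → ℂ} (hb : ∀ I, I.1.tail.degree ≤ 1 → b I = 0)
    {y : Fin (n + 1) → ℂ} (hy : ∀ j : Fin n, y j.succ = 0) (i : Fin (n + 1)) :
    eval y (pderiv i (form b)) = 0 := by
  rw [form, map_sum, map_sum]
  refine Finset.sum_eq_zero fun I _ => ?_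
  by_cases hI : I.1.tail.degree ≤ 1
  · rw [hb I hI, monomial_zero, map_zero, map_zero]
  · obtain ⟨j, hj⟩ : ∃ j : Fin n, (I.1 - Finsupp.single i 1 : Fin (n + 1) →₀ ℕ) j.succ ≠ 0 := by
      by_contra! h
      refine hI ?_
      have h1 : ∀ j : Fin n, I.1.tail j ≤ (Finsupp.single i 1 : Fin (n + 1) →₀ ℕ) j.succ := fun j => by
        have := h j
        rw [Finsupp.tsub_apply] at this
        rw [Finsupp.tail_apply]
        omega
      rw [degree_eq_sum]
      refine (Finset.sum_le_sum fun j _ => h1 j).trans ?_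
      have h2 := degree_eq_sum (Finsupp.single i 1)
      rw [Finsupp.degree_single, Fin.sum_univ_succ] at h2
      omega
    rw [pderiv_monomial, eval_monomial, Finsupp.prod_fintype _ _ (by simp),
      Finset.prod_eq_zero (Finset.mem_univ j.succ), mul_zero]
    rw [hy, zero_pow hj]

/-- The linear change puts the singular point at the origin of the chart, where coefficients of the
form and of the local equation coincide. The equality is on the nose, not up to scalars, so the
parametrization covers the whole cone. -/
theorem mk_mem_stratum_iff_exists_goodParams
    (hE : ∀ I, R ≤ Finsupp.degree I → I ∈ E) (hE1 : ∀ I, Finsupp.degree I ≤ 1 → I ∉ E)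
    (h𝒯 : ∀ T ∈ 𝒯, ∀ I ∈ T, Finsupp.degree I ≤ R)
    (hD : ∀ h : MvPowerSeries (Fin n) ℂ, (newtonDiagram h = D ∧ IsNewtonNondegenerate h) ↔
      NDCondition E 𝒯 fun I => MvPowerSeries.coeff I h)
    (hN : 1 ≤ N) (hRN : R ≤ N) (hdN : d ≤ N) {r : ℕ} (hr : IsDetermined D r) (hr1 : 1 ≤ r)
    (hrd : r < d) {v : Exponents n d → ℂ} (hv : v ≠ 0) :
    Projectivization.mk ℂ v hv ∈ stratum n d D ↔
      ∃ x ∈ (goodParams E 𝒯 r : Set (Params n d N → ℂ)), paramForm E r x = v := by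
  rw [mk_mem_stratum_iff (Nat.ne_zero_of_lt hrd) (fun f c hc hf => HasNDType.smul hD hf hc) hv]
  constructor
  · rintro ⟨A, hA, hs, ht⟩
    rw [hasNDType_iff_jet hE h𝒯 hD hN hRN] at ht
    obtain ⟨φ, g, h1, h2, h3, h4, h5, h6⟩ := ht
    have hF := linearSubst_isHomogeneous A (form_isHomogeneous v)
    let b : Exponents n d → ℂ := fun I => coeff I.1 (linearSubst A (form v))
    have hb : form b = linearSubst A (form v) := form_coeff hF
    -- `paramForm` carries the normalized form back to `v`, hence `A⁻¹`; the free slots record the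
    -- normalized form itself.
    let x : Params n d N → ℂ := Sum.elim (fun p => A⁻¹ p.1 p.2) (Sum.elim
      (fun p => coeff p.2.1 (φ p.1)) (Sum.elim (fun J => coeff J.1 g) b))
    have hx1 : paramMatrix x = A⁻¹ := rfl
    have hx2 : paramMap x = φ := by
      ext1 i
      refine jetPoly_eq (h2 i) fun J => ?_
      split_ifs with hJ
      · rw [hJ, ← constantCoeff_eq, h1]
      · rfl
    have hx3 : paramGerm E x = g := by
      refine jetPoly_eq h4 fun J => ?_
      split_ifs with hJ
      · rfl
      · by_contra h
        exact hJ (h5.1 J.1 (Ne.symm h))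
    have hx4 : paramCoeff E r x = b := by
      ext I
      by_cases hI : I.1.tail.degree ≤ r
      · rw [paramCoeff, if_pos hI, hx2, hx3, ← coeff_localEquation_form b I, hb]
        have := h6 I.1.tail (hI.trans (hrd.le.trans hdN))
        rw [subst_coe_eq_coe_aeval, coeff_coe, coeff_coe] at this
        exact this.symm
      · rw [paramCoeff, if_neg hI]
        rfl
    refine ⟨x, ⟨?_, ?_, ?_, ?_⟩, ?_⟩
    · rw [hx1]
      exact (Matrix.isUnit_nonsing_inv_det _ hA).ne_zero
    · rwa [hx2]
    · rw [hx3]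
      exact h5.2
    · rw [hx4, hb]
      exact fun y => (hs y).1
    · ext I
      rw [paramForm, hx1, hx4, hb, linearSubst_linearSubst, Matrix.mul_nonsing_inv _ hA,
        linearSubst_one, coeff_form]
  · rintro ⟨x, hx, rfl⟩
    have hB : IsUnit (paramMatrix x).det := hx.1.isUnit
    have ht := hasNDType_paramGerm hE h𝒯 hD hN hRN hx
    have hform : linearSubst (paramMatrix x)⁻¹ (form (paramForm E r x)) =
        form (paramCoeff E r x) := by
      have : form (paramForm E r x) = linearSubst (paramMatrix x) (form (paramCoeff E r x)) :=
        form_coeff (linearSubst_isHomogeneous _ (form_isHomogeneous _))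
      rw [this, linearSubst_linearSubst, Matrix.mul_nonsing_inv _ hB, linearSubst_one]
    refine ⟨(paramMatrix x)⁻¹, Matrix.isUnit_nonsing_inv_det _ hB, ?_, ?_⟩ <;> rw [hform]
    · refine fun y => ⟨hx.2.2.2 y, fun hy => eval_pderiv_form_eq_zero (fun I hI => ?_) hy⟩
      -- As `r ≥ 1`, the `1`-jet is prescribed by a germ of type `D`, whose `1`-jet is zero.
      rw [paramCoeff, if_pos (hI.trans hr1), ← coeff_coe]
      exact ht.coeff_eq_zero hE hE1 h𝒯 hD hI
    · refine hr _ _ (isConvergent_coe _) (isConvergent_coe _) ht fun J hJ => ?_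
      have h1 := coeff_localEquation_form (paramCoeff E r x)
        (homogenizeExponent J (hJ.trans hrd.le))
      have h2 : (homogenizeExponent J (hJ.trans hrd.le) : Exponents n d).1.tail = J :=
        Finsupp.tail_cons _ _
      rw [h2, paramCoeff, h2, if_pos hJ] at h1
      rw [coeff_coe, coeff_coe, h1]

/-- For the zero form every vector would be singular, including one with nonzero tail. -/
theorem paramForm_ne_zero (hn : 1 ≤ n) {r : ℕ} {x : Params n d N → ℂ}
    (hx : x ∈ goodParams E 𝒯 r) : paramForm E r x ≠ 0 := by
  intro h
  have hB : IsUnit (paramMatrix x).det := hx.1.isUnit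
  have h1 : linearSubst (paramMatrix x) (form (paramCoeff E r x)) = 0 := by
    rw [← form_coeff (linearSubst_isHomogeneous (paramMatrix x) (form_isHomogeneous
      (paramCoeff E r x)))]
    change form (paramForm E r x) = 0
    simp [h, form]
  have h2 : form (paramCoeff E r x) = 0 := by
    rw [← linearSubst_one (form (paramCoeff E r x)), ← Matrix.mul_nonsing_inv _ hB,
      ← linearSubst_linearSubst, h1, map_zero]
  have h3 := hx.2.2.2 (fun _ => 1) (fun i => by rw [h2, map_zero, map_zero]) ⟨0, hn⟩
  exact one_ne_zero h3

end GermType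

end NDStratum
end

/-! ### The theorem -/

theorem mainTheorem11 (n : ℕ) (hn : 1 ≤ n) (D : Set (Fin n → ℝ))
    (hD : NDStratum.IsCommodeDiagram D) :
    (∃ r : ℕ, NDStratum.IsDetermined D r) ∧
    ∀ d r : ℕ, NDStratum.IsDetermined D r → r < d →
      (NDStratum.stratum n d D).Nonempty ∧
      @Topology.IsConstructible _ (NDStratum.zariskiTopology (NDStratum.Exponents n d))
        (NDStratum.stratum n d D) ∧
      @IsIrreducible _ (NDStratum.zariskiTopology (NDStratum.Exponents n d))
        (NDStratum.stratum n d D) ∧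
      @IsClosed _ (NDStratum.zariskiTopology (NDStratum.Exponents n d))
        (NDStratum.classicalClosure (NDStratum.stratum n d D)) ∧
      @IsIrreducible _ (NDStratum.zariskiTopology (NDStratum.Exponents n d))
        (NDStratum.classicalClosure (NDStratum.stratum n d D)) := by
  obtain ⟨R, E, 𝒯, h𝒯, hE, hE1, hT, hND⟩ := NDStratum.exists_ndCondition hn hD
  have h𝒯R : ∀ T ∈ 𝒯, ∀ I ∈ T, Finsupp.degree I ≤ R := fun T hTT I hI => ((hT T hTT).1 I hI).2
  refine ⟨⟨R, NDStratum.isDetermined_of_ndCondition hE h𝒯R hND⟩, fun d r hr hrd => ?_⟩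
  -- The degree `d` may be smaller than `R`, which need not be the least order of determinacy; jets
  -- of order `max R d` see both the type and all coefficients of the form.
  have hdN : d ≤ max R d := le_max_right R d
  have hRN : R ≤ max R d := le_max_left R d
  have hN : 1 ≤ max R d := (Nat.one_le_of_lt hrd).trans hdN
  have hdense := NDStratum.dense_goodParams (n := n) (N := max R d) h𝒯
    (fun T hTT => ⟨fun I hI => ⟨((hT T hTT).1 I hI).1, (h𝒯R T hTT I hI).trans hRN⟩,
      (hT T hTT).2⟩) hN hrd
  obtain ⟨x, hx⟩ := hdense.nonempty
  have hr1 : 1 ≤ r := NDStratum.one_le_of_isDetermined hn hE hE1 h𝒯R hND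
    (NDStratum.hasNDType_paramGerm hE h𝒯R hND hN hRN hx) hr
  exact NDStratum.conclusions_of_parametrization hdense (NDStratum.isCon_goodParams E h𝒯 r)
    (NDStratum.isPoly_paramForm E r) (fun x hx => NDStratum.paramForm_ne_zero hn hx)
    fun v hv => NDStratum.mk_mem_stratum_iff_exists_goodParams hE hE1 h𝒯R hND hN hRN hdN hr hr1 hrd hv
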